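/- **Setting.** The Farey graph has vertex set $\mathbb{Q}\cup\{\infty\}$ ($\infty=\frac10$, other fractions in lowest terms with positive denominator), and $\frac pq\sim\frac ab$ iff $|pb-qa|=1$. A Farey triple with center $\frac pq$ is a triple $\frac ab<\frac pq<\frac cd$ (with $\infty=\frac10$ placed to the right of all rationals) such that $\frac ab\sim\frac cd$, $p=a+c$, $q=b+d$; then $(\frac ab,\frac cd)$, which is determined by $\frac pq$, are the immediate precedents of $\frac pq$. Let $H_{p/q}$ be the horoball centered at $\frac pq$ of the maximal $\mathrm{PSL}(2,\mathbb{Z})$-invariant horoball packing of the upper half-plane $\mathbb{H}^2$: $H_\infty=\{\operatorname{Im} z>1\}$, and $H_{p/q}$ is the disc of Euclidean diameter $1/q^2$ tangent to $\mathbb{R}$ at $\frac pq$. Let $\mathcal{H}$ be the set of the bounded horoballs $H_{p/q}$ meeting $\{0<\operatorname{Re} z<1\}$. The Farey label of $H=H_{p/q}$ is $\lambda_{\mathcal F}(H)=\frac pq$, and the immediate precedents of $H_{p/q}$ are the horoballs centered at those of $\frac pq$. The Markov labelling $\lambda_{\mathcal M}$ is defined inductively: $\lambda_{\mathcal M}(H_\infty)=\lambda_{\mathcal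 M}(H_0)=\lambda_{\mathcal M}(H_{-1})=1$, and for $v>0$, if $(H_1,H_2)$ are the immediate precedents of $H_v$ and $K\neq H_v$ is the other horoball of the packing whose center is a common Farey neighbour of the centers of $H_1$ and $H_2$, then $\lambda_{\mathcal M}(H_v)=3\lambda_{\mathcal M}(H_1)\lambda_{\mathcal M}(H_2)-\lambda_{\mathcal M}(K)$. The fractional Markov labelling $\lambda_{\mathcal{FM}}$ is defined inductively: $\lambda_{\mathcal{FM}}(H_\infty)=\frac11$, $\lambda_{\mathcal{FM}}(H_0)=\frac01$, $\lambda_{\mathcal{FM}}(H_{-1})=\frac{-1}1$, and for $v>0$, if $(H_1,H_2)$ are the immediate precedents of $H_v$, with labels $\frac{k_1}{n_1},\frac{k_2}{n_2}$ in lowest terms, then $$\lambda_{\mathcal{FM}}(H_v)=\frac{(k_1n_1+k_2n_2)/(k_2n_1-k_1n_2)}{3n_1n_2-(k_2n_1-k_1n_2)}.$$ Let $\Gamma$ be the commutator subgroup of $\mathrm{PSL}(2,\mathbb{Z})$, free on $\alpha=\begin{pmatrix}2&1\\1&1\end{pmatrix}$ and $\beta=\begin{pmatrix}2&-1\\-1&1\end{pmatrix}$,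 and let $\mathfrak{X}=\mathbb{H}^2/\Gamma$ be the modular torus. Identify $H_1(\mathfrak{X},\mathbb{Z})=\Gamma^{\mathrm{ab}}$ with $\mathbb{Z}^2$ so that $[\alpha]=(1,-1)$ and $[\beta]=(0,1)$. For a reduced fraction $\frac pq$, let $\gamma_{p/q}$ be the simple closed geodesic on $\mathfrak{X}$ in the homology class $(q,p)$. A simple proper geodesic arc is the image in $\mathfrak{X}$ of a complete geodesic of $\mathbb{H}^2$ on which the projection $\mathbb{H}^2\to\mathfrak{X}$ is injective and proper. An ideal triangulation is a family of pairwise disjoint simple proper geodesic arcs whose complement is a union of embedded open ideal triangles with sides projecting to arcs of the family. **Proposition.** Let $H\in\mathcal{H}$ and $\lambda_{\mathcal{FM}}(H)=\frac kn$ with $k\in\mathbb{Z}$, $n\ge1$ and $\gcd(k,n)=1$. Then: 1. $\lambda_{\mathcal M}(H)=n$. 2. $k^2\equiv-1\pmod n$. 3. There is exactly one simple closed geodesic $\gamma_{\lambda_{\mathcal F}(H)}$ as above, and the projection of $\{\operatorname{Re} z=\frac kn\}$ to $\mathfrak{X}$ is the unique simple proper geodesic arc on $\mathfrak{X}$ disjoint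 from it. 4. If $(H_1,H_2)$ are the immediate precedents of $H$ and $\lambda_{\mathcal{FM}}(H_i)=\frac{k_i}{n_i}$, then $\frac{k_1}{n_1}<\frac kn<\frac{k_2}{n_2}$, and the projections of $\{\operatorname{Re} z=\frac{k_1}{n_1}\}$, $\{\operatorname{Re} z=\frac{k_2}{n_2}\}$, $\{\operatorname{Re} z=\frac kn\}$ form an ideal triangulation of $\mathfrak{X}$; along the boundary of each complementary ideal triangle, traversed counterclockwise, the three sides are the arcs $\{\operatorname{Re} z=\frac{k_1}{n_1}\}$, $\{\operatorname{Re} z=\frac{k_2}{n_2}\}$, $\{\operatorname{Re} z=\frac kn\}$, in that cyclic order. -/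

import Mathlib

open UpperHalfPlane
open scoped MatrixGroups commutatorElement

namespace MarkovTorus

/-! ### The Farey graph -/

/-- Vertices of the Farey graph, `ℚ ∪ {∞}`.  The order of `WithTop ℚ` puts `∞ = 1/0` on the
right of every rational. -/
abbrev Vertex := WithTop ℚ

/-- Numerator in lowest terms, with `∞ = 1/0`. -/
def vnum : Vertex → ℤ
  | ⊤ => 1
  | (r : ℚ) => r.num

/-- (Nonnegative) denominator in lowest terms, with `∞ = 1/0`. -/
def vden : Vertex → ℤ
  | ⊤ => 0
  | (r : ℚ) => r.den

/-- Adjacency in the Farey graph: `p/q ∼ a/b` iff `|p b - q a| = 1`. -/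
def FareyAdj (u v : Vertex) : Prop := |vnum u * vden v - vden u * vnum v| = 1

/-- `u = a/b < v = p/q < w = c/d` is a Farey triple with center `v`: `a/b` and `c/d` are Farey
neighbours, and `p = a + c`, `q = b + d`. -/
structure IsFareyTriple (u v w : Vertex) : Prop where
  lt_left : u < v
  lt_right : v < w
  adj : FareyAdj u w
  num_eq : vnum v = vnum u + vnum w
  den_eq : vden v = vden u + vden w

/-! ### The labellings of the vertices -/

/-- `IsMarkovLabel v m`: the inductive procedure defining the Markov labelling puts `m` at `v`.
The labels at `∞, 0, -1` are `1`; if `(u, w)` are the immediate precedents of `v` and `t` is the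
vertex on the other side of the Farey edge `uw`, then the label of `v` is `3xy - z`, where
`x, y, z` are the labels of `u, w, t`. -/
inductive IsMarkovLabel : Vertex → ℤ → Prop
  | top : IsMarkovLabel ⊤ 1
  | zero : IsMarkovLabel ((0 : ℚ) : Vertex) 1
  | neg_one : IsMarkovLabel ((-1 : ℚ) : Vertex) 1
  | step {u v w t : Vertex} {x y z : ℤ} (hpos : ((0 : ℚ) : Vertex) < v)
      (hv : IsFareyTriple u v w) (hu : FareyAdj t u) (hw : FareyAdj t w) (ht : t ≠ v)
      (hx : IsMarkovLabel u x) (hy : IsMarkovLabel w y) (hz : IsMarkovLabel t z) :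
      IsMarkovLabel v (3 * x * y - z)

/-- The rule computing a fractional Markov label from the labels `k₁/n₁` and `k₂/n₂` (in lowest
terms) of the immediate precedents. -/
def fractionalRule (x y : ℚ) : ℚ :=
  ((x.num * x.den + y.num * y.den : ℚ) / (y.num * x.den - x.num * y.den : ℚ)) /
    (3 * x.den * y.den - (y.num * x.den - x.num * y.den) : ℚ)

/-- `IsFractionalLabel v x`: the inductive procedure defining the fractional Markov labelling puts
`x` at `v`.  The labels at `∞, 0, -1` are `1/1, 0/1, -1/1`. -/
inductive IsFractionalLabel : Vertex → ℚ → Prop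
  | top : IsFractionalLabel ⊤ 1
  | zero : IsFractionalLabel ((0 : ℚ) : Vertex) 0
  | neg_one : IsFractionalLabel ((-1 : ℚ) : Vertex) (-1)
  | step {u v w : Vertex} {x y : ℚ} (hpos : ((0 : ℚ) : Vertex) < v)
      (hv : IsFareyTriple u v w) (hx : IsFractionalLabel u x) (hy : IsFractionalLabel w y) :
      IsFractionalLabel v (fractionalRule x y)

lemma vertex_ext {u v : Vertex} (h1 : vnum u = vnum v) (h2 : vden u = vden v) : u = v := by
  cases u using WithTop.recTopCoe with
  | top => cases v using WithTop.recTopCoe with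
    | top => rfl
    | coe s =>
      have := s.den_pos
      simp only [vden] at h2
      omega
  | coe r => cases v using WithTop.recTopCoe with
    | top =>
      have := r.den_pos
      simp only [vden] at h2
      omega
    | coe s =>
      simp only [vnum, vden] at h1 h2
      congr 1
      exact Rat.ext h1 (by exact_mod_cast h2)

lemma den_nonneg (v : Vertex) : 0 ≤ vden v := by
  cases v using WithTop.recTopCoe <;> simp [vden]

lemma num_eq_one_of_den_eq_zero {v : Vertex} (h : vden v = 0) : vnum v = 1 := by
  cases v using WithTop.recTopCoe with
  | top => rfl
  | coe r =>
    have := r.den_pos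
    simp only [vden] at h
    omega

lemma det_pos_of_lt {u v : Vertex} (h : u < v) : 0 < vnum v * vden u - vden v * vnum u := by
  cases u using WithTop.recTopCoe with
  | top => exact absurd h not_top_lt
  | coe r => cases v using WithTop.recTopCoe with
    | top =>
      have := r.den_pos
      simp only [vnum, vden]
      omega
    | coe s =>
      have h' : r < s := by exact_mod_cast h
      rw [Rat.lt_iff] at h'
      simp only [vnum, vden]
      linarith [mul_comm s.num (r.den : ℤ), mul_comm r.num (s.den : ℤ)]

lemma IsFareyTriple.det {u v w : Vertex} (h : IsFareyTriple u v w) :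
    vnum w * vden u - vden w * vnum u = 1 := by
  have h1 := det_pos_of_lt (h.lt_left.trans h.lt_right)
  have h2 := h.adj
  rw [FareyAdj, abs_eq (by norm_num)] at h2
  rcases h2 with h2 | h2 <;> linarith [mul_comm (vnum u) (vden w), mul_comm (vnum w) (vden u)]

lemma IsFareyTriple.den_left_pos {u v w : Vertex} (h : IsFareyTriple u v w) : 0 < vden u := by
  have h1 := h.lt_left
  cases u using WithTop.recTopCoe with
  | top => exact absurd h1 not_top_lt
  | coe r => simpa [vden] using r.den_pos

/-- A vertex is the center of at most one Farey triple. -/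
lemma IsFareyTriple.unique {u v w u' w' : Vertex} (h : IsFareyTriple u v w)
    (h' : IsFareyTriple u' v w') : u = u' ∧ w = w' := by
  have e1 := h.det
  have e2 := h'.det
  have p1 := h.den_left_pos
  have p2 := h'.den_left_pos
  have d1 := den_nonneg w
  have d2 := den_nonneg w'
  have a1 := h.num_eq
  have a2 := h'.num_eq
  have b1 := h.den_eq
  have b2 := h'.den_eq
  have c1 : vnum v * vden u - vden v * vnum u = 1 := by rw [a1, b1]; linarith
  have c2 : vnum v * vden u' - vden v * vnum u' = 1 := by rw [a2, b2]; linarith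
  have hq : 0 < vden v := by omega
  have hcop : IsCoprime (vden v) (vnum v) := ⟨-vnum u, vden u, by linarith⟩
  have hdvd : vden v ∣ vden u - vden u' := by
    refine hcop.dvd_of_dvd_mul_left ⟨vnum u - vnum u', ?_⟩
    linarith
  have hden : vden u = vden u' := by
    have := Int.eq_zero_of_abs_lt_dvd hdvd (by rw [abs_lt]; constructor <;> omega)
    omega
  have hnum : vnum u = vnum u' := by
    rw [hden] at c1
    have : vden v * vnum u = vden v * vnum u' := by linarith
    exact mul_left_cancel₀ hq.ne' this
  exact ⟨vertex_ext hnum hden, vertex_ext (by omega) (by omega)⟩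

/-- A Farey edge lies in at most one triangle besides a given one. -/
lemma IsFareyTriple.opposite_unique {u v w t t' : Vertex} (h : IsFareyTriple u v w)
    (hu : FareyAdj t u) (hw : FareyAdj t w) (ht : t ≠ v)
    (hu' : FareyAdj t' u) (hw' : FareyAdj t' w) (ht' : t' ≠ v) : t = t' := by
  have key : ∀ s : Vertex, FareyAdj s u → FareyAdj s w → s ≠ v →
      (vnum s = vnum u - vnum w ∧ vden s = vden u - vden w) ∨
      (vnum s = vnum w - vnum u ∧ vden s = vden w - vden u) := by
    intro s h1 h2 h3
    have e := h.det
    have p := h.den_left_pos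
    have d := den_nonneg w
    have ds := den_nonneg s
    have a := h.num_eq
    have b := h.den_eq
    rw [FareyAdj, abs_eq (by norm_num)] at h1 h2
    have i1 : vnum s = vnum w * (vnum s * vden u - vden s * vnum u)
        - vnum u * (vnum s * vden w - vden s * vnum w) := by linear_combination (-(vnum s)) * e
    have i2 : vden s = vden w * (vnum s * vden u - vden s * vnum u)
        - vden u * (vnum s * vden w - vden s * vnum w) := by linear_combination (-(vden s)) * e
    rcases h1 with h1 | h1 <;> rcases h2 with h2 | h2 <;> rw [h1, h2] at i1 i2
    · right; constructor <;> linarith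
    · exact absurd (vertex_ext (by linarith) (by linarith)) h3
    · omega
    · left; constructor <;> linarith
  have ds := den_nonneg t
  have ds' := den_nonneg t'
  rcases key t hu hw ht with ⟨k1, k2⟩ | ⟨k1, k2⟩ <;>
    rcases key t' hu' hw' ht' with ⟨l1, l2⟩ | ⟨l1, l2⟩
  · exact vertex_ext (by omega) (by omega)
  · have z1 : vden t = 0 := by omega
    have z2 : vden t' = 0 := by omega
    exact vertex_ext (by rw [num_eq_one_of_den_eq_zero z1, num_eq_one_of_den_eq_zero z2])
      (by omega)
  · have z1 : vden t = 0 := by omega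
    have z2 : vden t' = 0 := by omega
    exact vertex_ext (by rw [num_eq_one_of_den_eq_zero z1, num_eq_one_of_den_eq_zero z2])
      (by omega)
  · exact vertex_ext (by omega) (by omega)

lemma exists_vertex {a b : ℤ} (hb : 0 < b) (h : IsCoprime a b) :
    ∃ r : ℚ, r.num = a ∧ (r.den : ℤ) = b := by
  have h' : Nat.Coprime a.natAbs b.natAbs := Int.isCoprime_iff_gcd_eq_one.mp h
  exact ⟨a / b, Rat.num_div_eq_of_coprime hb h', Rat.den_div_eq_of_coprime hb h'⟩

/-- The vertices from which the label at `r` is computed are labelled earlier. -/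
def Earlier (r : ℚ) (v : Vertex) : Prop :=
  v = ⊤ ∨ v = ((-1 : ℚ) : Vertex) ∨ ∃ s : ℚ, v = s ∧ 0 ≤ s ∧ s.num + s.den < r.num + r.den

lemma exists_step (r : ℚ) (hr : 0 < r) : ∃ u w t : Vertex, IsFareyTriple u r w ∧
    FareyAdj t u ∧ FareyAdj t w ∧ t ≠ r ∧ Earlier r u ∧ Earlier r w ∧ Earlier r t := by
  have hp : 0 < r.num := Rat.num_pos.mpr hr
  have hq : (0 : ℤ) < r.den := by exact_mod_cast r.den_pos
  have hcop : IsCoprime r.num (r.den : ℤ) := Rat.isCoprime_num_den r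
  rcases eq_or_ne (r.den : ℤ) 1 with h1 | h1
  · obtain ⟨u, hu1, hu2⟩ := exists_vertex (a := r.num - 1) (b := 1) one_pos isCoprime_one_right
    obtain ⟨t, ht1, ht2⟩ := exists_vertex (a := r.num - 2) (b := 1) one_pos isCoprime_one_right
    have hur : u < r := by rw [Rat.lt_iff, hu1, hu2, h1]; linarith
    refine ⟨u, ⊤, t, ⟨by exact_mod_cast hur, WithTop.coe_lt_top r, ?_, ?_, ?_⟩, ?_, ?_, ?_,
      ?_, Or.inl rfl, ?_⟩
    · simp [FareyAdj, vnum, vden, hu2]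
    · simp [vnum, hu1]
    · simp only [vden, hu2, h1]; norm_num
    · simp only [FareyAdj, vnum, vden, hu1, hu2, ht1, ht2]; ring_nf; norm_num
    · simp only [FareyAdj, vnum, vden, ht1, ht2]; norm_num
    · intro h
      have : t = r := by exact_mod_cast h
      rw [this] at ht1
      omega
    · refine Or.inr (Or.inr ⟨u, rfl, ?_, by omega⟩)
      rw [← Rat.num_nonneg]; omega
    · rcases lt_or_ge r.num 2 with h2 | h2
      · right; left
        have : t = -1 := Rat.ext (by simp; omega) (by simp; omega)
        rw [this]
      · refine Or.inr (Or.inr ⟨t, rfl, ?_, by omega⟩)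
        rw [← Rat.num_nonneg]; omega
  · obtain ⟨x, y, hxy⟩ := hcop
    set p := r.num with hpdef
    set q : ℤ := (r.den : ℤ) with hqdef
    obtain ⟨b, a, hb0, hbq, hab⟩ : ∃ b a : ℤ, 0 < b ∧ b < q ∧ p * b - q * a = 1 := by
      have hdm := Int.emod_add_mul_ediv x q
      have hab : p * (x % q) - q * (-y - p * (x / q)) = 1 := by
        linear_combination hxy + p * hdm
      refine ⟨x % q, _, ?_, Int.emod_lt_of_pos _ hq, hab⟩
      rcases (Int.emod_nonneg x hq.ne').lt_or_eq with h | h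
      · exact h
      · rw [← h] at hab
        have : q ∣ 1 := ⟨-(-y - p * (x / q)), by linear_combination -hab⟩
        have := Int.eq_one_of_dvd_one hq.le this
        exact absurd this h1
    have ha0 : 0 ≤ a := by
      by_contra hneg
      push Not at hneg
      nlinarith
    have hap : a < p := by
      by_contra hge
      push Not at hge
      nlinarith
    obtain ⟨u, hu1, hu2⟩ := exists_vertex (a := a) (b := b) hb0 ⟨-q, p, by linarith⟩
    obtain ⟨w, hw1, hw2⟩ := exists_vertex (a := p - a) (b := q - b) (by omega)
      ⟨b, -a, by linear_combination hab⟩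
    have hur : u < r := by rw [Rat.lt_iff, hu1, hu2, ← hpdef, ← hqdef]; linarith
    have hrw : r < w := by
      rw [Rat.lt_iff, hw1, hw2, ← hpdef, ← hqdef]; linarith
    have htri : IsFareyTriple u r w := by
      refine ⟨by exact_mod_cast hur, by exact_mod_cast hrw, ?_, ?_, ?_⟩
      · have : a * (q - b) - b * (p - a) = -1 := by linear_combination -hab
        simp [FareyAdj, vnum, vden, hu1, hu2, hw1, hw2, this]
      · simp only [vnum, hu1, hw1]; linarith
      · simp only [vden, hu2, hw2]; linarith
    have hEu : Earlier r u := by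
      refine Or.inr (Or.inr ⟨u, rfl, ?_, by omega⟩)
      rw [← Rat.num_nonneg]; omega
    have hEw : Earlier r w := by
      refine Or.inr (Or.inr ⟨w, rfl, ?_, by omega⟩)
      rw [← Rat.num_nonneg]; omega
    have hdet : (p - a) * b - (q - b) * a = 1 := by linear_combination hab
    rcases lt_trichotomy b (q - b) with hlt | heq | hgt
    · have hca : a ≤ p - a := by nlinarith
      obtain ⟨t, ht1, ht2⟩ := exists_vertex (a := p - a - a) (b := q - b - b) (by omega)
        ⟨b, -a, by linear_combination hdet⟩
      refine ⟨u, w, t, htri, ?_, ?_, ?_, hEu, hEw, Or.inr (Or.inr ⟨t, rfl, ?_, by omega⟩)⟩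
      · have : (p - a - a) * b - (q - b - b) * a = 1 := by linear_combination hdet
        simp [FareyAdj, vnum, vden, hu1, hu2, ht1, ht2, this]
      · have : (p - a - a) * (q - b) - (q - b - b) * (p - a) = 1 := by linear_combination hdet
        simp [FareyAdj, vnum, vden, hw1, hw2, ht1, ht2, this]
      · intro h
        have : t = r := by exact_mod_cast h
        rw [this] at ht2
        omega
      · rw [← Rat.num_nonneg]; omega
    · have hb1 : b = 1 := by
        have : b ∣ 1 := ⟨p - a - a, by rw [← heq] at hdet; linear_combination -hdet⟩
        exact Int.eq_one_of_dvd_one hb0.le this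
      refine ⟨u, w, ⊤, htri, ?_, ?_, ?_, hEu, hEw, Or.inl rfl⟩
      · simp [FareyAdj, vnum, vden, hu2, hb1]
      · simp [FareyAdj, vnum, vden, hw2, show q - b = 1 by omega]
      · exact WithTop.top_ne_coe
    · have hca : p - a ≤ a := by nlinarith
      obtain ⟨t, ht1, ht2⟩ := exists_vertex (a := a - (p - a)) (b := b - (q - b)) (by omega)
        ⟨-b, a, by linear_combination hdet⟩
      refine ⟨u, w, t, htri, ?_, ?_, ?_, hEu, hEw, Or.inr (Or.inr ⟨t, rfl, ?_, by omega⟩)⟩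
      · have : (a - (p - a)) * b - (b - (q - b)) * a = -1 := by linear_combination -hdet
        simp [FareyAdj, vnum, vden, hu1, hu2, ht1, ht2, this]
      · have : (a - (p - a)) * (q - b) - (b - (q - b)) * (p - a) = -1 := by
          linear_combination -hdet
        simp [FareyAdj, vnum, vden, hw1, hw2, ht1, ht2, this]
      · intro h
        have : t = r := by exact_mod_cast h
        rw [this] at ht2
        omega
      · rw [← Rat.num_nonneg]; omega

/-- The vertices that carry a label: `∞`, `-1` and the nonnegative rationals. -/
def Labelled (v : Vertex) : Prop := v = ((-1 : ℚ) : Vertex) ∨ ((0 : ℚ) : Vertex) ≤ v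

lemma exists_labels {v : Vertex} (hv : Labelled v) :
    (∃ m, IsMarkovLabel v m) ∧ ∃ x, IsFractionalLabel v x := by
  have key : ∀ N : ℕ, ∀ s : ℚ, 0 ≤ s → s.num + s.den < N →
      (∃ m, IsMarkovLabel s m) ∧ ∃ x, IsFractionalLabel s x := by
    intro N
    induction N with
    | zero =>
      intro s hs h
      have := Rat.num_nonneg.mpr hs
      have := s.den_pos
      omega
    | succ N ih =>
      intro s hs h
      rcases hs.eq_or_lt with h0 | hpos
      · rw [← h0]
        exact ⟨⟨1, .zero⟩, ⟨0, .zero⟩⟩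
      · obtain ⟨u, w, t, htri, h1, h2, h3, eu, ew, et⟩ := exists_step s hpos
        have lab : ∀ z : Vertex, Earlier s z →
            (∃ m, IsMarkovLabel z m) ∧ ∃ x, IsFractionalLabel z x := by
          rintro z (rfl | rfl | ⟨z, rfl, hz, hlt⟩)
          · exact ⟨⟨_, .top⟩, ⟨_, .top⟩⟩
          · exact ⟨⟨_, .neg_one⟩, ⟨_, .neg_one⟩⟩
          · exact ih z hz (by push_cast at h; omega)
        obtain ⟨⟨mu, hmu⟩, ⟨xu, hxu⟩⟩ := lab u eu
        obtain ⟨⟨mw, hmw⟩, ⟨xw, hxw⟩⟩ := lab w ew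
        obtain ⟨⟨mt, hmt⟩, -⟩ := lab t et
        have hpos' : ((0 : ℚ) : Vertex) < (s : Vertex) := by exact_mod_cast hpos
        exact ⟨⟨_, .step hpos' htri h1 h2 h3 hmu hmw hmt⟩, ⟨_, .step hpos' htri hxu hxw⟩⟩
  rcases hv with rfl | hv
  · exact ⟨⟨_, .neg_one⟩, ⟨_, .neg_one⟩⟩
  · cases v using WithTop.recTopCoe with
    | top => exact ⟨⟨_, .top⟩, ⟨_, .top⟩⟩
    | coe s =>
      have hs : 0 ≤ s := by exact_mod_cast hv
      have := Rat.num_nonneg.mpr hs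
      exact key ((s.num + s.den).toNat + 1) s hs (by push_cast; omega)

lemma not_zero_lt_neg_one : ¬ ((0 : ℚ) : Vertex) < ((-1 : ℚ) : Vertex) := by
  rw [WithTop.coe_lt_coe]; norm_num

lemma IsMarkovLabel.unique {v : Vertex} {m m' : ℤ} (h : IsMarkovLabel v m)
    (h' : IsMarkovLabel v m') : m = m' := by
  induction h generalizing m' with
  | top =>
    cases h' with
    | top => rfl
    | step hpos hv => exact absurd hv.lt_right not_top_lt
  | zero =>
    generalize hz : ((0 : ℚ) : Vertex) = v at h'
    cases h' with
    | top => rfl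
    | zero => rfl
    | neg_one => rfl
    | step hpos hv => exact absurd hpos (by rw [hz]; exact lt_irrefl _)
  | neg_one =>
    generalize hz : ((-1 : ℚ) : Vertex) = v at h'
    cases h' with
    | top => rfl
    | zero => rfl
    | neg_one => rfl
    | step hpos hv => exact absurd hpos (by rw [← hz]; exact not_zero_lt_neg_one)
  | step hpos hv hu hw ht _ _ _ ihx ihy ihz =>
    cases h' with
    | top => exact absurd hv.lt_right not_top_lt
    | zero => exact absurd hpos (lt_irrefl _)
    | neg_one => exact absurd hpos not_zero_lt_neg_one
    | step hpos' hv' hu' hw' ht' hx' hy' hz' =>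
      obtain ⟨rfl, rfl⟩ := hv.unique hv'
      obtain rfl := hv.opposite_unique hu hw ht hu' hw' ht'
      rw [ihx hx', ihy hy', ihz hz']

lemma IsFractionalLabel.unique {v : Vertex} {x x' : ℚ} (h : IsFractionalLabel v x)
    (h' : IsFractionalLabel v x') : x = x' := by
  induction h generalizing x' with
  | top =>
    cases h' with
    | top => rfl
    | step hpos hv => exact absurd hv.lt_right not_top_lt
  | zero =>
    generalize hz : ((0 : ℚ) : Vertex) = v at h'
    cases h' with
    | top => exact absurd hz (by simp)
    | zero => rfl
    | neg_one => exact absurd (WithTop.coe_injective hz) (by norm_num)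
    | step hpos hv => exact absurd hpos (by rw [hz]; exact lt_irrefl _)
  | neg_one =>
    generalize hz : ((-1 : ℚ) : Vertex) = v at h'
    cases h' with
    | top => exact absurd hz WithTop.coe_ne_top
    | zero => exact absurd (WithTop.coe_injective hz) (by norm_num)
    | neg_one => rfl
    | step hpos hv => exact absurd hpos (by rw [← hz]; exact not_zero_lt_neg_one)
  | step hpos hv _ _ ihx ihy =>
    cases h' with
    | top => exact absurd hv.lt_right not_top_lt
    | zero => exact absurd hpos (lt_irrefl _)
    | neg_one => exact absurd hpos not_zero_lt_neg_one
    | step hpos' hv' hx' hy' =>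
      obtain ⟨rfl, rfl⟩ := hv.unique hv'
      rw [ihx hx', ihy hy']

open Classical in
/-- The Markov label at a vertex (`0` at the vertices that carry no label). -/
noncomputable def markovValue (v : Vertex) : ℤ :=
  if h : Labelled v then (exists_labels h).1.choose else 0

open Classical in
/-- The fractional Markov label at a vertex (`0` at the vertices that carry no label). -/
noncomputable def fractionalValue (v : Vertex) : ℚ :=
  if h : Labelled v then (exists_labels h).2.choose else 0

lemma isMarkovLabel_iff {v : Vertex} (h : Labelled v) (m : ℤ) :
    IsMarkovLabel v m ↔ markovValue v = m := by
  rw [markovValue, dif_pos h]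
  exact ⟨fun hm => (exists_labels h).1.choose_spec.unique hm,
    fun hm => hm ▸ (exists_labels h).1.choose_spec⟩

lemma isFractionalLabel_iff {v : Vertex} (h : Labelled v) (x : ℚ) :
    IsFractionalLabel v x ↔ fractionalValue v = x := by
  rw [fractionalValue, dif_pos h]
  exact ⟨fun hm => (exists_labels h).2.choose_spec.unique hm,
    fun hm => hm ▸ (exists_labels h).2.choose_spec⟩

/-! ### Horoballs -/

/-- The horoballs of the maximal `PSL(2,ℤ)`-invariant horoball packing of `ℍ`: the half-plane
`Im z > 1` at `∞`, and the disc of Euclidean diameter `1/q²` tangent to `ℝ` at `p/q`. -/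
def horoball : Vertex → Set ℍ
  | ⊤ => {z | 1 < z.im}
  | (r : ℚ) => {z | (z.re - r) ^ 2 + (z.im - 1 / (2 * (r.den : ℝ) ^ 2)) ^ 2
      < (1 / (2 * (r.den : ℝ) ^ 2)) ^ 2}

lemma mem_horoball_coe (r : ℚ) (z : ℍ) :
    z ∈ horoball r ↔ (z.re - r) ^ 2 + z.im ^ 2 < z.im / (r.den : ℝ) ^ 2 := by
  change (z.re - r) ^ 2 + (z.im - 1 / (2 * (r.den : ℝ) ^ 2)) ^ 2
      < (1 / (2 * (r.den : ℝ) ^ 2)) ^ 2 ↔ _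
  have hd : (0 : ℝ) < r.den := by exact_mod_cast r.den_pos
  have e : (z.im - 1 / (2 * (r.den : ℝ) ^ 2)) ^ 2 - (1 / (2 * (r.den : ℝ) ^ 2)) ^ 2
      = z.im ^ 2 - z.im / (r.den : ℝ) ^ 2 := by
    field_simp
    ring
  constructor <;> intro h <;> linarith

lemma horoball_injective : Function.Injective horoball := by
  have htop : ∀ r : ℚ, horoball r ≠ horoball ⊤ := by
    intro r h
    let z : ℍ := ⟨⟨r, 2⟩, by norm_num⟩
    have hz : z ∈ horoball ⊤ := by
      change (1 : ℝ) < 2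
      norm_num
    rw [← h, mem_horoball_coe] at hz
    have h1 : z.re = r := rfl
    have h2 : z.im = 2 := rfl
    rw [h1, h2] at hz
    have hd : (1 : ℝ) ≤ (r.den : ℝ) ^ 2 := by
      have : (1 : ℝ) ≤ r.den := by exact_mod_cast r.den_pos
      nlinarith
    have : 2 / (r.den : ℝ) ^ 2 ≤ 2 := div_le_self (by norm_num) hd
    norm_num at hz
    linarith
  intro u v h
  cases u using WithTop.recTopCoe with
  | top => cases v using WithTop.recTopCoe with
    | top => rfl
    | coe s => exact absurd h.symm (htop s)
  | coe r => cases v using WithTop.recTopCoe with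
    | top => exact absurd h (htop r)
    | coe s =>
      by_contra hne
      have hrs : (r : ℝ) - s ≠ 0 := by
        intro h0
        apply hne
        have : (r : ℝ) = s := by linarith
        exact_mod_cast congrArg (fun t : ℚ => (t : Vertex)) (Rat.cast_injective this)
      have hd : (0 : ℝ) < (r.den : ℝ) ^ 2 := by
        have : (0 : ℝ) < r.den := by exact_mod_cast r.den_pos
        positivity
      have hs : (1 : ℝ) ≤ (s.den : ℝ) ^ 2 := by
        have : (1 : ℝ) ≤ s.den := by exact_mod_cast s.den_pos
        nlinarith
      have hδ : 0 < ((r : ℝ) - s) ^ 2 := by positivity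
      obtain ⟨ε, hε0, hε⟩ := exists_between (lt_min hδ (one_div_pos.mpr hd))
      obtain ⟨hε1, hε2⟩ := lt_min_iff.mp hε
      let z : ℍ := ⟨⟨r, ε⟩, hε0⟩
      have h1 : z.re = r := rfl
      have h2 : z.im = ε := rfl
      have hz : z ∈ horoball r := by
        rw [mem_horoball_coe, h1, h2, sub_self, div_eq_mul_one_div]
        nlinarith
      rw [h, mem_horoball_coe, h1, h2] at hz
      have : ε / (s.den : ℝ) ^ 2 ≤ ε := div_le_self hε0.le hs
      nlinarith [sq_nonneg ε]

/-- The set of bounded horoballs of the packing that meet the strip `0 < Re z < 1`. -/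
def horoballs : Set (Set ℍ) :=
  {H | ∃ r : ℚ, H = horoball r ∧ ∃ z ∈ H, 0 < z.re ∧ z.re < 1}

/-- The Farey label of a horoball of the packing: its center. -/
noncomputable def fareyLabel (H : Set ℍ) : Vertex := Function.invFun horoball H

lemma fareyLabel_horoball (v : Vertex) : fareyLabel (horoball v) = v :=
  Function.leftInverse_invFun horoball_injective v

/-- The Markov label of a horoball. -/
noncomputable def markovLabel (H : Set ℍ) : ℤ := markovValue (fareyLabel H)

/-- The fractional Markov label of a horoball. -/
noncomputable def fractionalLabel (H : Set ℍ) : ℚ := fractionalValue (fareyLabel H)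

/-- `(H₁, H₂)` are the immediate precedents of `H`, in the order of their centers. -/
def ImmediatePrecedents (H₁ H₂ H : Set ℍ) : Prop :=
  ∃ u v w : Vertex, H₁ = horoball u ∧ H = horoball v ∧ H₂ = horoball w ∧ IsFareyTriple u v w

/-! ### The modular torus -/

/-- The commutator subgroup of `SL(2,ℤ)`.  It maps isomorphically onto the commutator subgroup of
`PSL(2,ℤ)`. -/
abbrev Γ : Subgroup SL(2, ℤ) := commutator SL(2, ℤ)

/-- The modular torus `𝔛 = ℍ / Γ`, with the quotient topology. -/
abbrev 𝔛 : Type := Quotient (MulAction.orbitRel Γ ℍ)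

/-- The covering projection `ℍ → 𝔛`. -/
noncomputable def proj (z : ℍ) : 𝔛 := Quotient.mk (MulAction.orbitRel Γ ℍ) z

/-- The matrix `α`. -/
def matAlpha : SL(2, ℤ) := ⟨!![2, 1; 1, 1], by simp [Matrix.det_fin_two]⟩

/-- The matrix `β`. -/
def matBeta : SL(2, ℤ) := ⟨!![2, -1; -1, 1], by simp [Matrix.det_fin_two]⟩

lemma matAlpha_mem : matAlpha ∈ Γ := by
  have h : matAlpha = ⁅ModularGroup.T, ModularGroup.S⁆ := by decide
  rw [h]
  exact Subgroup.commutator_mem_commutator (Subgroup.mem_top _) (Subgroup.mem_top _)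

lemma matBeta_mem : matBeta ∈ Γ := by
  have h : matBeta = ⁅ModularGroup.T⁻¹, ModularGroup.S⁆ := by decide
  rw [h]
  exact Subgroup.commutator_mem_commutator (Subgroup.mem_top _) (Subgroup.mem_top _)

/-- The free generator `α` of `Γ`. -/
def alpha : Γ := ⟨matAlpha, matAlpha_mem⟩

/-- The free generator `β` of `Γ`. -/
def beta : Γ := ⟨matBeta, matBeta_mem⟩

/-- The homology class of `g ∈ Γ = π₁(𝔛)` in `H₁(𝔛, ℤ) = Γ^ab` is the primitive class `(q, p)` of
slope `s = p/q`, where `H₁(𝔛, ℤ) ≅ ℤ²` is normalised by `[α] = (1, -1)`, `[β] = (0, 1)`; that is,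
`(q, p) = q [α] + (p + q) [β]`. -/
def HasSlope (g : Γ) (s : Vertex) : Prop :=
  Abelianization.of g = Abelianization.of alpha ^ vden s * Abelianization.of beta ^ (vnum s + vden s)

/-! ### Geodesics, arcs, triangles -/

/-- The complete geodesic of `ℍ` with endpoints `u ≠ v` in `∂ℍ = ℝ ∪ {∞}`: a vertical line or a
semicircle orthogonal to `ℝ`. -/
def geodesic : WithTop ℝ → WithTop ℝ → Set ℍ
  | ⊤, ⊤ => ∅
  | ⊤, (v : ℝ) => {z | z.re = v}
  | (u : ℝ), ⊤ => {z | z.re = u}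
  | (u : ℝ), (v : ℝ) => {z | z.re ^ 2 + z.im ^ 2 - (u + v) * z.re + u * v = 0}

/-- The open half-plane to the left of the geodesic directed from `u` to `v`. -/
def leftSide : WithTop ℝ → WithTop ℝ → Set ℍ
  | ⊤, ⊤ => ∅
  | ⊤, (v : ℝ) => {z | v < z.re}
  | (u : ℝ), ⊤ => {z | z.re < u}
  | (u : ℝ), (v : ℝ) => {z | 0 < (v - u) * (z.re ^ 2 + z.im ^ 2 - (u + v) * z.re + u * v)}

/-- `L` is a complete geodesic of `ℍ`. -/
def IsCompleteGeodesic (L : Set ℍ) : Prop := ∃ u v : WithTop ℝ, u ≠ v ∧ L = geodesic u v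

/-- `A` is a simple proper geodesic arc on `𝔛`: the image of a complete geodesic of `ℍ` on which
the projection is injective and proper. -/
def IsSimpleProperArc (A : Set 𝔛) : Prop :=
  ∃ L : Set ℍ, IsCompleteGeodesic L ∧ Set.InjOn proj L ∧
    IsProperMap (fun z : L => proj z) ∧ A = proj '' L

/-- `C` is (the image of) a simple closed geodesic on `𝔛` whose homology class is the primitive
class of slope `s`: the quotient `L / ⟨g⟩` of the axis `L` of a hyperbolic `g ∈ Γ` in that class
maps injectively to `𝔛`, with image `C`. -/
def IsSimpleClosedGeodesic (s : Vertex) (C : Set 𝔛) : Prop :=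
  ∃ (g : Γ) (L : Set ℍ), HasSlope g s ∧ 2 < |(g : SL(2, ℤ)).1.trace| ∧
    IsCompleteGeodesic L ∧ (fun z : ℍ => g • z) '' L = L ∧
    (∀ h : Γ, ∀ z ∈ L, h • z ∈ L → ∃ m : ℤ, h • z = g ^ m • z) ∧ C = proj '' L

/-- The points `u, v, w` of `∂ℍ` are distinct and in counterclockwise order, i.e. in the cyclic
order of `ℝ ∪ {∞}`. -/
def Counterclockwise (u v w : WithTop ℝ) : Prop :=
  (u < v ∧ v < w) ∨ (v < w ∧ w < u) ∨ (w < u ∧ u < v)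

/-- The open ideal triangle with counterclockwise vertices `u, v, w`. -/
def idealTriangle (u v w : WithTop ℝ) : Set ℍ := leftSide u v ∩ leftSide v w ∩ leftSide w u

/-- `u, v, w` are the vertices, in counterclockwise order, of a lift of an ideal triangle of `𝔛`
complementary to the arcs `A i`: the open ideal triangle embeds in the complement of the arcs, and
its sides project onto some of the arcs. -/
structure IsComplementaryTriangle {ι : Type*} (A : ι → Set 𝔛) (u v w : WithTop ℝ) : Prop where
  ccw : Counterclockwise u v w
  inj : Set.InjOn proj (idealTriangle u v w)
  disjoint : ∀ i, Disjoint (proj '' idealTriangle u v w) (A i)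
  side₁ : ∃ i, proj '' geodesic u v = A i
  side₂ : ∃ i, proj '' geodesic v w = A i
  side₃ : ∃ i, proj '' geodesic w u = A i

/-- The family `A` is an ideal triangulation of `𝔛`: its members are pairwise disjoint simple proper
geodesic arcs, and the complement of their union is a union of ideal triangles. -/
structure IsIdealTriangulation {ι : Type*} (A : ι → Set 𝔛) : Prop where
  arc : ∀ i, IsSimpleProperArc (A i)
  disjoint : ∀ i j, i ≠ j → Disjoint (A i) (A j)
  triangle : ∀ x : 𝔛, (∀ i, x ∉ A i) →
    ∃ u v w, IsComplementaryTriangle A u v w ∧ x ∈ proj '' idealTriangle u v w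

/-- The counterclockwise order of the arcs is `A 0, A 1, A 2`: these are the sides of every
complementary triangle, in this cyclic order when its boundary is traversed counterclockwise. -/
def CounterclockwiseArcs (A : Fin 3 → Set 𝔛) : Prop :=
  ∀ u v w, IsComplementaryTriangle A u v w → ∃ j : Fin 3,
    proj '' geodesic u v = A j ∧ proj '' geodesic v w = A (j + 1) ∧
      proj '' geodesic w u = A (j + 2)

/-- The projection to `𝔛` of the vertical geodesic `Re z = x`. -/
def verticalArc (x : ℚ) : Set 𝔛 := proj '' {z : ℍ | z.re = (x : ℝ)}

end MarkovTorus

open MarkovTorus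

namespace MarkovTorus

/-! ### Homogeneous coordinates -/

/-- Homogeneous coordinates of a point of `ℝ ∪ {∞}`. -/
def toVec : WithTop ℝ → ℝ × ℝ
  | ⊤ => (1, 0)
  | (u : ℝ) => (u, 1)

/-- The oriented area, positive if `u < v` for vectors `(u, 1)`, `(v, 1)`. -/
def wedge (U V : ℝ × ℝ) : ℝ := V.1 * U.2 - V.2 * U.1

/-- The Hermitian form whose zero set in `ℍ` is the geodesic with endpoints `U`, `V`. -/
noncomputable def qf (U V : ℝ × ℝ) (z : ℍ) : ℝ :=
  U.2 * V.2 * (z.re ^ 2 + z.im ^ 2) - (U.1 * V.2 + U.2 * V.1) * z.re + U.1 * V.1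

/-- The linear action of `SL(2,ℤ)`. -/
def act (g : SL(2, ℤ)) (U : ℝ × ℝ) : ℝ × ℝ :=
  (g 0 0 * U.1 + g 0 1 * U.2, g 1 0 * U.1 + g 1 1 * U.2)

/-- The squared modulus of the automorphy factor. -/
noncomputable def autFactor (g : SL(2, ℤ)) (z : ℍ) : ℝ := (g 1 0 * z.re + g 1 1) ^ 2 + (g 1 0 * z.im) ^ 2

lemma det_real (g : SL(2, ℤ)) : (g 0 0 : ℝ) * g 1 1 - g 0 1 * g 1 0 = 1 := by
  have h := g.det_coe
  rw [Matrix.det_fin_two] at h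
  exact_mod_cast h

lemma det_int (g : SL(2, ℤ)) : g 0 0 * g 1 1 - g 0 1 * g 1 0 = 1 := by
  have h := g.det_coe
  rwa [Matrix.det_fin_two] at h

lemma autFactor_pos (g : SL(2, ℤ)) (z : ℍ) : 0 < autFactor g z := by
  have h := det_real g
  have hz := z.im_pos
  unfold autFactor
  rcases eq_or_ne (g 1 0 : ℝ) 0 with h0 | h0
  · have : (g 1 1 : ℝ) ≠ 0 := by
      intro h1; rw [h0, h1] at h; norm_num at h
    rw [h0]; simp; positivity
  · positivity

lemma smul_re_im (g : SL(2, ℤ)) (z : ℍ) :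
    (g • z).re * autFactor g z = g 0 0 * g 1 0 * (z.re ^ 2 + z.im ^ 2)
      + (g 0 0 * g 1 1 + g 0 1 * g 1 0) * z.re + g 0 1 * g 1 1 ∧
    (g • z).im * autFactor g z = z.im := by
  have hD := autFactor_pos g z
  have hN : Complex.normSq ((g 1 0 : ℂ) * z + g 1 1) = autFactor g z := by
    rw [Complex.normSq_apply]; simp [autFactor]; ring
  have h := coe_specialLinearGroup_apply g z
  simp only [eq_intCast, Complex.ofReal_intCast] at h
  have hre : (g • z).re = ((g • z : ℍ) : ℂ).re := rfl
  have him : (g • z).im = ((g • z : ℍ) : ℂ).im := rfl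
  have hdet := det_real g
  constructor
  · rw [hre, h, Complex.div_re, hN, add_mul, div_mul_cancel₀ _ hD.ne', div_mul_cancel₀ _ hD.ne']
    simp; ring
  · rw [him, h, Complex.div_im, hN, sub_mul, div_mul_cancel₀ _ hD.ne', div_mul_cancel₀ _ hD.ne']
    simp
    linear_combination z.im * hdet

lemma smul_normSq (g : SL(2, ℤ)) (z : ℍ) :
    ((g • z).re ^ 2 + (g • z).im ^ 2) * autFactor g z =
      g 0 0 ^ 2 * (z.re ^ 2 + z.im ^ 2) + 2 * g 0 0 * g 0 1 * z.re + g 0 1 ^ 2 := by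
  obtain ⟨h1, h2⟩ := smul_re_im g z
  have hD := autFactor_pos g z
  have hdet := det_real g
  apply mul_right_cancel₀ hD.ne'
  have : ((g • z).re ^ 2 + (g • z).im ^ 2) * autFactor g z * autFactor g z =
      ((g • z).re * autFactor g z) ^ 2 + ((g • z).im * autFactor g z) ^ 2 := by ring
  rw [this, h1, h2]
  unfold autFactor
  generalize (g 0 0 : ℝ) = a at *
  generalize (g 0 1 : ℝ) = b at *
  generalize (g 1 0 : ℝ) = c at *
  generalize (g 1 1 : ℝ) = d at *
  generalize z.re = x
  generalize z.im = y
  linear_combination (-(a * d - b * c) - 1) * y ^ 2 * hdet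

lemma wedge_act (g : SL(2, ℤ)) (U V : ℝ × ℝ) : wedge (act g U) (act g V) = wedge U V := by
  have h := det_real g
  simp only [wedge, act]
  linear_combination (V.1 * U.2 - V.2 * U.1) * h

lemma qf_act (g : SL(2, ℤ)) (U V : ℝ × ℝ) (z : ℍ) :
    qf (act g U) (act g V) (g • z) * autFactor g z = qf U V z := by
  have h1 := (smul_re_im g z).1
  have h2 := smul_normSq g z
  have hdet := det_real g
  simp only [qf, act, sub_mul, add_mul _ _ (autFactor g z)]
  rw [mul_assoc _ _ (autFactor g z), h2, mul_assoc _ _ (autFactor g z), h1]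
  unfold autFactor
  generalize (g 0 0 : ℝ) = a at *
  generalize (g 0 1 : ℝ) = b at *
  generalize (g 1 0 : ℝ) = c at *
  generalize (g 1 1 : ℝ) = d at *
  generalize z.re = x
  generalize z.im = y
  linear_combination (U.2 * V.2 * (x ^ 2 + y ^ 2) - (U.1 * V.2 + U.2 * V.1) * x + U.1 * V.1) * (a * d - b * c + 1) * hdet

lemma act_mul (g h : SL(2, ℤ)) (U : ℝ × ℝ) : act (g * h) U = act g (act h U) := by
  simp only [act, Matrix.SpecialLinearGroup.coe_mul, Matrix.mul_apply, Fin.sum_univ_two]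
  push_cast
  ext <;> simp <;> ring

lemma act_one (U : ℝ × ℝ) : act 1 U = U := by
  simp [act]

lemma act_inv_act (g : SL(2, ℤ)) (U : ℝ × ℝ) : act g⁻¹ (act g U) = U := by
  rw [← act_mul, inv_mul_cancel, act_one]

lemma act_smul (g : SL(2, ℤ)) (c : ℝ) (U : ℝ × ℝ) : act g (c • U) = c • act g U := by
  ext <;> simp [act] <;> ring

lemma qf_smul (c d : ℝ) (U V : ℝ × ℝ) (z : ℍ) : qf (c • U) (d • V) z = c * d * qf U V z := by
  simp [qf]; ring

lemma wedge_smul (c d : ℝ) (U V : ℝ × ℝ) : wedge (c • U) (d • V) = c * d * wedge U V := by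
  simp [wedge]; ring

lemma wedge_swap (U V : ℝ × ℝ) : wedge V U = -wedge U V := by
  simp [wedge]; ring

lemma qf_comm (U V : ℝ × ℝ) (z : ℍ) : qf V U z = qf U V z := by
  simp [qf]; ring

lemma mem_geodesic (u v : WithTop ℝ) (z : ℍ) :
    z ∈ geodesic u v ↔ qf (toVec u) (toVec v) z = 0 := by
  cases u using WithTop.recTopCoe <;> cases v using WithTop.recTopCoe
  · simp [geodesic, qf, toVec]
  · simp only [geodesic, qf, toVec, Set.mem_ofPred_eq]
    constructor <;> intro h <;> linarith
  · simp only [geodesic, qf, toVec, Set.mem_ofPred_eq]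
    constructor <;> intro h <;> linarith
  · simp only [geodesic, qf, toVec, Set.mem_ofPred_eq]
    constructor <;> intro h <;> linarith

lemma mem_leftSide (u v : WithTop ℝ) (z : ℍ) :
    z ∈ leftSide u v ↔ 0 < wedge (toVec u) (toVec v) * qf (toVec u) (toVec v) z := by
  cases u using WithTop.recTopCoe <;> cases v using WithTop.recTopCoe
  · simp [leftSide, qf, toVec, wedge]
  · simp only [leftSide, qf, toVec, wedge, Set.mem_ofPred_eq]
    constructor <;> intro h <;> linarith
  · simp only [leftSide, qf, toVec, wedge, Set.mem_ofPred_eq]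
    constructor <;> intro h <;> linarith
  · simp only [leftSide, qf, toVec, wedge, Set.mem_ofPred_eq]
    ring_nf

lemma counterclockwise_iff (u v w : WithTop ℝ) : Counterclockwise u v w ↔
    wedge (toVec u) (toVec v) * wedge (toVec v) (toVec w) * wedge (toVec w) (toVec u) < 0 := by
  have key : ∀ a b c : ℝ, (b - a) * (c - b) * (a - c) < 0 ↔
      (a < b ∧ b < c) ∨ (b < c ∧ c < a) ∨ (c < a ∧ a < b) := by
    intro a b c
    constructor
    · intro h
      have h1 : a ≠ b := by rintro rfl; simp at h
      have h2 : b ≠ c := by rintro rfl; simp at h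
      have h3 : c ≠ a := by rintro rfl; simp at h
      rcases lt_or_gt_of_ne h1 with h1 | h1 <;> rcases lt_or_gt_of_ne h2 with h2 | h2 <;>
        rcases lt_or_gt_of_ne h3 with h3 | h3
      · linarith
      · exact Or.inl ⟨h1, h2⟩
      · exact Or.inr (Or.inr ⟨h3, h1⟩)
      · have := mul_pos (mul_pos (sub_pos.mpr h1) (sub_pos.mpr h2)) (sub_pos.mpr h3); linarith
      · exact Or.inr (Or.inl ⟨h2, h3⟩)
      · have := mul_pos (mul_pos (sub_pos.mpr h1) (sub_pos.mpr h2)) (sub_pos.mpr h3); linarith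
      · have := mul_pos (mul_pos (sub_pos.mpr h1) (sub_pos.mpr h2)) (sub_pos.mpr h3); linarith
      · linarith
    · rintro (⟨h1, h2⟩ | ⟨h1, h2⟩ | ⟨h1, h2⟩)
      · have := mul_pos (mul_pos (sub_pos.mpr h1) (sub_pos.mpr h2)) (sub_pos.mpr (h1.trans h2))
        linarith
      · have := mul_pos (mul_pos (sub_pos.mpr h1) (sub_pos.mpr h2)) (sub_pos.mpr (h1.trans h2))
        linarith
      · have := mul_pos (mul_pos (sub_pos.mpr h1) (sub_pos.mpr h2)) (sub_pos.mpr (h1.trans h2))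
        linarith
  unfold Counterclockwise
  cases u using WithTop.recTopCoe <;> cases v using WithTop.recTopCoe <;>
    cases w using WithTop.recTopCoe <;>
    simp only [toVec, wedge, WithTop.coe_lt_coe, WithTop.coe_lt_top, not_top_lt, lt_irrefl,
      and_false, false_and, or_false, false_or, and_true]
  · norm_num
  · norm_num
  · norm_num
  · rename_i v w
    constructor <;> intro h <;> linarith
  · norm_num
  · constructor <;> intro h <;> linarith
  · constructor <;> intro h <;> linarith
  · rename_i u v w
    rw [← key]
    simp only [mul_one, one_mul]

lemma toVec_ne_zero (u : WithTop ℝ) : toVec u ≠ 0 := by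
  cases u using WithTop.recTopCoe <;> simp [toVec, Prod.ext_iff]

lemma exists_toVec {U : ℝ × ℝ} (hU : U ≠ 0) : ∃ (u : WithTop ℝ) (c : ℝ), c ≠ 0 ∧ U = c • toVec u := by
  rcases eq_or_ne U.2 0 with h | h
  · refine ⟨⊤, U.1, ?_, ?_⟩
    · intro h1; exact hU (Prod.ext h1 h)
    · ext <;> simp [toVec, h]
  · refine ⟨((U.1 / U.2 : ℝ) : WithTop ℝ), U.2, h, ?_⟩
    ext <;> simp [toVec]
    field_simp

lemma act_ne_zero (g : SL(2, ℤ)) {U : ℝ × ℝ} (hU : U ≠ 0) : act g U ≠ 0 := by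
  intro h
  apply hU
  rw [← act_inv_act g U, h]
  simp [act]

lemma exists_boundary_smul (g : SL(2, ℤ)) (u : WithTop ℝ) :
    ∃ (u' : WithTop ℝ) (c : ℝ), c ≠ 0 ∧ act g (toVec u) = c • toVec u' :=
  exists_toVec (act_ne_zero g (toVec_ne_zero u))

lemma wedge_toVec_eq_zero {u v : WithTop ℝ} : wedge (toVec u) (toVec v) = 0 ↔ u = v := by
  cases u using WithTop.recTopCoe <;> cases v using WithTop.recTopCoe
  · simp [wedge, toVec]
  · simp [wedge, toVec]
  · simp [wedge, toVec]
  · simp only [wedge, toVec, mul_one, one_mul, sub_eq_zero, WithTop.coe_inj]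
    exact eq_comm

end MarkovTorus

namespace MarkovTorus

/-! ### Geodesics and the action of `SL(2,ℤ)` -/

lemma smul_mem_geodesic {g : SL(2, ℤ)} {u v u' v' : WithTop ℝ} {c d : ℝ} (hc : c ≠ 0) (hd : d ≠ 0)
    (hu : act g (toVec u) = c • toVec u') (hv : act g (toVec v) = d • toVec v') (z : ℍ) :
    g • z ∈ geodesic u' v' ↔ z ∈ geodesic u v := by
  have h := qf_act g (toVec u) (toVec v) z
  rw [hu, hv, qf_smul] at h
  have hD := autFactor_pos g z
  rw [mem_geodesic, mem_geodesic, ← h]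
  simp [hc, hd, hD.ne']

lemma smul_mem_leftSide {g : SL(2, ℤ)} {u v u' v' : WithTop ℝ} {c d : ℝ} (hc : c ≠ 0) (hd : d ≠ 0)
    (hu : act g (toVec u) = c • toVec u') (hv : act g (toVec v) = d • toVec v') (z : ℍ) :
    g • z ∈ leftSide u' v' ↔ z ∈ leftSide u v := by
  have h := qf_act g (toVec u) (toVec v) z
  have hw := wedge_act g (toVec u) (toVec v)
  rw [hu, hv] at h hw
  rw [qf_smul] at h
  rw [wedge_smul] at hw
  have hD := autFactor_pos g z
  rw [mem_leftSide, mem_leftSide, ← h, ← hw]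
  rw [show c * d * wedge (toVec u') (toVec v') * (c * d * qf (toVec u') (toVec v') (g • z) *
    autFactor g z) = ((c * d) ^ 2 * autFactor g z) * (wedge (toVec u') (toVec v') *
      qf (toVec u') (toVec v') (g • z)) by ring]
  have hcd : c * d ≠ 0 := mul_ne_zero hc hd
  exact (mul_pos_iff_of_pos_left (by positivity)).symm

lemma mul_neg_iff_of_pos {a : ℝ} (ha : 0 < a) (b : ℝ) : a * b < 0 ↔ b < 0 := by
  constructor
  · intro h
    by_contra! h'
    linarith [mul_nonneg ha.le h']
  · exact mul_neg_of_pos_of_neg ha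

lemma counterclockwise_of_act {g : SL(2, ℤ)} {u v w u' v' w' : WithTop ℝ} {c d e : ℝ}
    (hc : c ≠ 0) (hd : d ≠ 0) (he : e ≠ 0)
    (hu : act g (toVec u) = c • toVec u') (hv : act g (toVec v) = d • toVec v')
    (hw : act g (toVec w) = e • toVec w') :
    Counterclockwise u' v' w' ↔ Counterclockwise u v w := by
  rw [counterclockwise_iff, counterclockwise_iff, ← wedge_act g (toVec u) (toVec v),
    ← wedge_act g (toVec v) (toVec w), ← wedge_act g (toVec w) (toVec u), hu, hv, hw,
    wedge_smul, wedge_smul, wedge_smul]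
  rw [show c * d * wedge (toVec u') (toVec v') * (d * e * wedge (toVec v') (toVec w')) *
    (e * c * wedge (toVec w') (toVec u')) = (c * d * e) ^ 2 * (wedge (toVec u') (toVec v') *
     wedge (toVec v') (toVec w') * wedge (toVec w') (toVec u')) by ring]
  have hcde : c * d * e ≠ 0 := mul_ne_zero (mul_ne_zero hc hd) he
  have : 0 < (c * d * e) ^ 2 := by positivity
  exact (mul_neg_iff_of_pos this _).symm

/-- The point of the geodesic with finite endpoints `u`, `v` above a given real part. -/
lemma exists_mem_geodesic {u v x : ℝ} (h : 0 < (x - u) * (v - x)) :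
    ∃ z ∈ geodesic u v, z.re = x := by
  refine ⟨⟨⟨x, √((x - u) * (v - x))⟩, Real.sqrt_pos.mpr h⟩, ?_, rfl⟩
  have : √((x - u) * (v - x)) ^ 2 = (x - u) * (v - x) := Real.sq_sqrt h.le
  change x ^ 2 + √((x - u) * (v - x)) ^ 2 - (u + v) * x + u * v = 0
  rw [this]; ring

lemma geodesic_infinite {u v : WithTop ℝ} (h : u ≠ v) : (geodesic u v).Infinite := by
  have vert : ∀ x : ℝ, {z : ℍ | z.re = x}.Infinite := by
    intro x
    refine Set.infinite_of_injective_forall_mem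
      (f := fun n : ℕ => (⟨⟨x, n + 1⟩, by positivity⟩ : ℍ)) ?_ (fun n => rfl)
    intro m n hmn
    have := congrArg UpperHalfPlane.im hmn
    simpa using! this
  cases u using WithTop.recTopCoe <;> cases v using WithTop.recTopCoe
  · exact absurd rfl h
  · exact vert _
  · exact vert _
  · rename_i u v
    have huv : u ≠ v := by simpa using h
    have hex : ∀ n : ℕ, ∃ z ∈ geodesic (u : WithTop ℝ) v, z.re = u + (v - u) * (1 / (n + 2)) := by
      intro n
      apply exists_mem_geodesic
      have h1 : (u + (v - u) * (1 / ((n : ℝ) + 2)) - u) * (v - (u + (v - u) * (1 / (n + 2)))) =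
          (v - u) ^ 2 * ((n + 1) / (n + 2) ^ 2) := by field_simp; ring
      rw [h1]
      have : 0 < (v - u) ^ 2 := by
        have : v - u ≠ 0 := sub_ne_zero.mpr huv.symm
        positivity
      positivity
    choose f hf hre using hex
    refine Set.infinite_of_injective_forall_mem (f := f) ?_ hf
    intro m n hmn
    have h1 := hre m
    rw [hmn, hre n] at h1
    have h2 : v - u ≠ 0 := sub_ne_zero.mpr huv.symm
    have h3 := mul_left_cancel₀ h2 (add_left_cancel h1)
    field_simp at h3
    have : (m : ℝ) = n := by linarith
    exact_mod_cast this

/-- Two geodesics with two common points have the same endpoints. -/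
lemma endpoints_eq {u v u' v' : WithTop ℝ} (h' : u' ≠ v') {z₁ z₂ : ℍ}
    (hz : z₁ ≠ z₂) (h1 : z₁ ∈ geodesic u v) (h2 : z₂ ∈ geodesic u v) (h1' : z₁ ∈ geodesic u' v')
    (h2' : z₂ ∈ geodesic u' v') : (u' = u ∧ v' = v) ∨ (u' = v ∧ v' = u) := by
  rw [mem_geodesic] at h1 h2 h1' h2'
  have hw' : wedge (toVec u') (toVec v') ≠ 0 := by rwa [Ne, wedge_toVec_eq_zero]
  have key : ∀ W X : ℝ × ℝ,
      (wedge (toVec u) W * wedge (toVec v) W) * (wedge (toVec u') X * wedge (toVec v') X) =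
      (wedge (toVec u') W * wedge (toVec v') W) * (wedge (toVec u) X * wedge (toVec v) X) := by
    simp only [qf] at h1 h2 h1' h2'
    have hne : z₁.re - z₂.re ≠ 0 ∨ (z₁.re ^ 2 + z₁.im ^ 2) - (z₂.re ^ 2 + z₂.im ^ 2) ≠ 0 := by
      by_contra! hcon
      obtain ⟨c1, c2⟩ := hcon
      have e1 : z₁.re = z₂.re := by linarith
      rw [e1] at c2
      have e2 : z₁.im = z₂.im := by
        have := z₁.im_pos
        have := z₂.im_pos
        have : (z₁.im - z₂.im) * (z₁.im + z₂.im) = 0 := by linarith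
        rcases mul_eq_zero.mp this with h | h <;> linarith
      exact hz (UpperHalfPlane.ext_re_im e1 e2)
    generalize z₁.re ^ 2 + z₁.im ^ 2 = N₁ at *
    generalize z₂.re ^ 2 + z₂.im ^ 2 = N₂ at *
    generalize z₁.re = X₁ at *
    generalize z₂.re = X₂ at *
    intro W X
    simp only [wedge]
    clear hw'
    generalize toVec u = U at *
    generalize toVec v = V at *
    generalize toVec u' = U' at *
    generalize toVec v' = V' at *
    obtain ⟨u1, u2⟩ := U
    obtain ⟨v1, v2⟩ := V
    obtain ⟨u1', u2'⟩ := U'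
    obtain ⟨v1', v2'⟩ := V'
    simp only at *
    have m1 : (u2 * v2) * (u1' * v2' + u2' * v1') - (u2' * v2') * (u1 * v2 + u2 * v1) = 0 := by
      rcases hne with h | h
      · apply mul_right_cancel₀ h
        linear_combination (u2 * v2) * (h2' - h1') - (u2' * v2') * (h2 - h1)
      · apply mul_right_cancel₀ h
        linear_combination (u1' * v2' + u2' * v1') * (h1 - h2) - (u1 * v2 + u2 * v1) * (h1' - h2')
    have m2 : (u2 * v2) * (u1' * v1') - (u2' * v2') * (u1 * v1) = 0 := by
      linear_combination (u2 * v2) * h1' - (u2' * v2') * h1 + X₁ * m1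
    have m3 : (u1 * v2 + u2 * v1) * (u1' * v1') - (u1' * v2' + u2' * v1') * (u1 * v1) = 0 := by
      linear_combination (u1 * v2 + u2 * v1) * h1' - (u1' * v2' + u2' * v1') * h1 + N₁ * m1
    obtain ⟨w1, w2⟩ := W
    obtain ⟨x1, x2⟩ := X
    simp only
    linear_combination (-w1 ^ 2 * x1 * x2 + w1 * w2 * x1 ^ 2) * m1 + (w1 ^ 2 * x2 ^ 2 - w2 ^ 2 * x1 ^ 2) * m2
      + (-w1 * w2 * x2 ^ 2 + w2 ^ 2 * x1 * x2) * m3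
  have hX : wedge (toVec u') (toVec u' + toVec v') * wedge (toVec v') (toVec u' + toVec v') ≠ 0 := by
    have e1 : wedge (toVec u') (toVec u' + toVec v') = wedge (toVec u') (toVec v') := by
      simp [wedge]; ring
    have e2 : wedge (toVec v') (toVec u' + toVec v') = -wedge (toVec u') (toVec v') := by
      simp [wedge]; ring
    rw [e1, e2]
    simpa using hw'
  have k1 : wedge (toVec u) (toVec u') * wedge (toVec v) (toVec u') = 0 := by
    have := key (toVec u') (toVec u' + toVec v')
    rw [show wedge (toVec u') (toVec u') = 0 by simp [wedge, mul_comm]] at this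
    simpa [hX] using! this
  have k2 : wedge (toVec u) (toVec v') * wedge (toVec v) (toVec v') = 0 := by
    have := key (toVec v') (toVec u' + toVec v')
    rw [show wedge (toVec v') (toVec v') = 0 by simp [wedge, mul_comm]] at this
    simpa [hX] using! this
  rw [mul_eq_zero, wedge_toVec_eq_zero, wedge_toVec_eq_zero] at k1 k2
  rcases k1 with k1 | k1 <;> rcases k2 with k2 | k2
  · exact absurd (k1.symm.trans k2) h'
  · exact Or.inl ⟨k1.symm, k2.symm⟩
  · exact Or.inr ⟨k1.symm, k2.symm⟩
  · exact absurd (k1.symm.trans k2) h'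

lemma geodesic_comm (u v : WithTop ℝ) : geodesic u v = geodesic v u := by
  ext z; rw [mem_geodesic, mem_geodesic, qf_comm]

/-! ### Axes of hyperbolic elements -/

/-- The binary quadratic form whose roots are the fixed points of `M`. -/
def fixForm (M : SL(2, ℤ)) (U : ℝ × ℝ) : ℝ :=
  M 1 0 * U.1 ^ 2 + (M 1 1 - M 0 0) * (U.1 * U.2) - M 0 1 * U.2 ^ 2

/-- The Hermitian form that vanishes on the axis of `M`. -/
noncomputable def axisForm (M : SL(2, ℤ)) (z : ℍ) : ℝ :=
  M 1 0 * (z.re ^ 2 + z.im ^ 2) + (M 1 1 - M 0 0) * z.re - M 0 1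

/-- The axis of a hyperbolic matrix. -/
def axis (M : SL(2, ℤ)) : Set ℍ := {z | axisForm M z = 0}

/-- `|tr M| > 2`. -/
def IsHyp (M : SL(2, ℤ)) : Prop := 2 < |M.1.trace|

lemma fixForm_eq (M : SL(2, ℤ)) (U : ℝ × ℝ) : fixForm M U = -wedge U (act M U) := by
  simp only [fixForm, wedge, act]; ring

lemma fixForm_conj (h M : SL(2, ℤ)) (U : ℝ × ℝ) :
    fixForm (h * M * h⁻¹) (act h U) = fixForm M U := by
  rw [fixForm_eq, fixForm_eq, act_mul, act_inv_act, act_mul, wedge_act]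

lemma axisForm_conj (h M : SL(2, ℤ)) (z : ℍ) :
    axisForm (h * M * h⁻¹) (h • z) * autFactor h z = axisForm M z := by
  have h1 := (smul_re_im h z).1
  have h2 := smul_normSq h z
  have hdet := det_real h
  have e : ∀ i j, ((h * M * h⁻¹) i j : ℝ) =
      (h i 0 * M 0 0 + h i 1 * M 1 0) * (h⁻¹) 0 j + (h i 0 * M 0 1 + h i 1 * M 1 1) * (h⁻¹) 1 j := by
    intro i j
    simp only [Matrix.SpecialLinearGroup.coe_mul, Matrix.mul_apply, Fin.sum_univ_two]
    push_cast; ring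
  have i00 : (h⁻¹) 0 0 = h 1 1 := by simp [Matrix.SpecialLinearGroup.SL2_inv_expl]
  have i01 : (h⁻¹) 0 1 = -h 0 1 := by simp [Matrix.SpecialLinearGroup.SL2_inv_expl]
  have i10 : (h⁻¹) 1 0 = -h 1 0 := by simp [Matrix.SpecialLinearGroup.SL2_inv_expl]
  have i11 : (h⁻¹) 1 1 = h 0 0 := by simp [Matrix.SpecialLinearGroup.SL2_inv_expl]
  have hexp : axisForm (h * M * h⁻¹) (h • z) * autFactor h z =
      (h * M * h⁻¹) 1 0 * (((h • z).re ^ 2 + (h • z).im ^ 2) * autFactor h z) +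
      ((h * M * h⁻¹) 1 1 - (h * M * h⁻¹) 0 0) * ((h • z).re * autFactor h z) -
      (h * M * h⁻¹) 0 1 * autFactor h z := by
    simp only [axisForm]; ring
  rw [hexp, h2, h1]
  simp only [axisForm]
  simp only [e, i00, i01, i10, i11]
  unfold autFactor
  push_cast
  generalize (h 0 0 : ℝ) = a at *
  generalize (h 0 1 : ℝ) = b at *
  generalize (h 1 0 : ℝ) = c at *
  generalize (h 1 1 : ℝ) = d at *
  generalize z.re = x
  generalize z.im = y
  generalize (M 0 0 : ℝ) = m
  generalize (M 0 1 : ℝ) = n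
  generalize (M 1 0 : ℝ) = r
  generalize (M 1 1 : ℝ) = s
  linear_combination (r * (x ^ 2 + y ^ 2) + (s - m) * x - n) * (a * d - b * c + 1) * hdet

lemma smul_mem_axis (h M : SL(2, ℤ)) (z : ℍ) : h • z ∈ axis (h * M * h⁻¹) ↔ z ∈ axis M := by
  change axisForm _ _ = 0 ↔ axisForm _ _ = 0
  rw [← axisForm_conj h M z]
  simp [(autFactor_pos h z).ne']

lemma image_axis (h M : SL(2, ℤ)) : (fun z : ℍ => h • z) '' axis M = axis (h * M * h⁻¹) := by
  ext z
  constructor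
  · rintro ⟨w, hw, rfl⟩
    exact (smul_mem_axis h M w).mpr hw
  · intro hz
    refine ⟨h⁻¹ • z, ?_, by simp⟩
    rw [← smul_mem_axis h]
    simpa using hz

lemma trace_conj (h M : SL(2, ℤ)) : (h * M * h⁻¹).1.trace = M.1.trace := by
  simp only [Matrix.SpecialLinearGroup.coe_mul]
  rw [Matrix.trace_mul_comm, ← Matrix.mul_assoc, ← Matrix.SpecialLinearGroup.coe_mul,
    inv_mul_cancel]
  simp

lemma IsHyp.conj {M : SL(2, ℤ)} (hM : IsHyp M) (h : SL(2, ℤ)) : IsHyp (h * M * h⁻¹) := by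
  rwa [IsHyp, trace_conj]

lemma trace_eq (M : SL(2, ℤ)) : M.1.trace = M 0 0 + M 1 1 := by
  rw [Matrix.trace_fin_two]

lemma not_isSquare_sq_sub_four {t m : ℤ} (ht : 2 < |t|) : m ^ 2 ≠ t ^ 2 - 4 := by
  intro h
  rw [← sq_abs m, ← sq_abs t] at h
  have h0 := abs_nonneg m
  have h1 : |m| < |t| := by nlinarith
  have h2 : |m| ≤ |t| - 1 := by omega
  nlinarith

/-- A hyperbolic matrix has no rational fixed point. -/
lemma IsHyp.fixForm_ne_zero {M : SL(2, ℤ)} (hM : IsHyp M) {k n : ℤ} (hkn : k ≠ 0 ∨ n ≠ 0) :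
    fixForm M (k, n) ≠ 0 := by
  intro h
  have h' : M 1 0 * k ^ 2 + (M 1 1 - M 0 0) * (k * n) - M 0 1 * n ^ 2 = 0 := by
    simp only [fixForm] at h
    exact_mod_cast h
  have hdet := det_int M
  rw [IsHyp, trace_eq] at hM
  rcases eq_or_ne n 0 with rfl | hn
  · have hk : k ≠ 0 := by simpa using hkn
    have hc : M 1 0 = 0 := by simpa [hk] using h'
    rw [hc] at hdet
    refine not_isSquare_sq_sub_four (m := M 0 0 - M 1 1) hM ?_
    linear_combination -4 * hdet
  · have e : (2 * M 1 0 * k + (M 1 1 - M 0 0) * n) ^ 2 = n ^ 2 * ((M 0 0 + M 1 1) ^ 2 - 4) := by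
      linear_combination 4 * M 1 0 * h' - 4 * n ^ 2 * hdet
    have hd : n ∣ (2 * M 1 0 * k + (M 1 1 - M 0 0) * n) :=
      (Int.pow_dvd_pow_iff two_ne_zero).mp ⟨_, e⟩
    obtain ⟨m, hm⟩ := hd
    refine not_isSquare_sq_sub_four (m := m) hM ?_
    rw [hm, mul_pow] at e
    exact mul_left_cancel₀ (pow_ne_zero 2 hn) e

lemma IsHyp.c_ne_zero {M : SL(2, ℤ)} (hM : IsHyp M) : (M 1 0 : ℝ) ≠ 0 := by
  have := hM.fixForm_ne_zero (k := 1) (n := 0) (by simp)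
  simpa [fixForm] using this

/-- `p < q` are the fixed points of `M` (and `∞` is not fixed). -/
structure FixPair (M : SL(2, ℤ)) (p q : ℝ) : Prop where
  c_ne : (M 1 0 : ℝ) ≠ 0
  lt : p < q
  sum : (M 1 0 : ℝ) * (p + q) = M 0 0 - M 1 1
  prod : (M 1 0 : ℝ) * (p * q) = -M 0 1

lemma FixPair.fixForm {M : SL(2, ℤ)} {p q : ℝ} (h : FixPair M p q) (U : ℝ × ℝ) :
    fixForm M U = M 1 0 * ((U.1 - p * U.2) * (U.1 - q * U.2)) := by
  simp only [MarkovTorus.fixForm]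
  linear_combination (U.1 * U.2) * h.sum - U.2 ^ 2 * h.prod

lemma IsHyp.exists_fixPair {M : SL(2, ℤ)} (hM : IsHyp M) : ∃ p q, FixPair M p q := by
  have hc := hM.c_ne_zero
  have hdet := det_real M
  have hD : 0 < ((M 0 0 : ℝ) + M 1 1) ^ 2 - 4 := by
    rw [IsHyp, trace_eq] at hM
    have h2 : (2 : ℝ) < |(M 0 0 : ℝ) + M 1 1| := by exact_mod_cast hM
    rw [← sq_abs]
    nlinarith
  set s := √(((M 0 0 : ℝ) + M 1 1) ^ 2 - 4) with hs
  have hs0 : 0 < s := Real.sqrt_pos.mpr hD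
  have hs2 : s ^ 2 = ((M 0 0 : ℝ) + M 1 1) ^ 2 - 4 := Real.sq_sqrt hD.le
  have hpos : 0 < s / (2 * |(M 1 0 : ℝ)|) := by positivity
  have habs : |(M 1 0 : ℝ)| ^ 2 = (M 1 0 : ℝ) ^ 2 := sq_abs _
  have habs0 : |(M 1 0 : ℝ)| ≠ 0 := abs_ne_zero.mpr hc
  refine ⟨(M 0 0 - M 1 1) / (2 * M 1 0) - s / (2 * |(M 1 0 : ℝ)|),
    (M 0 0 - M 1 1) / (2 * M 1 0) + s / (2 * |(M 1 0 : ℝ)|), hc, by linarith, ?_, ?_⟩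
  · field_simp; ring
  · have : (s / (2 * |(M 1 0 : ℝ)|)) ^ 2 = s ^ 2 / (4 * (M 1 0 : ℝ) ^ 2) := by
      rw [div_pow, mul_pow, habs]; norm_num
    rw [show ∀ x y : ℝ, (x - y) * (x + y) = x ^ 2 - y ^ 2 by intros; ring, this, hs2]
    field_simp
    linear_combination (-16 : ℝ) * hdet

lemma FixPair.axis_eq {M : SL(2, ℤ)} {p q : ℝ} (h : FixPair M p q) : axis M = geodesic p q := by
  ext z
  change axisForm M z = 0 ↔ z.re ^ 2 + z.im ^ 2 - (p + q) * z.re + p * q = 0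
  have : axisForm M z = M 1 0 * (z.re ^ 2 + z.im ^ 2 - (p + q) * z.re + p * q) := by
    simp only [axisForm]
    linear_combination z.re * h.sum - h.prod
  rw [this]
  simp [h.c_ne]

lemma FixPair.root {M : SL(2, ℤ)} {p q : ℝ} (h : FixPair M p q) {x : ℝ}
    (hx : MarkovTorus.fixForm M (x, 1) = 0) : x = p ∨ x = q := by
  rw [h.fixForm] at hx
  simp only [mul_one, mul_eq_zero, h.c_ne, false_or, sub_eq_zero] at hx
  exact hx

/-- A complete geodesic that is invariant under a hyperbolic matrix is its axis. -/
lemma eq_axis {M : SL(2, ℤ)} (hM : IsHyp M) {L : Set ℍ} (hL : IsCompleteGeodesic L)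
    (hML : (fun z : ℍ => M • z) '' L = L) : L = axis M := by
  obtain ⟨u, v, huv, rfl⟩ := hL
  obtain ⟨u', c, hc, hu⟩ := exists_boundary_smul M u
  obtain ⟨v', d, hd, hv⟩ := exists_boundary_smul M v
  have huv' : u' ≠ v' := by
    intro h
    have hw := wedge_act M (toVec u) (toVec v)
    rw [hu, hv, wedge_smul, h] at hw
    have : wedge (toVec v') (toVec v') = 0 := by simp [wedge, mul_comm]
    rw [this, mul_zero] at hw
    exact huv (wedge_toVec_eq_zero.mp hw.symm)
  obtain ⟨z₁, hz₁, z₂, hz₂, hz⟩ := (geodesic_infinite huv).nontrivial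
  have him : ∀ z ∈ geodesic u v, z ∈ geodesic u' v' := by
    intro z hz
    rw [← hML] at hz
    obtain ⟨w, hw, rfl⟩ := hz
    exact (smul_mem_geodesic hc hd hu hv w).mpr hw
  have hU : ∀ {x y : WithTop ℝ}, wedge (toVec x) (toVec y) = 0 → x = y :=
    fun h => wedge_toVec_eq_zero.mp h
  rcases endpoints_eq huv' hz hz₁ hz₂ (him _ hz₁) (him _ hz₂) with ⟨rfl, rfl⟩ | ⟨rfl, rfl⟩
  · have hself : ∀ X : ℝ × ℝ, ∀ e : ℝ, wedge X (e • X) = 0 := by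
      intro X e; simp [wedge]; ring
    have f1 : fixForm M (toVec u') = 0 := by rw [fixForm_eq, hu, hself, neg_zero]
    have f2 : fixForm M (toVec v') = 0 := by rw [fixForm_eq, hv, hself, neg_zero]
    have hc := hM.c_ne_zero
    cases u' using WithTop.recTopCoe with
    | top => exact absurd f1 (by simpa [fixForm, toVec] using hc)
    | coe u => cases v' using WithTop.recTopCoe with
      | top => exact absurd f2 (by simpa [fixForm, toVec] using hc)
      | coe v =>
        obtain ⟨p, q, hpq⟩ := hM.exists_fixPair
        have huv' : u ≠ v := by simpa using huv
        rw [hpq.axis_eq]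
        rcases hpq.root f1 with rfl | rfl <;> rcases hpq.root f2 with rfl | rfl
        · exact absurd rfl huv
        · rfl
        · exact geodesic_comm _ _
        · exact absurd rfl huv
  · exfalso
    have tr : wedge (act M (toVec v')) (toVec u') + wedge (toVec v') (act M (toVec u')) =
        (M 0 0 + M 1 1) * wedge (toVec v') (toVec u') := by
      simp only [wedge, act]; ring
    rw [hu, hv] at tr
    have : (M 0 0 + M 1 1 : ℝ) * wedge (toVec v') (toVec u') = 0 := by
      rw [← tr]; simp [wedge]; ring
    rcases mul_eq_zero.mp this with h | h
    · rw [IsHyp, trace_eq] at hM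
      have h' : M 0 0 + M 1 1 = 0 := by exact_mod_cast h
      rw [h'] at hM
      norm_num at hM
    · exact huv (hU h)

lemma isCompleteGeodesic_axis {M : SL(2, ℤ)} (hM : IsHyp M) : IsCompleteGeodesic (axis M) := by
  obtain ⟨p, q, h⟩ := hM.exists_fixPair
  exact ⟨p, q, by simpa using h.lt.ne, h.axis_eq⟩

lemma smul_axis_self (M : SL(2, ℤ)) : (fun z : ℍ => M • z) '' axis M = axis M := by
  rw [image_axis]; simp

/-- Geodesics with linked finite endpoints intersect. -/
lemma exists_mem_inter {p q p' q' : ℝ} (h1 : p < p') (h2 : p' < q) (h3 : q < q') :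
    ∃ z, z ∈ geodesic p q ∧ z ∈ geodesic p' q' := by
  have hD : 0 < p' + q' - (p + q) := by linarith
  set x := (p' * q' - p * q) / (p' + q' - (p + q)) with hx
  have e1 : x - p = (p' - p) * (q' - p) / (p' + q' - (p + q)) := by
    rw [hx]; field_simp; ring
  have e2 : q - x = (q - p') * (q' - q) / (p' + q' - (p + q)) := by
    rw [hx]; field_simp; ring
  have a1 := sub_pos.mpr h1
  have a2 := sub_pos.mpr h2
  have a3 := sub_pos.mpr h3
  have a4 : 0 < q' - p := by linarith
  have hpos : 0 < (x - p) * (q - x) := by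
    rw [e1, e2]; positivity
  obtain ⟨z, hz, hre⟩ := exists_mem_geodesic hpos
  refine ⟨z, hz, ?_⟩
  change z.re ^ 2 + z.im ^ 2 - (p' + q') * z.re + p' * q' = 0
  have hz' : z.re ^ 2 + z.im ^ 2 - (p + q) * z.re + p * q = 0 := hz
  have hxe : x * (p' + q' - (p + q)) = p' * q' - p * q := by rw [hx]; field_simp
  rw [hre] at hz' ⊢
  linarith

lemma exists_mem_vertical_inter {p q t : ℝ} (h1 : p < t) (h2 : t < q) :
    ∃ z, z ∈ geodesic p q ∧ z.re = t := by
  have := mul_pos (sub_pos.mpr h1) (sub_pos.mpr h2)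
  obtain ⟨z, hz, h⟩ := exists_mem_geodesic this
  exact ⟨z, hz, h⟩

/-! ### The projection -/

lemma proj_eq_iff (z w : ℍ) : proj z = proj w ↔ ∃ h ∈ Γ, h • w = z := by
  unfold proj
  rw [Quotient.eq]
  change z ∈ MulAction.orbit Γ w ↔ _
  rw [MulAction.mem_orbit_iff]
  constructor
  · rintro ⟨⟨h, hh⟩, e⟩; exact ⟨h, hh, e⟩
  · rintro ⟨h, hh, e⟩; exact ⟨⟨h, hh⟩, e⟩

lemma proj_smul {h : SL(2, ℤ)} (hh : h ∈ Γ) (z : ℍ) : proj (h • z) = proj z :=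
  (proj_eq_iff _ _).mpr ⟨h, hh, rfl⟩

lemma proj_image_smul {h : SL(2, ℤ)} (hh : h ∈ Γ) {S S' : Set ℍ}
    (hS : ∀ z, h • z ∈ S' ↔ z ∈ S) : proj '' S' = proj '' S := by
  ext x
  constructor
  · rintro ⟨z, hz, rfl⟩
    refine ⟨h⁻¹ • z, (hS _).mp (by simpa using hz), proj_smul (inv_mem hh) z⟩
  · rintro ⟨z, hz, rfl⟩
    exact ⟨h • z, (hS z).mpr hz, proj_smul hh z⟩

lemma proj_axis_conj {h : SL(2, ℤ)} (hh : h ∈ Γ) (M : SL(2, ℤ)) :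
    proj '' axis (h * M * h⁻¹) = proj '' axis M :=
  proj_image_smul hh (smul_mem_axis h M)

end MarkovTorus

namespace MarkovTorus

/-! ### Markov quadrilaterals -/

/-- An integer solution of `n l = k² + 1` with `n > 0`; it stands for the fraction `k/n`. -/
structure MarkovFraction where
  k : ℤ
  n : ℤ
  l : ℤ
  n_pos : 0 < n
  eq : n * l = k ^ 2 + 1

namespace MarkovFraction

/-- The Cohn matrix of a fraction `x`, with `x ↦ ∞ ↦ x + 3`. -/
def matA (x : MarkovFraction) : SL(2, ℤ) :=
  ⟨!![3 * x.n + x.k, -3 * x.k - x.l; x.n, -x.k], by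
    rw [Matrix.det_fin_two_of]; linear_combination x.eq⟩

/-- The Cohn matrix of a fraction `x`, with `x ↦ ∞ ↦ x - 3`. -/
def matB (x : MarkovFraction) : SL(2, ℤ) :=
  ⟨!![3 * x.n - x.k, x.l - 3 * x.k; -x.n, x.k], by
    rw [Matrix.det_fin_two_of]; linear_combination x.eq⟩

@[simp] lemma matA_00 (x : MarkovFraction) : x.matA 0 0 = 3 * x.n + x.k := rfl
@[simp] lemma matA_01 (x : MarkovFraction) : x.matA 0 1 = -3 * x.k - x.l := rfl
@[simp] lemma matA_10 (x : MarkovFraction) : x.matA 1 0 = x.n := rfl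
@[simp] lemma matA_11 (x : MarkovFraction) : x.matA 1 1 = -x.k := rfl
@[simp] lemma matB_00 (x : MarkovFraction) : x.matB 0 0 = 3 * x.n - x.k := rfl
@[simp] lemma matB_01 (x : MarkovFraction) : x.matB 0 1 = x.l - 3 * x.k := rfl
@[simp] lemma matB_10 (x : MarkovFraction) : x.matB 1 0 = -x.n := rfl
@[simp] lemma matB_11 (x : MarkovFraction) : x.matB 1 1 = x.k := rfl

lemma isHyp_matA (x : MarkovFraction) : IsHyp x.matA := by
  rw [IsHyp, trace_eq, matA_00, matA_11]
  have := x.n_pos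
  rw [abs_of_pos] <;> omega

/-- The value `k/n`. -/
def val (x : MarkovFraction) : ℚ := x.k / x.n

/-- The homogeneous coordinates `(k, n)`. -/
def vec (x : MarkovFraction) : ℝ × ℝ := (x.k, x.n)

lemma gcd_eq_one (x : MarkovFraction) : IsCoprime x.k x.n :=
  ⟨-x.k, x.l, by linear_combination x.eq⟩

lemma val_num (x : MarkovFraction) : x.val.num = x.k :=
  Rat.num_div_eq_of_coprime x.n_pos (Int.isCoprime_iff_gcd_eq_one.mp x.gcd_eq_one)

lemma val_den (x : MarkovFraction) : (x.val.den : ℤ) = x.n :=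
  Rat.den_div_eq_of_coprime x.n_pos (Int.isCoprime_iff_gcd_eq_one.mp x.gcd_eq_one)

lemma n_pos_real (x : MarkovFraction) : (0 : ℝ) < x.n := by exact_mod_cast x.n_pos

lemma val_real (x : MarkovFraction) : (x.val : ℝ) = x.k / x.n := by simp [val]

lemma vec_eq (x : MarkovFraction) : x.vec = (x.n : ℝ) • ((x.val : ℝ), (1 : ℝ)) := by
  have := x.n_pos_real.ne'
  ext <;> simp [vec, val_real]
  field_simp

end MarkovFraction

/-- Three fractions `x < y < z` such that the ideal quadrilateral with vertices `x, y, z, ∞` is a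
fundamental domain of `Γ`, with side pairings `matA x` and `matB z`. -/
structure MarkovQuad where
  x : MarkovFraction
  y : MarkovFraction
  z : MarkovFraction
  d₁ : y.k * x.n - x.k * y.n = z.n
  d₂ : z.k * y.n - y.k * z.n = x.n
  d₃ : z.k * x.n - x.k * z.n = 3 * x.n * z.n - y.n

namespace MarkovQuad

/-- Complete two fractions to a quadrilateral. -/
def ofPair (x z : MarkovFraction) (m : ℤ) (hm : 0 < m) (hxz : z.k * x.n - x.k * z.n = m)
    (h : x.n ^ 2 + z.n ^ 2 + m ^ 2 = 3 * x.n * z.n * m) : MarkovQuad :=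
  have d₁ : (3 * x.k * z.n + x.l * z.n - x.k * z.k) * x.n - x.k * (3 * x.n * z.n - m) = z.n := by
    linear_combination z.n * x.eq - x.k * hxz
  have d₂ : z.k * (3 * x.n * z.n - m) - (3 * x.k * z.n + x.l * z.n - x.k * z.k) * z.n = x.n := by
    apply mul_left_cancel₀ x.n_pos.ne'
    linear_combination (-z.n ^ 2) * x.eq - h + (3 * x.n * z.n - m + x.k * z.n) * hxz + 0 * z.eq
  have s : x.n * (z.l - 3 * z.k) - x.k * z.k = -(3 * x.k * z.n + x.l * z.n - x.k * z.k) := by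
    apply mul_left_cancel₀ z.n_pos.ne'
    linear_combination x.n * z.eq + z.k * hxz - d₂
  { x := x
    z := z
    y :=
      { k := 3 * x.k * z.n + x.l * z.n - x.k * z.k
        n := 3 * x.n * z.n - m
        l := -3 * (3 * x.k * z.n + x.l * z.n - x.k * z.k) -
          ((3 * x.n + x.k) * (z.l - 3 * z.k) - (3 * x.k + x.l) * z.k)
        n_pos := by
          have h1 := x.n_pos
          have h2 := z.n_pos
          have : 0 < (3 * x.n * z.n - m) * m := by nlinarith
          exact pos_of_mul_pos_left this hm.le
        eq := by
          linear_combination (z.n * z.l - z.k ^ 2) * x.eq + z.eq -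
            3 * (3 * x.k * z.n + x.l * z.n - x.k * z.k) * hxz -
            ((3 * x.n + x.k) * (3 * z.n - z.k) + (3 * x.k + x.l) * z.n) * s -
            ((3 * x.n + x.k) * (z.l - 3 * z.k) - (3 * x.k + x.l) * z.k) * hxz }
    d₁ := d₁
    d₂ := d₂
    d₃ := by linear_combination hxz }

variable (Q : MarkovQuad)

lemma markov_eq : Q.x.n ^ 2 + Q.y.n ^ 2 + Q.z.n ^ 2 = 3 * Q.x.n * Q.y.n * Q.z.n := by
  linear_combination -Q.x.n * Q.d₂ + Q.y.n * Q.d₃ - Q.z.n * Q.d₁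

lemma k_eq : 3 * Q.x.k * Q.z.n + Q.x.l * Q.z.n - Q.x.k * Q.z.k = Q.y.k := by
  apply mul_left_cancel₀ Q.x.n_pos.ne'
  linear_combination Q.z.n * Q.x.eq - Q.x.k * Q.d₃ - Q.d₁

lemma k_eq' : Q.x.n * (Q.z.l - 3 * Q.z.k) - Q.x.k * Q.z.k = -Q.y.k := by
  apply mul_left_cancel₀ Q.z.n_pos.ne'
  linear_combination Q.x.n * Q.z.eq + Q.z.k * Q.d₃ - Q.d₂

/-- The side pairing `(x, y) → (∞, z)`. -/
def A : SL(2, ℤ) := Q.x.matA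

/-- The side pairing `(z, y) → (∞, x)`. -/
def B : SL(2, ℤ) := Q.z.matB

lemma A_mul_B : Q.A * Q.B = Q.y.matA := by
  have hk := Q.k_eq
  have hk' := Q.k_eq'
  have d₁ := Q.d₁
  have d₃ := Q.d₃
  have h10 : Q.x.n * (3 * Q.z.n - Q.z.k) + -Q.x.k * -Q.z.n = Q.y.n := by
    linear_combination -Q.d₃
  have h11 : Q.x.n * (Q.z.l - 3 * Q.z.k) + -Q.x.k * Q.z.k = -Q.y.k := by
    linear_combination hk'
  have h00 : (3 * Q.x.n + Q.x.k) * (3 * Q.z.n - Q.z.k) + (-3 * Q.x.k - Q.x.l) * -Q.z.n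
      = 3 * Q.y.n + Q.y.k := by
    linear_combination hk - 3 * Q.d₃
  have h01 : (3 * Q.x.n + Q.x.k) * (Q.z.l - 3 * Q.z.k) + (-3 * Q.x.k - Q.x.l) * Q.z.k
      = -3 * Q.y.k - Q.y.l := by
    apply mul_left_cancel₀ Q.y.n_pos.ne'
    linear_combination -(Q.z.n * Q.z.l - Q.z.k ^ 2) * Q.x.eq - Q.z.eq + Q.y.eq +
      ((3 * Q.x.n + Q.x.k) * (3 * Q.z.n - Q.z.k) + (-3 * Q.x.k - Q.x.l) * -Q.z.n) * h11
      - Q.y.k * h00 - ((3 * Q.x.n + Q.x.k) * (Q.z.l - 3 * Q.z.k) + (-3 * Q.x.k - Q.x.l) * Q.z.k) * h10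
  ext i j
  fin_cases i <;> fin_cases j <;>
    simp [A, B, Matrix.mul_apply, Fin.sum_univ_two] <;> linarith

lemma B_mul_A : Q.B * Q.A = Q.y.matB := by
  have hk := Q.k_eq
  have hk' := Q.k_eq'
  have h10 : -Q.z.n * (3 * Q.x.n + Q.x.k) + Q.z.k * Q.x.n = -Q.y.n := by
    linear_combination Q.d₃
  have h11 : -Q.z.n * (-3 * Q.x.k - Q.x.l) + Q.z.k * -Q.x.k = Q.y.k := by
    linear_combination hk
  have h00 : (3 * Q.z.n - Q.z.k) * (3 * Q.x.n + Q.x.k) + (Q.z.l - 3 * Q.z.k) * Q.x.n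
      = 3 * Q.y.n - Q.y.k := by
    linear_combination hk' - 3 * Q.d₃
  have h01 : (3 * Q.z.n - Q.z.k) * (-3 * Q.x.k - Q.x.l) + (Q.z.l - 3 * Q.z.k) * -Q.x.k
      = Q.y.l - 3 * Q.y.k := by
    apply mul_left_cancel₀ Q.y.n_pos.ne'
    linear_combination (Q.z.n * Q.z.l - Q.z.k ^ 2) * Q.x.eq + Q.z.eq - Q.y.eq -
      ((3 * Q.z.n - Q.z.k) * (3 * Q.x.n + Q.x.k) + (Q.z.l - 3 * Q.z.k) * Q.x.n) * h11
      - Q.y.k * h00 + ((3 * Q.z.n - Q.z.k) * (-3 * Q.x.k - Q.x.l) + (Q.z.l - 3 * Q.z.k) * -Q.x.k) * h10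
  ext i j
  fin_cases i <;> fin_cases j <;>
    simp [A, B, Matrix.mul_apply, Fin.sum_univ_two] <;> linarith

/-- The quadrilateral after the flip that replaces `z`. -/
def left : MarkovQuad := ofPair Q.x Q.y Q.z.n Q.z.n_pos Q.d₁ (by linear_combination Q.markov_eq)

/-- The quadrilateral after the flip that replaces `x`. -/
def right : MarkovQuad := ofPair Q.y Q.z Q.x.n Q.x.n_pos Q.d₂ (by linear_combination Q.markov_eq)

/-- The quadrilateral of the Farey triple `-1 < 0 < ∞`. -/
def base : MarkovQuad where
  x := ⟨-1, 1, 2, by norm_num, by norm_num⟩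
  y := ⟨0, 1, 1, by norm_num, by norm_num⟩
  z := ⟨1, 1, 2, by norm_num, by norm_num⟩
  d₁ := by norm_num
  d₂ := by norm_num
  d₃ := by norm_num

lemma left_A : Q.left.A = Q.A := rfl
lemma left_B : Q.left.B = Q.B * Q.A := Q.B_mul_A.symm
lemma right_A : Q.right.A = Q.A * Q.B := Q.A_mul_B.symm
lemma right_B : Q.right.B = Q.B := rfl

lemma base_A : base.A = matAlpha := by
  ext i j; fin_cases i <;> fin_cases j <;> rfl

lemma base_B : base.B = matBeta := by
  ext i j; fin_cases i <;> fin_cases j <;> rfl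

lemma act_A_y : act Q.A Q.y.vec = Q.z.vec := by
  have h1 : (Q.y.k : ℝ) * Q.x.n - Q.x.k * Q.y.n = Q.z.n := by exact_mod_cast Q.d₁
  have h3 : (3 * Q.x.n + Q.x.k : ℝ) * Q.y.k + (-3 * Q.x.k - Q.x.l) * Q.y.n = Q.z.k := by
    have : (3 * Q.x.n + Q.x.k) * Q.y.k + (-3 * Q.x.k - Q.x.l) * Q.y.n = Q.z.k := by
      apply mul_left_cancel₀ Q.x.n_pos.ne'
      linear_combination (3 * Q.x.n + Q.x.k) * Q.d₁ - Q.y.n * Q.x.eq - Q.d₃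
    exact_mod_cast this
  ext
  · simp [act, A, MarkovFraction.vec]; linarith
  · simp [act, A, MarkovFraction.vec]; linarith

lemma act_A_x : act Q.A Q.x.vec = (-1, 0) := by
  have h := Q.x.eq
  have h' : (Q.x.n : ℝ) * Q.x.l = Q.x.k ^ 2 + 1 := by exact_mod_cast h
  ext
  · simp [act, A, MarkovFraction.vec]; linear_combination -h'
  · simp [act, A, MarkovFraction.vec]; ring

lemma act_B_z : act Q.B Q.z.vec = (1, 0) := by
  have h := Q.z.eq
  have h' : (Q.z.n : ℝ) * Q.z.l = Q.z.k ^ 2 + 1 := by exact_mod_cast h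
  ext
  · simp [act, B, MarkovFraction.vec]; linear_combination h'
  · simp [act, B, MarkovFraction.vec]; ring

lemma act_B_y : act Q.B Q.y.vec = Q.x.vec := by
  have h1 : (Q.z.k : ℝ) * Q.y.n - Q.y.k * Q.z.n = Q.x.n := by exact_mod_cast Q.d₂
  have h3 : (3 * Q.z.n - Q.z.k : ℝ) * Q.y.k + (Q.z.l - 3 * Q.z.k) * Q.y.n = Q.x.k := by
    have : (3 * Q.z.n - Q.z.k) * Q.y.k + (Q.z.l - 3 * Q.z.k) * Q.y.n = Q.x.k := by
      apply mul_left_cancel₀ Q.z.n_pos.ne'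
      linear_combination (Q.z.k - 3 * Q.z.n) * Q.d₂ + Q.y.n * Q.z.eq + Q.d₃
    exact_mod_cast this
  ext
  · simp [act, B, MarkovFraction.vec]; linarith
  · simp [act, B, MarkovFraction.vec]; linarith

end MarkovQuad
end MarkovTorus

namespace MarkovTorus

/-! ### Generators of `Γ` -/

lemma S_eq : ModularGroup.S = ModularGroup.T ^ (-3 : ℤ) * (matAlpha * matBeta) := by
  rw [zpow_neg]
  decide

lemma closure_normal : (Subgroup.closure {matAlpha, matBeta}).Normal := by
  set N := Subgroup.closure {matAlpha, matBeta} with hN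
  have ha : matAlpha ∈ N := Subgroup.subset_closure (by simp)
  have hb : matBeta ∈ N := Subgroup.subset_closure (by simp)
  have key : ∀ g : SL(2, ℤ), g * matAlpha * g⁻¹ ∈ N → g * matBeta * g⁻¹ ∈ N →
      g⁻¹ * matAlpha * g ∈ N → g⁻¹ * matBeta * g ∈ N → g ∈ Subgroup.normalizer (N : Set SL(2, ℤ)) := by
    intro g h1 h2 h3 h4
    have aux : ∀ g : SL(2, ℤ), g * matAlpha * g⁻¹ ∈ N → g * matBeta * g⁻¹ ∈ N →
        ∀ x ∈ N, g * x * g⁻¹ ∈ N := by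
      intro g h1 h2
      have : N ≤ N.comap (MulAut.conj g).toMonoidHom := by
        rw [hN, Subgroup.closure_le]
        rintro x (rfl | rfl)
        · simpa using! h1
        · simpa using! h2
      intro x hx
      simpa using! this hx
    rw [Subgroup.mem_normalizer_iff]
    intro x
    refine ⟨aux g h1 h2 x, fun hx => ?_⟩
    have := aux g⁻¹ (by simpa using h3) (by simpa using h4) _ hx
    simpa [mul_assoc] using this
  rw [← Subgroup.normalizer_eq_top_iff, eq_top_iff, ← SpecialLinearGroup.SL2Z_generators,
    Subgroup.closure_le]
  rintro g (rfl | rfl)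
  · apply key
    · rw [show ModularGroup.S * matAlpha * ModularGroup.S⁻¹ = matAlpha⁻¹ by decide]
      exact inv_mem ha
    · rw [show ModularGroup.S * matBeta * ModularGroup.S⁻¹ = matBeta⁻¹ by decide]
      exact inv_mem hb
    · rw [show ModularGroup.S⁻¹ * matAlpha * ModularGroup.S = matAlpha⁻¹ by decide]
      exact inv_mem ha
    · rw [show ModularGroup.S⁻¹ * matBeta * ModularGroup.S = matBeta⁻¹ by decide]
      exact inv_mem hb
  · apply key
    · rw [show ModularGroup.T * matAlpha * ModularGroup.T⁻¹ = matAlpha * matBeta by decide]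
      exact mul_mem ha hb
    · rw [show ModularGroup.T * matBeta * ModularGroup.T⁻¹ = matAlpha⁻¹ by decide]
      exact inv_mem ha
    · rw [show ModularGroup.T⁻¹ * matAlpha * ModularGroup.T = matBeta⁻¹ by decide]
      exact inv_mem hb
    · rw [show ModularGroup.T⁻¹ * matBeta * ModularGroup.T = matBeta * matAlpha by decide]
      exact mul_mem hb ha

lemma closure_sup_zpowers :
    Subgroup.closure {matAlpha, matBeta} ⊔ Subgroup.zpowers ModularGroup.T = ⊤ := by
  rw [eq_top_iff, ← SpecialLinearGroup.SL2Z_generators, Subgroup.closure_le]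
  have ha : matAlpha ∈ Subgroup.closure {matAlpha, matBeta} := Subgroup.subset_closure (by simp)
  have hb : matBeta ∈ Subgroup.closure {matAlpha, matBeta} := Subgroup.subset_closure (by simp)
  have hT : ModularGroup.T ∈ Subgroup.zpowers ModularGroup.T := Subgroup.mem_zpowers _
  rintro g (rfl | rfl)
  · rw [S_eq]
    exact mul_mem (zpow_mem (Subgroup.mem_sup_right hT) _) (Subgroup.mem_sup_left (mul_mem ha hb))
  · exact Subgroup.mem_sup_right hT

lemma gamma_eq_closure : Γ = Subgroup.closure {matAlpha, matBeta} := by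
  have hn := closure_normal
  apply le_antisymm
  · exact Subgroup.Normal.commutator_le_of_self_sup_commutative_eq_top closure_sup_zpowers
      inferInstance
  · rw [Subgroup.closure_le]
    rintro x (rfl | rfl)
    · exact matAlpha_mem
    · exact matBeta_mem

lemma gamma_normal : Γ.Normal := inferInstance

/-- Every element of `SL(2,ℤ)` is the product of a power of `T` and an element of `Γ`. -/
lemma exists_T_zpow_mul (g : SL(2, ℤ)) : ∃ (j : ℤ) (h : SL(2, ℤ)), h ∈ Γ ∧
    g = ModularGroup.T ^ j * h := by
  have hg : g ∈ Γ ⊔ Subgroup.zpowers ModularGroup.T := by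
    rw [gamma_eq_closure, closure_sup_zpowers]; trivial
  rw [sup_comm, Subgroup.mem_sup_of_normal_right] at hg
  obtain ⟨t, ⟨j, rfl⟩, h, hh, rfl⟩ := hg
  exact ⟨j, h, hh, rfl⟩

lemma neg_T_pow_six_mem : (-ModularGroup.T ^ 6 : SL(2, ℤ)) ∈ Γ := by
  have h : (-ModularGroup.T ^ 6 : SL(2, ℤ)) = matAlpha * matBeta * matAlpha⁻¹ * matBeta⁻¹ := by decide
  rw [h]
  exact mul_mem (mul_mem (mul_mem matAlpha_mem matBeta_mem) (inv_mem matAlpha_mem))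
    (inv_mem matBeta_mem)

end MarkovTorus

namespace MarkovTorus

/-! ### Labelled Farey triples -/

/-- `Q` is the quadrilateral of the labels of the Farey triple `(u, v, w)`. -/
inductive IsLabelledTriple : Vertex → Vertex → Vertex → MarkovQuad → Prop
  | base : IsLabelledTriple ((-1 : ℚ) : Vertex) ((0 : ℚ) : Vertex) ⊤ MarkovQuad.base
  | left {u v w v' : Vertex} {Q : MarkovQuad} (h : IsLabelledTriple u v w Q) (hu : 0 ≤ vnum u)
      (hv' : IsFareyTriple u v' v) : IsLabelledTriple u v' v Q.left
  | right {u v w v' : Vertex} {Q : MarkovQuad} (h : IsLabelledTriple u v w Q)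
      (hv' : IsFareyTriple v v' w) : IsLabelledTriple v v' w Q.right

lemma FareyAdj.symm {u v : Vertex} (h : FareyAdj u v) : FareyAdj v u := by
  unfold FareyAdj at *
  rw [← h, ← abs_neg]
  congr 1; ring

lemma IsFareyTriple.adj_left {u v w : Vertex} (h : IsFareyTriple u v w) : FareyAdj u v := by
  have := h.det
  unfold FareyAdj
  rw [h.num_eq, h.den_eq, show vnum u * (vden u + vden w) - vden u * (vnum u + vnum w) = -1 by
    linarith]
  rfl

lemma IsFareyTriple.adj_right {u v w : Vertex} (h : IsFareyTriple u v w) : FareyAdj v w := by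
  have := h.det
  unfold FareyAdj
  rw [h.num_eq, h.den_eq, show (vnum u + vnum w) * vden w - (vden u + vden w) * vnum w = -1 by
    linarith]
  rfl

lemma lt_of_det_pos {u v : Vertex} (hu : 0 < vden u)
    (h : 0 < vnum v * vden u - vden v * vnum u) : u < v := by
  cases u using WithTop.recTopCoe with
  | top => simp [vden] at hu
  | coe r => cases v using WithTop.recTopCoe with
    | top => exact WithTop.coe_lt_top r
    | coe s =>
      rw [WithTop.coe_lt_coe, Rat.lt_iff]
      simp only [vnum, vden] at h
      linarith

lemma IsFareyTriple.mk' {u v w : Vertex} (hu : 0 < vden u)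
    (hdet : vnum w * vden u - vden w * vnum u = 1) (h1 : vnum v = vnum u + vnum w)
    (h2 : vden v = vden u + vden w) : IsFareyTriple u v w where
  lt_left := lt_of_det_pos hu (by rw [h1, h2]; linarith)
  lt_right := lt_of_det_pos (by rw [h2]; linarith [den_nonneg w]) (by rw [h1, h2]; linarith)
  adj := by
    unfold FareyAdj
    rw [show vnum u * vden w - vden u * vnum w = -1 by linarith]
    rfl
  num_eq := h1
  den_eq := h2

/-- A Farey edge has a mediant. -/
lemma exists_fareyTriple {u w : Vertex} (hu : 0 < vden u)
    (hdet : vnum w * vden u - vden w * vnum u = 1) : ∃ v, IsFareyTriple u v w := by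
  obtain ⟨r, h1, h2⟩ := exists_vertex (a := vnum u + vnum w) (b := vden u + vden w)
    (by linarith [den_nonneg w]) ⟨vden u, -vnum u, by linarith⟩
  exact ⟨r, .mk' hu hdet h1 h2⟩

lemma base_isFareyTriple : IsFareyTriple ((-1 : ℚ) : Vertex) ((0 : ℚ) : Vertex) ⊤ := by
  refine .mk' ?_ ?_ ?_ ?_ <;> simp [vnum, vden]

namespace IsLabelledTriple

variable {u v w : Vertex} {Q : MarkovQuad}

lemma isFareyTriple (h : IsLabelledTriple u v w Q) : IsFareyTriple u v w := by
  cases h with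
  | base => exact base_isFareyTriple
  | left _ _ hv' => exact hv'
  | right _ hv' => exact hv'

lemma exists_left (h : IsLabelledTriple u v w Q) (hu : 0 ≤ vnum u) :
    ∃ v', IsLabelledTriple u v' v Q.left := by
  have ht := h.isFareyTriple
  obtain ⟨v', hv'⟩ := exists_fareyTriple (u := u) (w := v) ht.den_left_pos (by
    rw [ht.num_eq, ht.den_eq]; linarith [ht.det])
  exact ⟨v', h.left hu hv'⟩

lemma exists_right (h : IsLabelledTriple u v w Q) : ∃ v', IsLabelledTriple v v' w Q.right := by
  have ht := h.isFareyTriple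
  obtain ⟨v', hv'⟩ := exists_fareyTriple (u := v) (w := w)
    (by rw [ht.den_eq]; linarith [ht.den_left_pos, den_nonneg w]) (by
    rw [ht.num_eq, ht.den_eq]; linarith [ht.det])
  exact ⟨v', h.right hv'⟩

lemma num_nonneg (h : IsLabelledTriple u v w Q) :
    ((0 : ℚ) : Vertex) ≤ v ∧ (0 ≤ vnum u ∨ (u = ((-1 : ℚ) : Vertex) ∧ w = ⊤)) := by
  have num_nonneg : ∀ {v : Vertex}, ((0 : ℚ) : Vertex) ≤ v → 0 ≤ vnum v := by
    intro v hv
    cases v using WithTop.recTopCoe with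
    | top => simp [vnum]
    | coe r => simpa [vnum] using hv
  have of_num_nonneg : ∀ {v : Vertex}, 0 ≤ vnum v → ((0 : ℚ) : Vertex) ≤ v := by
    intro v hv
    cases v using WithTop.recTopCoe with
    | top => simp
    | coe r => simpa [vnum] using hv
  induction h with
  | base => simp
  | left h hu hv' ih => exact ⟨(of_num_nonneg hu).trans hv'.lt_left.le, Or.inl hu⟩
  | right h hv' ih => exact ⟨ih.1.trans hv'.lt_left.le, Or.inl (num_nonneg ih.1)⟩

lemma markov (h : IsLabelledTriple u v w Q) :
    IsMarkovLabel u Q.x.n ∧ IsMarkovLabel v Q.y.n ∧ IsMarkovLabel w Q.z.n := by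
  induction h with
  | base => exact ⟨.neg_one, .zero, .top⟩
  | @left u v w v' Q h hu hv' ih =>
    obtain ⟨hx, hy, hz⟩ := ih
    have ht := h.isFareyTriple
    have h0 : ((0 : ℚ) : Vertex) ≤ u := by
      cases u using WithTop.recTopCoe with
      | top => simp
      | coe r => simpa [vnum] using hu
    exact ⟨hx, .step (h0.trans_lt hv'.lt_left) hv' ht.adj.symm ht.adj_right.symm
      (hv'.lt_right.trans ht.lt_right).ne' hx hy hz, hy⟩
  | @right u v w v' Q h hv' ih =>
    obtain ⟨hx, hy, hz⟩ := ih
    have ht := h.isFareyTriple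
    exact ⟨hy, .step (h.num_nonneg.1.trans_lt hv'.lt_left) hv' ht.adj_left ht.adj
      (ht.lt_left.trans hv'.lt_left).ne hy hz hx, hz⟩

end IsLabelledTriple

lemma MarkovQuad.rule_eq (Q : MarkovQuad) : fractionalRule Q.x.val Q.z.val = Q.y.val := by
  have key : (3 * Q.x.n * Q.z.n - Q.y.n) * Q.y.k = Q.x.k * Q.x.n + Q.z.k * Q.z.n := by
    apply mul_left_cancel₀ Q.x.n_pos.ne'
    have hm : Q.y.n * (3 * Q.x.n * Q.z.n - Q.y.n) = Q.x.n ^ 2 + Q.z.n ^ 2 := by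
      linear_combination -Q.markov_eq
    linear_combination (3 * Q.x.n * Q.z.n - Q.y.n) * Q.d₁ + Q.x.k * hm - Q.z.n * Q.d₃
  have hm : 0 < 3 * Q.x.n * Q.z.n - Q.y.n := by
    have h1 := Q.markov_eq
    have h2 := Q.x.n_pos
    have h3 := Q.y.n_pos
    have : 0 < (3 * Q.x.n * Q.z.n - Q.y.n) * Q.y.n := by nlinarith
    exact pos_of_mul_pos_left this h3.le
  have key' : (3 * Q.x.n * Q.z.n - Q.y.n : ℚ) * Q.y.k = Q.x.k * Q.x.n + Q.z.k * Q.z.n := by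
    exact_mod_cast key
  have d₃ : (Q.z.k * Q.x.n - Q.x.k * Q.z.n : ℚ) = 3 * Q.x.n * Q.z.n - Q.y.n := by
    exact_mod_cast Q.d₃
  have hm' : (3 * Q.x.n * Q.z.n - Q.y.n : ℚ) ≠ 0 := by exact_mod_cast hm.ne'
  have e1 : (Q.x.val.den : ℚ) = Q.x.n := by exact_mod_cast Q.x.val_den
  have e2 : (Q.z.val.den : ℚ) = Q.z.n := by exact_mod_cast Q.z.val_den
  rw [fractionalRule, e1, e2, Q.x.val_num, Q.z.val_num, d₃, ← key', mul_div_cancel_left₀ _ hm',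
    MarkovFraction.val]
  congr 1
  ring

namespace IsLabelledTriple

variable {u v w : Vertex} {Q : MarkovQuad}

lemma fractional (h : IsLabelledTriple u v w Q) :
    IsFractionalLabel u Q.x.val ∧ IsFractionalLabel v Q.y.val ∧ IsFractionalLabel w Q.z.val := by
  induction h with
  | base =>
    refine ⟨?_, ?_, ?_⟩
    · convert IsFractionalLabel.neg_one; simp [MarkovFraction.val, MarkovQuad.base]
    · convert IsFractionalLabel.zero; simp [MarkovFraction.val, MarkovQuad.base]
    · convert IsFractionalLabel.top; simp [MarkovFraction.val, MarkovQuad.base]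
  | @left u v w v' Q h hu hv' ih =>
    obtain ⟨hx, hy, hz⟩ := ih
    have h0 : ((0 : ℚ) : Vertex) ≤ u := by
      cases u using WithTop.recTopCoe with
      | top => simp
      | coe r => simpa [vnum] using hu
    refine ⟨hx, ?_, hy⟩
    rw [← MarkovQuad.rule_eq]
    exact .step (h0.trans_lt hv'.lt_left) hv' hx hy
  | @right u v w v' Q h hv' ih =>
    obtain ⟨hx, hy, hz⟩ := ih
    refine ⟨hy, ?_, hz⟩
    rw [← MarkovQuad.rule_eq]
    exact .step (h.num_nonneg.1.trans_lt hv'.lt_left) hv' hy hz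

/-- The side pairings of a labelled triple generate `Γ` and have the slopes of its outer
vertices. -/
lemma generators (h : IsLabelledTriple u v w Q) : ∃ a b : Γ, (a : SL(2, ℤ)) = Q.A ∧
    (b : SL(2, ℤ)) = Q.B ∧ HasSlope a u ∧ HasSlope b w ∧ Subgroup.closure {a, b} = ⊤ := by
  induction h with
  | base =>
    refine ⟨alpha, beta, MarkovQuad.base_A.symm, MarkovQuad.base_B.symm, ?_, ?_, ?_⟩
    · simp [HasSlope, vnum, vden]
    · simp [HasSlope, vnum, vden]
    · have h1 : (Subgroup.closure {alpha, beta}).map Γ.subtype = (⊤ : Subgroup Γ).map Γ.subtype := by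
        rw [MonoidHom.map_closure, ← MonoidHom.range_eq_map, Subgroup.range_subtype,
          Set.image_pair]
        exact gamma_eq_closure.symm
      exact Subgroup.map_injective Γ.subtype_injective h1
  | @left u v w v' Q h hu hv' ih =>
    obtain ⟨a, b, ha, hb, sa, sb, hcl⟩ := ih
    have ht := h.isFareyTriple
    refine ⟨a, b * a, ha, ?_, sa, ?_, ?_⟩
    · rw [MarkovQuad.left_B, ← ha, ← hb]; rfl
    · unfold HasSlope at *
      rw [map_mul, sa, sb, ht.num_eq, ht.den_eq, mul_mul_mul_comm, ← zpow_add, ← zpow_add]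
      congr 2 <;> ring
    · rw [eq_top_iff, ← hcl, Subgroup.closure_le]
      have h1 : a ∈ Subgroup.closure {a, b * a} := Subgroup.subset_closure (by simp)
      have h2 : b * a ∈ Subgroup.closure {a, b * a} := Subgroup.subset_closure (by simp)
      rintro x (rfl | rfl)
      · exact h1
      · have := mul_mem h2 (inv_mem h1)
        simpa using this
  | @right u v w v' Q h hv' ih =>
    obtain ⟨a, b, ha, hb, sa, sb, hcl⟩ := ih
    have ht := h.isFareyTriple
    refine ⟨a * b, b, ?_, hb, ?_, sb, ?_⟩
    · rw [MarkovQuad.right_A, ← ha, ← hb]; rfl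
    · unfold HasSlope at *
      rw [map_mul, sa, sb, ht.num_eq, ht.den_eq, mul_mul_mul_comm, ← zpow_add, ← zpow_add]
      congr 2; ring
    · rw [eq_top_iff, ← hcl, Subgroup.closure_le]
      have h1 : b ∈ Subgroup.closure {a * b, b} := Subgroup.subset_closure (by simp)
      have h2 : a * b ∈ Subgroup.closure {a * b, b} := Subgroup.subset_closure (by simp)
      rintro x (rfl | rfl)
      · have := mul_mem h2 (inv_mem h1)
        simpa using this
      · exact h1

end IsLabelledTriple

/-- Every nonnegative rational is the center of a labelled triple. -/
lemma exists_labelledTriple {r : ℚ} (hr : 0 ≤ r) :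
    ∃ u w Q, IsLabelledTriple u (r : Vertex) w Q := by
  have key : ∀ N : ℕ, ∀ r : ℚ, 0 ≤ r → r.num + r.den < N →
      ∃ u w Q, IsLabelledTriple u (r : Vertex) w Q := by
    intro N
    induction N with
    | zero =>
      intro r hr h
      have := Rat.num_nonneg.mpr hr
      have := r.den_pos
      omega
    | succ N ih =>
      intro r hr h
      rcases hr.eq_or_lt with rfl | hpos
      · exact ⟨_, _, _, .base⟩
      obtain ⟨u, w, t, htri, h1, h2, h3, eu, ew, et⟩ := exists_step r hpos
      have hp : 0 < r.num := Rat.num_pos.mpr hpos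
      have hq : (0 : ℤ) < r.den := by exact_mod_cast r.den_pos
      have e := htri.det
      have p := htri.den_left_pos
      have d := den_nonneg w
      have ds := den_nonneg t
      have a := htri.num_eq
      have b := htri.den_eq
      have hu : ∃ s : ℚ, u = s ∧ 0 ≤ s ∧ s.num + s.den < r.num + r.den := by
        rcases eu with rfl | rfl | hs
        · simp [vden] at p
        · exfalso
          simp [vnum, vden] at a b e
          omega
        · exact hs
      obtain ⟨su, rfl, hsu, hlu⟩ := hu
      unfold FareyAdj at h1 h2
      rw [abs_eq (by norm_num)] at h1 h2
      have i1 : vnum t = vnum w * (vnum t * vden su - vden t * vnum su)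
          - vnum su * (vnum t * vden w - vden t * vnum w) := by linear_combination (-(vnum t)) * e
      have i2 : vden t = vden w * (vnum t * vden su - vden t * vnum su)
          - vden su * (vnum t * vden w - vden t * vnum w) := by linear_combination (-(vden t)) * e
      rcases h1 with h1 | h1 <;> rcases h2 with h2 | h2 <;> rw [h1, h2] at i1 i2
      · have htri' : IsFareyTriple su w t := .mk' p h1 (by linarith) (by linarith)
        have hw : ∃ s : ℚ, w = s ∧ 0 ≤ s ∧ s.num + s.den < r.num + r.den := by
          rcases ew with rfl | rfl | hs
          · simp only [vden] at i2 ds p; omega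
          · exfalso
            have := htri.lt_right
            rw [WithTop.coe_lt_coe] at this
            linarith
          · exact hs
        obtain ⟨sw, rfl, hsw, hlw⟩ := hw
        obtain ⟨u', w', Q, hQ⟩ := ih sw hsw (by push_cast at h; omega)
        obtain ⟨rfl, rfl⟩ := hQ.isFareyTriple.unique htri'
        exact ⟨_, _, _, hQ.left (by simpa [vnum] using hsu) htri⟩
      · exact absurd (vertex_ext (by linarith) (by linarith)) h3
      · omega
      · have pt : 0 < vden t := by
          rcases ds.lt_or_eq with h0 | h0
          · exact h0
          · exfalso
            have := num_eq_one_of_den_eq_zero h0.symm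
            have e1 : vden su = vden w := by linarith
            have e2 : vnum su = vnum w + 1 := by linarith
            rw [← e1, e2] at e
            linarith
        have htri' : IsFareyTriple t su w := .mk' pt (by linarith) (by linarith) (by linarith)
        obtain ⟨u', w', Q, hQ⟩ := ih su hsu (by push_cast at h; omega)
        obtain ⟨rfl, rfl⟩ := hQ.isFareyTriple.unique htri'
        exact ⟨_, _, _, hQ.right htri⟩
  have := Rat.num_nonneg.mpr hr
  exact key ((r.num + r.den).toNat + 1) r hr (by push_cast; omega)

end MarkovTorus

namespace MarkovTorus

/-! ### Ping-pong on the upper half-plane -/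

/-- The group element of a letter. -/
def letter {G : Type*} [Group G] (f : Bool → G) (l : Bool × Bool) : G :=
  cond l.2 (f l.1) (f l.1)⁻¹

/-- The group element of a word. -/
def evalWord {G : Type*} [Group G] (f : Bool → G) (L : List (Bool × Bool)) : G :=
  (L.map (letter f)).prod

lemma lift_mk_eq {G : Type*} [Group G] (f : Bool → G) (L : List (Bool × Bool)) :
    FreeGroup.lift f (FreeGroup.mk L) = evalWord f L := FreeGroup.lift_mk ..

/-- The inverse letter. -/
def invLetter (l : Bool × Bool) : Bool × Bool := (l.1, !l.2)

@[simp] lemma invLetter_invLetter (l : Bool × Bool) : invLetter (invLetter l) = l := by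
  simp [invLetter]

lemma ne_invLetter_iff (a b : Bool × Bool) : b ≠ invLetter a ↔ (a.1 = b.1 → a.2 = b.2) := by
  obtain ⟨a1, a2⟩ := a
  obtain ⟨b1, b2⟩ := b
  revert a1 a2 b1 b2
  decide

lemma ping_pong {G α : Type*} [Group G] [MulAction G α] {f : Bool → G} {X : Bool × Bool → Set α}
    (hX : ∀ l, ∀ p ∉ X (invLetter l), letter f l • p ∈ X l)
    (hdis : ∀ l m, l ≠ m → ∀ p ∈ X l, p ∉ X m) {p : α} (hp : ∀ l, p ∉ X l)
    (l : Bool × Bool) (L : List (Bool × Bool)) (hL : FreeGroup.IsReduced (l :: L)) :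
    evalWord f (l :: L) • p ∈ X l := by
  induction L generalizing l with
  | nil => simpa [evalWord] using hX l p (hp _)
  | cons m L ih =>
    have h1 : FreeGroup.IsReduced (m :: L) := by
      rw [FreeGroup.IsReduced.eq_1] at hL ⊢
      exact hL.tail
    have h2 : m ≠ invLetter l := by
      rw [ne_invLetter_iff]
      rw [FreeGroup.IsReduced.eq_1, List.isChain_cons_cons] at hL
      exact hL.1
    have h3 := hX l _ (hdis m _ h2 _ (ih m h1))
    rwa [← mul_smul] at h3

lemma ping_pong_unique {G α : Type*} [Group G] [MulAction G α] {f : Bool → G}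
    {X : Bool × Bool → Set α}
    (hX : ∀ l, ∀ p ∉ X (invLetter l), letter f l • p ∈ X l)
    (hdis : ∀ l m, l ≠ m → ∀ p ∈ X l, p ∉ X m) {p : α} (hp : ∀ l, p ∉ X l)
    (w : FreeGroup Bool) (hw : ∀ l, FreeGroup.lift f w • p ∉ X l) : w = 1 := by
  by_contra hne
  rw [← FreeGroup.toWord_eq_nil_iff] at hne
  obtain ⟨l, L, hL⟩ := List.exists_cons_of_ne_nil hne
  have hred : FreeGroup.IsReduced w.toWord := FreeGroup.isReduced_toWord
  rw [hL] at hred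
  have := ping_pong hX hdis hp l L hred
  rw [← lift_mk_eq, ← hL, FreeGroup.mk_toWord] at this
  exact hw l this

lemma qf_pos_smul (g : SL(2, ℤ)) (U V : ℝ × ℝ) (z : ℍ) :
    0 < qf (act g U) (act g V) (g • z) ↔ 0 < qf U V z := by
  rw [← qf_act g U V z]
  exact (mul_pos_iff_of_pos_right (autFactor_pos g z)).symm

lemma qf_self_nonneg (U : ℝ × ℝ) (z : ℍ) : 0 ≤ qf U U z := by
  have : qf U U z = (U.2 * z.re - U.1) ^ 2 + (U.2 * z.im) ^ 2 := by simp [qf]; ring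
  rw [this]; positivity

/-- A point outside a half-disc is outside the half-discs over smaller intervals. -/
lemma qf_pos_of_between {U V W : ℝ × ℝ} {z : ℍ} (h1 : 0 < wedge U W) (h2 : 0 < wedge W V)
    (h3 : 0 < wedge U V) (h : 0 < qf U V z) : 0 < qf U W z ∧ 0 < qf W V z := by
  have e1 : wedge U V * qf U W z = wedge W V * qf U U z + wedge U W * qf U V z := by
    simp [wedge, qf]; ring
  have e2 : wedge U V * qf W V z = wedge W V * qf U V z + wedge U W * qf V V z := by
    simp [wedge, qf]; ring
  have hU := qf_self_nonneg U z
  have hV := qf_self_nonneg V z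
  constructor
  · refine pos_of_mul_pos_right (a := wedge U V) ?_ h3.le
    rw [e1]; positivity
  · refine pos_of_mul_pos_right (a := wedge U V) ?_ h3.le
    rw [e2]; positivity

lemma re_mem_of_qf_nonpos {s t : MarkovFraction} (hst : 0 < wedge s.vec t.vec) {z : ℍ}
    (h : qf s.vec t.vec z ≤ 0) : s.k < s.n * z.re ∧ t.n * z.re < t.k := by
  have hs := s.n_pos_real
  have ht := t.n_pos_real
  have hz := z.im_pos
  have e : qf s.vec t.vec z = (s.n * z.re - s.k) * (t.n * z.re - t.k) + s.n * t.n * z.im ^ 2 := by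
    simp [qf, MarkovFraction.vec]; ring
  have hneg : (s.n * z.re - s.k) * (t.n * z.re - t.k) < 0 := by
    have : 0 < s.n * t.n * z.im ^ 2 := by positivity
    linarith
  have hd : s.n * (t.n * z.re - t.k) < t.n * (s.n * z.re - s.k) := by
    simp only [wedge, MarkovFraction.vec] at hst
    linarith
  rcases mul_neg_iff.mp hneg with ⟨h1, h2⟩ | ⟨h1, h2⟩
  · exact ⟨by linarith, by linarith⟩
  · exfalso
    have := mul_pos hs h2
    have := mul_neg_of_pos_of_neg ht h1
    linarith

namespace MarkovQuad

variable (Q : MarkovQuad)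

lemma wedge_xy : wedge Q.x.vec Q.y.vec = Q.z.n := by
  have := Q.d₁
  simp only [wedge, MarkovFraction.vec]
  rw [← this]; push_cast; ring

lemma wedge_yz : wedge Q.y.vec Q.z.vec = Q.x.n := by
  have := Q.d₂
  simp only [wedge, MarkovFraction.vec]
  rw [← this]; push_cast; ring

lemma d₃_pos : 0 < Q.z.k * Q.x.n - Q.x.k * Q.z.n := by
  have h1 := Q.markov_eq
  have h2 := Q.x.n_pos
  have h3 := Q.y.n_pos
  rw [Q.d₃]
  have : 0 < (3 * Q.x.n * Q.z.n - Q.y.n) * Q.y.n := by nlinarith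
  exact pos_of_mul_pos_left this h3.le

lemma wedge_xz_pos : 0 < wedge Q.x.vec Q.z.vec := by
  have := Q.d₃_pos
  simp only [wedge, MarkovFraction.vec]
  exact_mod_cast (by linarith : 0 < Q.z.k * Q.x.n - Q.z.n * Q.x.k)

lemma wedge_xy_pos : 0 < wedge Q.x.vec Q.y.vec := by rw [wedge_xy]; exact Q.z.n_pos_real
lemma wedge_yz_pos : 0 < wedge Q.y.vec Q.z.vec := by rw [wedge_yz]; exact Q.x.n_pos_real

lemma val_lt_xy : Q.x.val < Q.y.val := by
  have h := Q.wedge_xy_pos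
  simp only [wedge, MarkovFraction.vec] at h
  have : (Q.x.val : ℝ) < Q.y.val := by
    rw [MarkovFraction.val_real, MarkovFraction.val_real,
      div_lt_div_iff₀ Q.x.n_pos_real Q.y.n_pos_real]
    linarith
  exact_mod_cast this

lemma val_lt_yz : Q.y.val < Q.z.val := by
  have h := Q.wedge_yz_pos
  simp only [wedge, MarkovFraction.vec] at h
  have : (Q.y.val : ℝ) < Q.z.val := by
    rw [MarkovFraction.val_real, MarkovFraction.val_real,
      div_lt_div_iff₀ Q.y.n_pos_real Q.z.n_pos_real]
    linarith
  exact_mod_cast this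

/-- The regions cut off by the four sides of the quadrilateral; the pairings `A`, `B` are indexed
by `true`, `false`. -/
def region : Bool × Bool → Set ℍ
  | (true, true) => {p | 0 < qf (-1, 0) Q.z.vec p}
  | (true, false) => {p | ¬ 0 < qf Q.x.vec Q.y.vec p}
  | (false, true) => {p | 0 < qf Q.x.vec (1, 0) p}
  | (false, false) => {p | ¬ 0 < qf Q.y.vec Q.z.vec p}

/-- The quadrilateral, with two of its sides. -/
def core : Set ℍ := {p | ∀ l, p ∉ Q.region l}

lemma qf_neg_one_zero (s : MarkovFraction) (p : ℍ) : qf (-1, 0) s.vec p = s.n * p.re - s.k := by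
  simp [qf, MarkovFraction.vec]; ring

lemma qf_one_zero (s : MarkovFraction) (p : ℍ) : qf s.vec (1, 0) p = s.k - s.n * p.re := by
  simp [qf, MarkovFraction.vec]; ring

lemma mem_core (p : ℍ) : p ∈ Q.core ↔ Q.x.k ≤ Q.x.n * p.re ∧ Q.z.n * p.re ≤ Q.z.k ∧
    0 < qf Q.x.vec Q.y.vec p ∧ 0 < qf Q.y.vec Q.z.vec p := by
  simp only [core, region, Set.mem_ofPred_eq, Prod.forall, Bool.forall_bool, qf_neg_one_zero,
    qf_one_zero, not_lt, not_le]
  constructor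
  · rintro ⟨⟨h1, h2⟩, h3, h4⟩; exact ⟨by linarith, by linarith, h3, h1⟩
  · rintro ⟨h1, h2, h3, h4⟩; exact ⟨⟨h4, by linarith⟩, h3, by linarith⟩

lemma smul_mem_region_A (p : ℍ) : Q.A • p ∈ Q.region (true, true) ↔ p ∉ Q.region (true, false) := by
  change 0 < qf (-1, 0) Q.z.vec (Q.A • p) ↔ ¬ ¬ 0 < qf Q.x.vec Q.y.vec p
  rw [not_not, ← Q.act_A_x, ← Q.act_A_y, qf_pos_smul]

lemma smul_mem_region_B (p : ℍ) : Q.B • p ∈ Q.region (false, true) ↔ p ∉ Q.region (false, false) := by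
  change 0 < qf Q.x.vec (1, 0) (Q.B • p) ↔ ¬ ¬ 0 < qf Q.y.vec Q.z.vec p
  rw [not_not, ← Q.act_B_z, ← Q.act_B_y, qf_pos_smul]

lemma letter_smul_mem_region {f : Bool → Γ} (hA : (f true : SL(2, ℤ)) = Q.A)
    (hB : (f false : SL(2, ℤ)) = Q.B) (l : Bool × Bool) (p : ℍ) (hp : p ∉ Q.region (invLetter l)) :
    letter f l • p ∈ Q.region l := by
  rcases l with ⟨_ | _, _ | _⟩
  · by_contra hcon
    have := (Q.smul_mem_region_B _).mpr hcon
    rw [← hB] at this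
    change f false • (f false)⁻¹ • p ∈ _ at this
    rw [smul_inv_smul] at this
    exact hp this
  · have := (Q.smul_mem_region_B _).mpr hp
    rw [← hB] at this
    exact this
  · by_contra hcon
    have := (Q.smul_mem_region_A _).mpr hcon
    rw [← hA] at this
    change f true • (f true)⁻¹ • p ∈ _ at this
    rw [smul_inv_smul] at this
    exact hp this
  · have := (Q.smul_mem_region_A _).mpr hp
    rw [← hA] at this
    exact this

lemma region_disjoint (l m : Bool × Bool) (h : l ≠ m) (p : ℍ) (hp : p ∈ Q.region l) :
    p ∉ Q.region m := by
  have hx := Q.x.n_pos_real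
  have hy := Q.y.n_pos_real
  have hz := Q.z.n_pos_real
  have hxy := Q.wedge_xy_pos
  have hyz := Q.wedge_yz_pos
  simp only [wedge, MarkovFraction.vec] at hxy hyz
  have loc : ∀ l, p ∈ Q.region l →
      match l with
      | (true, true) => Q.z.k < Q.z.n * p.re
      | (true, false) => Q.x.k < Q.x.n * p.re ∧ Q.y.n * p.re < Q.y.k
      | (false, true) => Q.x.n * p.re < Q.x.k
      | (false, false) => Q.y.k < Q.y.n * p.re ∧ Q.z.n * p.re < Q.z.k := by
    rintro ⟨_ | _, _ | _⟩ h
    · exact re_mem_of_qf_nonpos Q.wedge_yz_pos (not_lt.mp h)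
    · have : 0 < qf Q.x.vec (1, 0) p := h
      rw [qf_one_zero] at this
      simpa using this
    · exact re_mem_of_qf_nonpos Q.wedge_xy_pos (not_lt.mp h)
    · have : 0 < qf (-1, 0) Q.z.vec p := h
      rw [qf_neg_one_zero] at this
      simpa using this
  intro hm
  have h1 := loc l hp
  have h2 := loc m hm
  have hlt : (Q.x.k : ℝ) / Q.x.n < Q.y.k / Q.y.n := by
    rw [div_lt_div_iff₀ hx hy]; linarith
  have hlt' : (Q.y.k : ℝ) / Q.y.n < Q.z.k / Q.z.n := by
    rw [div_lt_div_iff₀ hy hz]; linarith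
  rcases l with ⟨_ | _, _ | _⟩ <;> rcases m with ⟨_ | _, _ | _⟩ <;> simp only at h1 h2 <;>
    first
      | exact h rfl
      | (simp only [← div_lt_iff₀' hx, ← lt_div_iff₀' hx, ← div_lt_iff₀' hy, ← lt_div_iff₀' hy,
          ← div_lt_iff₀' hz, ← lt_div_iff₀' hz] at h1 h2
         linarith)

/-- Distinct elements of `Γ` move a point of the core to distinct translates of the core. -/
lemma core_unique {f : Bool → Γ} (hA : (f true : SL(2, ℤ)) = Q.A)
    (hB : (f false : SL(2, ℤ)) = Q.B) {p : ℍ} (hp : p ∈ Q.core) {w : FreeGroup Bool}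
    (h : FreeGroup.lift f w • p ∈ Q.core) : w = 1 :=
  ping_pong_unique (Q.letter_smul_mem_region hA hB) Q.region_disjoint hp w h

end MarkovQuad

lemma range_lift_eq_top {G : Type*} [Group G] {a b : G} (h : Subgroup.closure {a, b} = ⊤) :
    Function.Surjective (FreeGroup.lift (fun i : Bool => cond i a b)) := by
  rw [← MonoidHom.range_eq_top, FreeGroup.range_lift_eq_closure, eq_top_iff, ← h]
  apply Subgroup.closure_mono
  rintro x (rfl | rfl)
  · exact ⟨true, rfl⟩
  · exact ⟨false, rfl⟩

lemma IsLabelledTriple.core_unique {u v w : Vertex} {Q : MarkovQuad}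
    (h : IsLabelledTriple u v w Q) {p : ℍ} (hp : p ∈ Q.core) {g : SL(2, ℤ)} (hg : g ∈ Γ)
    (hgp : g • p ∈ Q.core) : g = 1 := by
  obtain ⟨a, b, ha, hb, -, -, hcl⟩ := h.generators
  obtain ⟨w, hw⟩ := range_lift_eq_top hcl ⟨g, hg⟩
  have : w = 1 := by
    refine Q.core_unique (f := fun i : Bool => cond i a b) ha hb hp ?_
    rw [hw]; exact hgp
  rw [this, map_one] at hw
  exact (congrArg Subtype.val hw).symm

end MarkovTorus

namespace MarkovTorus

/-! ### The quadrilaterals are fundamental domains -/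

lemma T_zpow_six_mem (j : ℤ) :
    ModularGroup.T ^ (6 * j) ∈ Γ ∨ -ModularGroup.T ^ (6 * j) ∈ Γ := by
  rw [zpow_mul]
  have h : (-ModularGroup.T ^ (6 : ℤ) : SL(2, ℤ)) ∈ Γ := neg_T_pow_six_mem
  generalize (ModularGroup.T ^ (6 : ℤ) : SL(2, ℤ)) = g at h
  have hinv : (-g)⁻¹ = -g⁻¹ := by
    rw [inv_eq_iff_mul_eq_one, neg_mul_neg, mul_inv_cancel]
  induction j using Int.induction_on with
  | zero => left; rw [zpow_zero]; exact one_mem _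
  | succ i ih =>
    rcases ih with ih | ih
    · right
      have := mul_mem ih h
      rwa [mul_neg, ← zpow_add_one] at this
    · left
      have := mul_mem ih h
      rwa [neg_mul_neg, ← zpow_add_one] at this
  | pred i ih =>
    have h' := inv_mem h
    rw [hinv] at h'
    rcases ih with ih | ih
    · right
      have := mul_mem ih h'
      rwa [mul_neg, ← zpow_sub_one] at this
    · left
      have := mul_mem ih h'
      rwa [neg_mul_neg, ← zpow_sub_one] at this

/-- Translations by multiples of `6` are induced by elements of `Γ`. -/
lemma exists_translate (j : ℤ) : ∃ h ∈ Γ, (∀ z : ℍ, h • z = ModularGroup.T ^ (6 * j) • z) ∧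
    (h = ModularGroup.T ^ (6 * j) ∨ h = -ModularGroup.T ^ (6 * j)) := by
  rcases T_zpow_six_mem j with h | h
  · exact ⟨_, h, fun z => rfl, Or.inl rfl⟩
  · exact ⟨_, h, fun z => ModularGroup.SL_neg_smul _ z, Or.inr rfl⟩

lemma qf_pos_smul_inv (g : SL(2, ℤ)) (U V : ℝ × ℝ) (z : ℍ) :
    0 < qf U V (g⁻¹ • z) ↔ 0 < qf (act g U) (act g V) z := by
  rw [← qf_pos_smul g]; simp

lemma mem_core_inv_smul (Q : MarkovQuad) (g : SL(2, ℤ)) (z : ℍ) : g⁻¹ • z ∈ Q.core ↔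
    qf (act g Q.x.vec) (act g (1, 0)) z ≤ 0 ∧ qf (act g (-1, 0)) (act g Q.z.vec) z ≤ 0 ∧
    0 < qf (act g Q.x.vec) (act g Q.y.vec) z ∧ 0 < qf (act g Q.y.vec) (act g Q.z.vec) z := by
  rw [← not_lt, ← not_lt, ← qf_pos_smul_inv, ← qf_pos_smul_inv, ← qf_pos_smul_inv,
    ← qf_pos_smul_inv, MarkovQuad.mem_core, MarkovQuad.qf_one_zero, MarkovQuad.qf_neg_one_zero,
    not_lt, not_lt, sub_nonpos, sub_nonpos]

lemma base_cover_of_outside {z : ℍ} (hz : ∀ m : ℤ, 1 ≤ (z.re - m) ^ 2 + z.im ^ 2) :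
    ∃ h ∈ Γ, h • z ∈ MarkovQuad.base.core := by
  -- translate to `-2 ≤ re < 4`
  obtain ⟨j, hj1, hj2⟩ : ∃ j : ℤ, -2 ≤ z.re + 6 * j ∧ z.re + 6 * j < 4 := by
    refine ⟨-⌊(z.re + 2) / 6⌋, ?_, ?_⟩
    · have := Int.floor_le ((z.re + 2) / 6)
      push_cast; linarith
    · have := Int.lt_floor_add_one ((z.re + 2) / 6)
      push_cast; linarith
  obtain ⟨h, hh, hz', -⟩ := exists_translate j
  suffices H : ∃ g ∈ Γ, g⁻¹ • h • z ∈ MarkovQuad.base.core by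
    obtain ⟨g, hg, H⟩ := H
    exact ⟨g⁻¹ * h, mul_mem (inv_mem hg) hh, by rwa [mul_smul]⟩
  rw [hz']
  set w := ModularGroup.T ^ (6 * j) • z with hw
  have hre : w.re = z.re + 6 * j := by
    rw [hw, ModularGroup.re_T_zpow_smul]; push_cast; ring
  have him : w.im = z.im := ModularGroup.im_T_zpow_smul z _
  have hE : ∀ m : ℤ, 1 ≤ (w.re - m) ^ 2 + w.im ^ 2 := by
    intro m
    have := hz (m - 6 * j)
    push_cast at this
    rw [hre, him]
    convert this using 3
    ring
  rw [← hre] at hj1 hj2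
  have m1 := hE (-1)
  have m2 := hE (-2)
  have p0 := hE 0
  have p1 := hE 1
  have p2 := hE 2
  have p3 := hE 3
  have p4 := hE 4
  push_cast at m1 m2 p0 p1 p2 p3 p4
  clear hw
  clear_value w
  rcases lt_or_ge w.re (-1) with c1 | c1
  · refine ⟨matBeta, matBeta_mem, ?_⟩
    rw [mem_core_inv_smul]
    simp [MarkovQuad.base, MarkovFraction.vec, act, qf, matBeta]
    refine ⟨?_, ?_, ?_, ?_⟩ <;> nlinarith
  rcases le_or_gt w.re 1 with c2 | c2
  · refine ⟨1, one_mem _, ?_⟩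
    rw [mem_core_inv_smul]
    simp [MarkovQuad.base, MarkovFraction.vec, act, qf]
    refine ⟨?_, ?_, ?_, ?_⟩ <;> nlinarith
  rcases le_or_gt w.re 2 with c3 | c3
  · refine ⟨matAlpha, matAlpha_mem, ?_⟩
    rw [mem_core_inv_smul]
    simp [MarkovQuad.base, MarkovFraction.vec, act, qf, matAlpha]
    refine ⟨?_, ?_, ?_, ?_⟩ <;> nlinarith
  · refine ⟨matAlpha * matBeta, mul_mem matAlpha_mem matBeta_mem, ?_⟩
    rw [mem_core_inv_smul]
    simp only [act_mul]
    simp [MarkovQuad.base, MarkovFraction.vec, act, qf, matAlpha, matBeta]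
    refine ⟨?_, ?_, ?_, ?_⟩ <;> nlinarith

lemma base_cover (z : ℍ) : ∃ h ∈ Γ, h • z ∈ MarkovQuad.base.core := by
  obtain ⟨g, hg⟩ := ModularGroup.exists_smul_mem_fd z
  obtain ⟨j, h, hh, rfl⟩ := exists_T_zpow_mul g
  suffices H : ∃ h' ∈ Γ, h' • h • z ∈ MarkovQuad.base.core by
    obtain ⟨h', hh', H⟩ := H
    exact ⟨h' * h, mul_mem hh' hh, by rwa [mul_smul]⟩
  apply base_cover_of_outside
  intro m
  rw [mul_smul] at hg
  obtain ⟨h1, h2⟩ := hg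
  generalize h • z = w at *
  have h1' : 1 ≤ (w.re + j) ^ 2 + w.im ^ 2 := by
    rw [Complex.normSq_apply] at h1
    have e1 : ((ModularGroup.T ^ j • w : ℍ) : ℂ).re = w.re + j := ModularGroup.re_T_zpow_smul w j
    have e2 : ((ModularGroup.T ^ j • w : ℍ) : ℂ).im = w.im := ModularGroup.im_T_zpow_smul w j
    rw [e1, e2] at h1
    linarith
  rw [ModularGroup.re_T_zpow_smul, abs_le] at h2
  -- an integer distance from the center
  have e : (w.re - m) = (w.re + j) - ((m + j : ℤ) : ℝ) := by push_cast; ring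
  rw [e]
  generalize w.re + j = x at *
  generalize m + j = i
  have : 0 ≤ (i : ℝ) ^ 2 - 2 * x * i := by
    rcases lt_trichotomy i 0 with hi | rfl | hi
    · have : (i : ℝ) ≤ -1 := by exact_mod_cast (by omega : i ≤ -1)
      nlinarith
    · simp
    · have : (1 : ℝ) ≤ i := by exact_mod_cast hi
      nlinarith
  nlinarith

namespace MarkovQuad

variable (Q : MarkovQuad)

lemma left_cover {p : ℍ} (hp : p ∈ Q.core) : p ∈ Q.left.core ∨ Q.A⁻¹ • p ∈ Q.left.core := by
  have hp' := (Q.mem_core p).mp hp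
  obtain ⟨h1, h2, h3, h4⟩ := hp'
  rcases le_or_gt (Q.y.n * p.re) Q.y.k with h | h
  · left
    rw [mem_core]
    have := qf_pos_of_between Q.left.wedge_xy_pos Q.left.wedge_yz_pos Q.wedge_xy_pos h3
    exact ⟨h1, h, this⟩
  · right
    have hmem : Q.A⁻¹ • p ∈ Q.region (true, false) := by
      by_contra hcon
      rw [← Q.smul_mem_region_A] at hcon
      rw [smul_inv_smul] at hcon
      exact hp _ hcon
    have hre := re_mem_of_qf_nonpos Q.wedge_xy_pos (not_lt.mp hmem)
    rw [mem_core]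
    refine ⟨hre.1.le, hre.2.le, ?_, ?_⟩
    · have := (Q.left.smul_mem_region_A (Q.A⁻¹ • p)).mp (by
        rw [left_A, smul_inv_smul]
        change 0 < qf (-1, 0) Q.y.vec p
        rw [qf_neg_one_zero]; linarith)
      exact not_not.mp this
    · rw [qf_pos_smul_inv]
      have e1 : act Q.A Q.left.y.vec = Q.y.vec := Q.left.act_A_y
      have e2 : act Q.A Q.left.z.vec = Q.z.vec := Q.act_A_y
      rw [e1, e2]
      exact h4

lemma right_cover {p : ℍ} (hp : p ∈ Q.core) : p ∈ Q.right.core ∨ Q.B⁻¹ • p ∈ Q.right.core := by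
  have hp' := (Q.mem_core p).mp hp
  obtain ⟨h1, h2, h3, h4⟩ := hp'
  rcases le_or_gt (Q.y.k : ℝ) (Q.y.n * p.re) with h | h
  · left
    rw [mem_core]
    have := qf_pos_of_between Q.right.wedge_xy_pos Q.right.wedge_yz_pos Q.wedge_yz_pos h4
    exact ⟨h, h2, this⟩
  · right
    have hmem : Q.B⁻¹ • p ∈ Q.region (false, false) := by
      by_contra hcon
      rw [← Q.smul_mem_region_B] at hcon
      rw [smul_inv_smul] at hcon
      exact hp _ hcon
    have hre := re_mem_of_qf_nonpos Q.wedge_yz_pos (not_lt.mp hmem)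
    rw [mem_core]
    refine ⟨hre.1.le, hre.2.le, ?_, ?_⟩
    · rw [qf_pos_smul_inv]
      have e1 : act Q.B Q.right.y.vec = Q.y.vec := Q.right.act_B_y
      have e2 : act Q.B Q.right.x.vec = Q.x.vec := Q.act_B_y
      rw [e1, e2]
      exact h3
    · have := (Q.right.smul_mem_region_B (Q.B⁻¹ • p)).mp (by
        rw [right_B, smul_inv_smul]
        change 0 < qf Q.y.vec (1, 0) p
        rw [qf_one_zero]; linarith)
      exact not_not.mp this

end MarkovQuad

namespace IsLabelledTriple

variable {u v w : Vertex} {Q : MarkovQuad}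

lemma A_mem (h : IsLabelledTriple u v w Q) : Q.A ∈ Γ := by
  obtain ⟨a, b, ha, hb, -⟩ := h.generators
  rw [← ha]; exact a.2

lemma B_mem (h : IsLabelledTriple u v w Q) : Q.B ∈ Γ := by
  obtain ⟨a, b, ha, hb, -⟩ := h.generators
  rw [← hb]; exact b.2

/-- The translates of the core cover the upper half-plane. -/
lemma cover (h : IsLabelledTriple u v w Q) (z : ℍ) : ∃ g ∈ Γ, g • z ∈ Q.core := by
  induction h with
  | base => exact base_cover z
  | @left u v w v' Q h hu hv' ih =>
    obtain ⟨g, hg, hz⟩ := ih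
    rcases Q.left_cover hz with h' | h'
    · exact ⟨g, hg, h'⟩
    · exact ⟨Q.A⁻¹ * g, mul_mem (inv_mem h.A_mem) hg, by rwa [mul_smul]⟩
  | @right u v w v' Q h hv' ih =>
    obtain ⟨g, hg, hz⟩ := ih
    rcases Q.right_cover hz with h' | h'
    · exact ⟨g, hg, h'⟩
    · exact ⟨Q.B⁻¹ * g, mul_mem (inv_mem h.B_mem) hg, by rwa [mul_smul]⟩

end IsLabelledTriple

/-- `Γ` acts freely. -/
lemma eq_one_of_smul_eq {g : SL(2, ℤ)} (hg : g ∈ Γ) {z : ℍ} (h : g • z = z) : g = 1 := by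
  obtain ⟨k, hk, hz⟩ := base_cover z
  have h1 : (k * g * k⁻¹) • k • z ∈ MarkovQuad.base.core := by
    rw [← mul_smul, inv_mul_cancel_right, mul_smul, h]; exact hz
  have := IsLabelledTriple.base.core_unique hz (mul_mem (mul_mem hk hg) (inv_mem hk)) h1
  simpa [conj_eq_one_iff] using this

end MarkovTorus

namespace MarkovTorus

/-! ### Ping-pong on the boundary -/

/-- The closed cone spanned by `P`, `R` (if `0 < wedge P R`). -/
def InCone (P R V : ℝ × ℝ) : Prop := 0 ≤ wedge P V ∧ 0 ≤ wedge V R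

lemma InCone.mono {P R P' R' V : ℝ × ℝ} (h : InCone P R V) (hPR : 0 < wedge P R)
    (h1 : 0 ≤ wedge P' P) (h2 : 0 ≤ wedge P' R) (h3 : 0 ≤ wedge P R') (h4 : 0 ≤ wedge R R') :
    InCone P' R' V := by
  have e1 : wedge P R * wedge P' V = wedge V R * wedge P' P + wedge P V * wedge P' R := by
    simp only [wedge]; ring
  have e2 : wedge P R * wedge V R' = wedge V R * wedge P R' + wedge P V * wedge R R' := by
    simp only [wedge]; ring
  obtain ⟨a, b⟩ := h
  constructor
  · refine nonneg_of_mul_nonneg_right (a := wedge P R) ?_ hPR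
    rw [e1]; positivity
  · refine nonneg_of_mul_nonneg_right (a := wedge P R) ?_ hPR
    rw [e2]; positivity

lemma inCone_act (g : SL(2, ℤ)) {P R V : ℝ × ℝ} : InCone (act g P) (act g R) (act g V) ↔ InCone P R V := by
  simp only [InCone, wedge_act]

lemma inCone_neg {P R V : ℝ × ℝ} : InCone (-P) (-R) V ↔ InCone P R ((-1 : ℝ) • V) := by
  simp [InCone, wedge]

lemma act_neg (g : SL(2, ℤ)) (U : ℝ × ℝ) : act g (-U) = -act g U := by
  ext <;> simp [act] <;> ring

namespace MarkovQuad

variable (Q : MarkovQuad)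

/-- The initial boundary vector of the cone of a letter. -/
def coneStart : Bool × Bool → ℝ × ℝ
  | (true, true) => Q.z.vec
  | (false, true) => (1, 0)
  | (true, false) => -Q.x.vec
  | (false, false) => -Q.y.vec

/-- The final boundary vector of the cone of a letter. -/
def coneEnd : Bool × Bool → ℝ × ℝ
  | (true, true) => (1, 0)
  | (false, true) => -Q.x.vec
  | (true, false) => -Q.y.vec
  | (false, false) => -Q.z.vec

lemma letter_inCone {G : Bool → SL(2, ℤ)} (hA : G true = Q.A) (hB : G false = Q.B)
    (l m : Bool × Bool) (h : m ≠ invLetter l) : ∃ ε : ℝ, ε ≠ 0 ∧ ∀ V,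
      InCone (Q.coneStart m) (Q.coneEnd m) V →
        InCone (Q.coneStart l) (Q.coneEnd l) (ε • act (letter G l) V) := by
  have hx := Q.x.n_pos_real
  have hy := Q.y.n_pos_real
  have hz := Q.z.n_pos_real
  have hxy := Q.wedge_xy_pos
  have hyz := Q.wedge_yz_pos
  have hxz := Q.wedge_xz_pos
  have hA1 := Q.act_A_x
  have hA2 := Q.act_A_y
  have hB1 := Q.act_B_z
  have hB2 := Q.act_B_y
  have hA1' : act Q.A⁻¹ (1, 0) = -Q.x.vec := by
    rw [← act_inv_act Q.A Q.x.vec, hA1, ← act_neg]; simp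
  have hA2' : act Q.A⁻¹ Q.z.vec = Q.y.vec := by rw [← hA2, act_inv_act]
  have hB1' : act Q.B⁻¹ (1, 0) = Q.z.vec := by rw [← hB1, act_inv_act]
  have hB2' : act Q.B⁻¹ Q.x.vec = Q.y.vec := by rw [← hB2, act_inv_act]
  simp only [wedge, MarkovFraction.vec] at hxy hyz hxz
  have key : ∀ l, ∃ P R, act (letter G l) P = Q.coneStart l ∧ act (letter G l) R = Q.coneEnd l ∧
      ∀ m, m ≠ invLetter l → 0 < wedge (Q.coneStart m) (Q.coneEnd m) ∧
        ((0 ≤ wedge P (Q.coneStart m) ∧ 0 ≤ wedge P (Q.coneEnd m) ∧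
          0 ≤ wedge (Q.coneStart m) R ∧ 0 ≤ wedge (Q.coneEnd m) R) ∨
         (0 ≤ wedge (-P) (Q.coneStart m) ∧ 0 ≤ wedge (-P) (Q.coneEnd m) ∧
          0 ≤ wedge (Q.coneStart m) (-R) ∧ 0 ≤ wedge (Q.coneEnd m) (-R))) := by
    rintro ⟨_ | _, _ | _⟩
    · refine ⟨-Q.x.vec, (-1, 0), ?_, ?_, ?_⟩
      · simp [letter, hB, act_neg, hB2', coneStart]
      · have : ((-1, 0) : ℝ × ℝ) = -(1, 0) := by simp
        rw [this, act_neg]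
        simpa [letter, hB, coneEnd] using hB1'
      · rintro ⟨_ | _, _ | _⟩ hm <;>
        simp only [coneStart, coneEnd, wedge, MarkovFraction.vec, Prod.fst_neg,
          Prod.snd_neg] <;>
        first
          | exact absurd rfl hm
          | exact ⟨by linarith, Or.inl ⟨by linarith, by linarith, by linarith, by linarith⟩⟩
          | exact ⟨by linarith, Or.inr ⟨by linarith, by linarith, by linarith, by linarith⟩⟩
    · refine ⟨Q.z.vec, -Q.y.vec, ?_, ?_, ?_⟩
      · simpa [letter, hB, coneStart] using hB1
      · simp [letter, hB, act_neg, hB2, coneEnd]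
      · rintro ⟨_ | _, _ | _⟩ hm <;>
        simp only [coneStart, coneEnd, wedge, MarkovFraction.vec, Prod.fst_neg,
          Prod.snd_neg] <;>
        first
          | exact absurd rfl hm
          | exact ⟨by linarith, Or.inl ⟨by linarith, by linarith, by linarith, by linarith⟩⟩
    · refine ⟨(1, 0), -Q.z.vec, ?_, ?_, ?_⟩
      · simp [letter, hA, hA1', coneStart]
      · simp [letter, hA, act_neg, hA2', coneEnd]
      · rintro ⟨_ | _, _ | _⟩ hm <;>
        simp only [coneStart, coneEnd, wedge, MarkovFraction.vec, Prod.fst_neg,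
          Prod.snd_neg] <;>
        first
          | exact absurd rfl hm
          | exact ⟨by linarith, Or.inl ⟨by linarith, by linarith, by linarith, by linarith⟩⟩
    · refine ⟨Q.y.vec, -Q.x.vec, ?_, ?_, ?_⟩
      · simp [letter, hA, hA2, coneStart]
      · simp [letter, hA, act_neg, hA1, coneEnd]
      · rintro ⟨_ | _, _ | _⟩ hm <;>
        simp only [coneStart, coneEnd, wedge, MarkovFraction.vec, Prod.fst_neg,
          Prod.snd_neg] <;>
        first
          | exact absurd rfl hm
          | exact ⟨by linarith, Or.inl ⟨by linarith, by linarith, by linarith, by linarith⟩⟩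
          | exact ⟨by linarith, Or.inr ⟨by linarith, by linarith, by linarith, by linarith⟩⟩
  obtain ⟨P, R, hP, hR, hm⟩ := key l
  obtain ⟨h0, h1 | h1⟩ := hm m h
  · refine ⟨1, one_ne_zero, fun V hV => ?_⟩
    rw [one_smul, ← hP, ← hR, inCone_act]
    exact hV.mono h0 h1.1 h1.2.1 h1.2.2.1 h1.2.2.2
  · refine ⟨-1, by norm_num, fun V hV => ?_⟩
    rw [← inCone_neg, ← hP, ← hR, ← act_neg, ← act_neg, inCone_act]
    exact hV.mono h0 h1.1 h1.2.1 h1.2.2.1 h1.2.2.2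

end MarkovQuad

/-! ### Periodic words -/

/-- The product of the letters `c i, …, c (i + n - 1)`. -/
def seg {G : Type*} [Group G] (f : Bool → G) (c : ℕ → Bool × Bool) : ℕ → ℕ → G
  | _, 0 => 1
  | i, n + 1 => letter f (c i) * seg f c (i + 1) n

lemma seg_succ' {G : Type*} [Group G] (f : Bool → G) (c : ℕ → Bool × Bool) (i n : ℕ) :
    seg f c i (n + 1) = seg f c i n * letter f (c (i + n)) := by
  induction n generalizing i with
  | zero => simp [seg]
  | succ n ih =>
    rw [seg, ih (i + 1), seg, mul_assoc]
    congr 4; ring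

lemma letter_invLetter {G : Type*} [Group G] (f : Bool → G) (l : Bool × Bool) :
    letter f (invLetter l) = (letter f l)⁻¹ := by
  rcases l with ⟨l, _ | _⟩ <;> simp [letter, invLetter]

lemma map_letter {G H : Type*} [Group G] [Group H] (φ : G →* H) (f : Bool → G) (l : Bool × Bool) :
    φ (letter f l) = letter (φ ∘ f) l := by
  rcases l with ⟨l, _ | _⟩ <;> simp [letter]

lemma map_seg {G H : Type*} [Group G] [Group H] (φ : G →* H) (f : Bool → G) (c : ℕ → Bool × Bool)
    (i n : ℕ) : φ (seg f c i n) = seg (φ ∘ f) c i n := by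
  induction n generalizing i with
  | zero => simp [seg]
  | succ n ih => rw [seg, map_mul, ih, map_letter, seg]

/-- `c` is a periodic word of period `n`, reduced. -/
structure CyclicWord (c : ℕ → Bool × Bool) (n : ℕ) : Prop where
  pos : 0 < n
  period : ∀ i, c (i + n) = c i
  reduced : ∀ i, c (i + 1) ≠ invLetter (c i)

/-- Rotating a periodic word conjugates its value. -/
lemma CyclicWord.seg_conj {G : Type*} [Group G] (f : Bool → G) {c : ℕ → Bool × Bool} {n : ℕ}
    (hc : CyclicWord c n) (i : ℕ) : ∃ h, seg f c i n = h * seg f c 0 n * h⁻¹ := by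
  induction i with
  | zero => exact ⟨1, by simp⟩
  | succ i ih =>
    obtain ⟨h, hh⟩ := ih
    refine ⟨(letter f (c i))⁻¹ * h, ?_⟩
    have e : letter f (c i) * seg f c (i + 1) n = seg f c i n * letter f (c i) := by
      have := seg_succ' f c i n
      rw [seg, hc.period] at this
      exact this
    have : seg f c (i + 1) n = (letter f (c i))⁻¹ * seg f c i n * letter f (c i) := by
      rw [mul_assoc, ← e, inv_mul_cancel_left]
    rw [this, hh]; group

lemma fixForm_inv (M : SL(2, ℤ)) (U : ℝ × ℝ) : fixForm M⁻¹ U = -fixForm M U := by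
  have i00 : (M⁻¹) 0 0 = M 1 1 := by simp [Matrix.SpecialLinearGroup.SL2_inv_expl]
  have i01 : (M⁻¹) 0 1 = -M 0 1 := by simp [Matrix.SpecialLinearGroup.SL2_inv_expl]
  have i10 : (M⁻¹) 1 0 = -M 1 0 := by simp [Matrix.SpecialLinearGroup.SL2_inv_expl]
  have i11 : (M⁻¹) 1 1 = M 0 0 := by simp [Matrix.SpecialLinearGroup.SL2_inv_expl]
  simp only [fixForm, i00, i01, i10, i11]; push_cast; ring

namespace MarkovQuad

variable (Q : MarkovQuad)

lemma coneStart_int (l : Bool × Bool) : ∃ k n : ℤ, (k ≠ 0 ∨ n ≠ 0) ∧ Q.coneStart l = ((k : ℝ), (n : ℝ)) := by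
  have hx := Q.x.n_pos
  have hy := Q.y.n_pos
  have hz := Q.z.n_pos
  rcases l with ⟨_ | _, _ | _⟩
  · exact ⟨-Q.y.k, -Q.y.n, Or.inr (by omega), by simp [coneStart, MarkovFraction.vec]⟩
  · exact ⟨1, 0, by simp, by simp [coneStart]⟩
  · exact ⟨-Q.x.k, -Q.x.n, Or.inr (by omega), by simp [coneStart, MarkovFraction.vec]⟩
  · exact ⟨Q.z.k, Q.z.n, Or.inr (by omega), by simp [coneStart, MarkovFraction.vec]⟩

lemma coneEnd_int (l : Bool × Bool) : ∃ k n : ℤ, (k ≠ 0 ∨ n ≠ 0) ∧ Q.coneEnd l = ((k : ℝ), (n : ℝ)) := by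
  have hx := Q.x.n_pos
  have hy := Q.y.n_pos
  have hz := Q.z.n_pos
  rcases l with ⟨_ | _, _ | _⟩
  · exact ⟨-Q.z.k, -Q.z.n, Or.inr (by omega), by simp [coneEnd, MarkovFraction.vec]⟩
  · exact ⟨-Q.x.k, -Q.x.n, Or.inr (by omega), by simp [coneEnd, MarkovFraction.vec]⟩
  · exact ⟨-Q.y.k, -Q.y.n, Or.inr (by omega), by simp [coneEnd, MarkovFraction.vec]⟩
  · exact ⟨1, 0, by simp, by simp [coneEnd]⟩

lemma coneStart_mem (l : Bool × Bool) : InCone (Q.coneStart l) (Q.coneEnd l) (Q.coneStart l) ∧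
    InCone (Q.coneStart l) (Q.coneEnd l) (Q.coneEnd l) := by
  have hx := Q.x.n_pos_real
  have hy := Q.y.n_pos_real
  have hz := Q.z.n_pos_real
  have hxy := Q.wedge_xy_pos
  have hyz := Q.wedge_yz_pos
  have self : ∀ U : ℝ × ℝ, wedge U U = 0 := fun U => by simp [wedge]; ring
  simp only [InCone, self, le_refl, true_and, and_true, and_self]
  simp only [wedge, MarkovFraction.vec] at hxy hyz
  rcases l with ⟨_ | _, _ | _⟩ <;>
    simp only [coneStart, coneEnd, wedge, MarkovFraction.vec, Prod.fst_neg, Prod.snd_neg] <;> linarith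

/-- A matrix that preserves the projective interval of a letter has a fixed point in it. -/
lemma fixForm_mul_neg {M : SL(2, ℤ)} (hM : IsHyp M) {l : Bool × Bool} {ε : ℝ} (hε : ε ≠ 0)
    (h : ∀ V, InCone (Q.coneStart l) (Q.coneEnd l) V →
      InCone (Q.coneStart l) (Q.coneEnd l) (ε • act M V)) :
    fixForm M (Q.coneStart l) * fixForm M (Q.coneEnd l) < 0 := by
  have h1 := (h _ (Q.coneStart_mem l).1).1
  have h2 := (h _ (Q.coneStart_mem l).2).2
  have e1 : wedge (Q.coneStart l) (ε • act M (Q.coneStart l)) = -ε * fixForm M (Q.coneStart l) := by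
    rw [fixForm_eq]; simp [wedge]; ring
  have e2 : wedge (ε • act M (Q.coneEnd l)) (Q.coneEnd l) = ε * fixForm M (Q.coneEnd l) := by
    rw [fixForm_eq]; simp [wedge]; ring
  rw [e1] at h1
  rw [e2] at h2
  have n1 : fixForm M (Q.coneStart l) ≠ 0 := by
    obtain ⟨k, n, hkn, e⟩ := Q.coneStart_int l
    rw [e]; exact hM.fixForm_ne_zero hkn
  have n2 : fixForm M (Q.coneEnd l) ≠ 0 := by
    obtain ⟨k, n, hkn, e⟩ := Q.coneEnd_int l
    rw [e]; exact hM.fixForm_ne_zero hkn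
  refine lt_of_le_of_ne ?_ (mul_ne_zero n1 n2)
  have := mul_nonneg h1 h2
  have hpos : 0 < ε ^ 2 := by positivity
  by_contra hcon
  push Not at hcon
  nlinarith [mul_pos hpos hcon]

variable {Q} in
/-- The value of a periodic word has a fixed point in the interval of its first letter and one in the
interval of the inverse of its last letter. -/
lemma fixForm_seg {G : Bool → SL(2, ℤ)} (hA : G true = Q.A) (hB : G false = Q.B)
    {c : ℕ → Bool × Bool} {n : ℕ} (hc : CyclicWord c n) (i : ℕ) (hM : IsHyp (seg G c (i + 1) n)) :
    fixForm (seg G c (i + 1) n) (Q.coneStart (c (i + 1))) *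
      fixForm (seg G c (i + 1) n) (Q.coneEnd (c (i + 1))) < 0 ∧
    fixForm (seg G c (i + 1) n) (Q.coneStart (invLetter (c i))) *
      fixForm (seg G c (i + 1) n) (Q.coneEnd (invLetter (c i))) < 0 := by
  have fwd : ∀ n i, ∃ ε : ℝ, ε ≠ 0 ∧ ∀ V, InCone (Q.coneStart (c (i + n))) (Q.coneEnd (c (i + n))) V →
      InCone (Q.coneStart (c i)) (Q.coneEnd (c i)) (ε • act (seg G c i n) V) := by
    intro n
    induction n with
    | zero => exact fun i => ⟨1, one_ne_zero, fun V hV => by simpa [seg, act_one] using hV⟩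
    | succ n ih =>
      intro i
      obtain ⟨ε, hε, h⟩ := ih (i + 1)
      obtain ⟨δ, hδ, h'⟩ := Q.letter_inCone hA hB (c i) (c (i + 1)) (hc.reduced i)
      refine ⟨δ * ε, mul_ne_zero hδ hε, fun V hV => ?_⟩
      have := h' _ (h V (by rwa [show i + 1 + n = i + (n + 1) by ring]))
      rwa [act_smul, smul_smul, ← act_mul] at this
  have bwd : ∀ n i, ∃ ε : ℝ, ε ≠ 0 ∧ ∀ V,
      InCone (Q.coneStart (invLetter (c i))) (Q.coneEnd (invLetter (c i))) V →
      InCone (Q.coneStart (invLetter (c (i + n)))) (Q.coneEnd (invLetter (c (i + n))))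
        (ε • act (seg G c (i + 1) n)⁻¹ V) := by
    intro n i
    induction n with
    | zero => exact ⟨1, one_ne_zero, fun V hV => by simpa [seg, act_one] using hV⟩
    | succ n ih =>
      obtain ⟨ε, hε, h⟩ := ih
      obtain ⟨δ, hδ, h'⟩ := Q.letter_inCone hA hB (invLetter (c (i + n + 1))) (invLetter (c (i + n)))
        (by rw [invLetter_invLetter]; exact (hc.reduced (i + n)).symm)
      refine ⟨δ * ε, mul_ne_zero hδ hε, fun V hV => ?_⟩
      have := h' _ (h V hV)
      rw [act_smul, smul_smul, ← act_mul, letter_invLetter, ← mul_inv_rev] at this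
      rw [seg_succ', show i + 1 + n = i + n + 1 by ring]
      exact this
  constructor
  · obtain ⟨ε, hε, h⟩ := fwd n (i + 1)
    rw [hc.period] at h
    exact Q.fixForm_mul_neg hM hε h
  · obtain ⟨ε, hε, h⟩ := bwd n i
    rw [hc.period] at h
    have hM' : IsHyp (seg G c (i + 1) n)⁻¹ := by
      rw [IsHyp, trace_eq] at hM ⊢
      convert hM using 2
      simp [Matrix.SpecialLinearGroup.SL2_inv_expl]; ring
    have := Q.fixForm_mul_neg hM' hε h
    rwa [fixForm_inv, fixForm_inv, neg_mul_neg] at this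

end MarkovQuad
end MarkovTorus

namespace MarkovTorus

/-! ### Exponent sums -/

lemma lift_alpha_beta_bijective :
    Function.Bijective (FreeGroup.lift (fun i : Bool => cond i alpha beta)) := by
  constructor
  · rw [injective_iff_map_eq_one]
    intro w hw
    obtain ⟨p, -, hp⟩ := (IsLabelledTriple.base.cover I)
    exact MarkovQuad.base.core_unique (f := fun i : Bool => cond i alpha beta)
      MarkovQuad.base_A.symm MarkovQuad.base_B.symm hp (by rw [hw, one_smul]; exact hp)
  · obtain ⟨a, b, ha, hb, -, -, h⟩ := IsLabelledTriple.base.generators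
    have ha' : a = alpha := Subtype.ext (ha.trans MarkovQuad.base_A)
    have hb' : b = beta := Subtype.ext (hb.trans MarkovQuad.base_B)
    rw [ha', hb'] at h
    exact range_lift_eq_top h

/-- Homomorphisms `Γ → ℤ` can be prescribed on the free generators. -/
lemma exists_hom (m n : ℤ) : ∃ φ : Γ →* Multiplicative ℤ,
    (φ alpha).toAdd = m ∧ (φ beta).toAdd = n := by
  let e := MulEquiv.ofBijective _ lift_alpha_beta_bijective
  refine ⟨(FreeGroup.lift (fun i : Bool => cond i (Multiplicative.ofAdd m)
    (Multiplicative.ofAdd n))).comp e.symm.toMonoidHom, ?_, ?_⟩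
  · have : e.symm alpha = FreeGroup.of true := by
      rw [MulEquiv.symm_apply_eq]; simp [e]
    simp [this]
  · have : e.symm beta = FreeGroup.of false := by
      rw [MulEquiv.symm_apply_eq]; simp [e]
    simp [this]

lemma HasSlope.toAdd_map {g : Γ} {s : Vertex} (h : HasSlope g s) (φ : Γ →* Multiplicative ℤ) :
    (φ g).toAdd = vden s * (φ alpha).toAdd + (vnum s + vden s) * (φ beta).toAdd := by
  have := congrArg (Abelianization.lift φ) h
  simp only [map_mul, map_zpow, Abelianization.lift_apply_of] at this
  rw [this]
  simp

/-! ### Cyclic words -/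

/-- The periodic sequence of a list. -/
def cyc {α : Type*} [Inhabited α] (L : List α) (i : ℕ) : α := L.getD (i % L.length) default

lemma cyc_add_length {α : Type*} [Inhabited α] (L : List α) (i : ℕ) :
    cyc L (i + L.length) = cyc L i := by simp [cyc]

lemma cyc_eq {α : Type*} [Inhabited α] (L : List α) {i : ℕ} (hi : i < L.length) :
    cyc L i = L[i] := by simp [cyc, Nat.mod_eq_of_lt hi, hi]

lemma seg_eq {G : Type*} [Group G] (f : Bool → G) (c : ℕ → Bool × Bool) (i n : ℕ) :
    seg f c i n = evalWord f ((List.range' i n).map c) := by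
  induction n generalizing i with
  | zero => rfl
  | succ n ih => simp [seg, ih, evalWord, List.range'_succ]

lemma map_cyc {α : Type*} [Inhabited α] (L : List α) :
    (List.range' 0 L.length).map (cyc L) = L := by
  apply List.ext_getElem
  · simp
  · intro i h1 h2
    simp [cyc_eq L h2]

lemma exists_cyclicWord {G : Type*} [Group G] {f : Bool → G}
    (hf : Function.Surjective (FreeGroup.lift f)) {g : G} (hg : g ≠ 1) :
    ∃ c n, CyclicWord c n ∧ IsConj g (seg f c 0 n) := by
  obtain ⟨w, rfl⟩ := hf g
  have h1 := FreeGroup.reduceCyclically.isCyclicallyReduced (FreeGroup.isReduced_toWord (x := w))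
  have h2 := FreeGroup.reduceCyclically.conj_conjugator_reduceCyclically w.toWord
  set L := FreeGroup.reduceCyclically w.toWord
  set K := FreeGroup.reduceCyclically.conjugator w.toWord
  have hw : w = FreeGroup.mk K * FreeGroup.mk L * (FreeGroup.mk K)⁻¹ := by
    rw [FreeGroup.inv_mk, FreeGroup.mul_mk, FreeGroup.mul_mk, h2, FreeGroup.mk_toWord]
  have hconj : IsConj (FreeGroup.lift f w) (evalWord f L) := by
    rw [← lift_mk_eq]
    exact MonoidHom.map_isConj _ (isConj_iff.mpr ⟨_, hw.symm⟩).symm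
  have hpos : 0 < L.length := by
    rw [List.length_pos_iff]
    intro h
    rw [h] at hconj
    simp only [evalWord, List.map_nil, List.prod_nil, isConj_one_left] at hconj
    exact hg hconj
  refine ⟨cyc L, L.length, ⟨hpos, cyc_add_length L, fun i => ?_⟩, ?_⟩
  · rw [ne_invLetter_iff]
    have hi := Nat.mod_lt i hpos
    have e1 : cyc L i = L[i % L.length] := by simp [cyc, hi]
    rcases Nat.lt_or_ge (i % L.length + 1) L.length with h | h
    · have e2 : cyc L (i + 1) = L[i % L.length + 1] := by
        have : (i + 1) % L.length = i % L.length + 1 := by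
          rw [Nat.add_mod, Nat.mod_eq_of_lt (a := 1) (by omega), Nat.mod_eq_of_lt h]
        simp [cyc, this, h]
      rw [e1, e2]
      have := h1.1
      rw [FreeGroup.IsReduced.eq_1, List.isChain_iff_getElem] at this
      exact this _ h
    · have e3 : i % L.length = L.length - 1 := by omega
      have e2 : cyc L (i + 1) = L[0] := by
        have : (i + 1) % L.length = 0 := by
          rw [Nat.add_mod, e3]
          rcases Nat.lt_or_ge 1 L.length with h' | h'
          · rw [Nat.mod_eq_of_lt h', Nat.sub_add_cancel hpos, Nat.mod_self]
          · have : L.length = 1 := by omega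
            simp [this]
        simp [cyc, this, hpos]
      rw [e1, e2]
      simp only [e3]
      refine h1.2 _ ?_ _ ?_
      · rw [Option.mem_def, List.getLast?_eq_getElem?, List.getElem?_eq_getElem]
      · rw [Option.mem_def, List.head?_eq_getElem?, List.getElem?_eq_getElem]
  · rw [seg_eq, map_cyc]; exact hconj

lemma CyclicWord.isConj {G : Type*} [Group G] (f : Bool → G) {c : ℕ → Bool × Bool} {n : ℕ}
    (hc : CyclicWord c n) (i : ℕ) : IsConj (seg f c 0 n) (seg f c i n) := by
  obtain ⟨h, hh⟩ := hc.seg_conj f i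
  exact isConj_iff.mpr ⟨h, hh.symm⟩

/-- A word with positive exponent sum in a generator contains that generator. -/
lemma exists_letter_of_pos {G : Type*} [Group G] {f : Bool → G} (φ : G →* Multiplicative ℤ) (b : Bool)
    (h1 : (φ (f b)).toAdd = 1) (h2 : (φ (f !b)).toAdd = 0) (c : ℕ → Bool × Bool) (i n : ℕ)
    (h : 0 < (φ (seg f c i n)).toAdd) : ∃ j, c j = (b, true) := by
  induction n generalizing i with
  | zero => simp [seg] at h
  | succ n ih =>
    by_contra hcon
    push Not at hcon
    rw [seg, map_mul, toAdd_mul] at h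
    have hn := ih (i + 1)
    have hl : (φ (letter f (c i))).toAdd ≤ 0 := by
      have := hcon i
      rcases hci : c i with ⟨b', e⟩
      rw [hci] at this
      rcases eq_or_ne b' b with rfl | hb
      · cases e
        · simp [letter, h1]
        · exact absurd rfl this
      · have : b' = !b := by cases b <;> cases b' <;> simp_all
        subst this
        cases e <;> simp [letter, h2]
    obtain ⟨j, hj⟩ := hn (by linarith)
    exact hcon j hj

/-- A set of letters closed under successors contains all letters or none. -/
lemma CyclicWord.closed {c : ℕ → Bool × Bool} {n : ℕ} (hc : CyclicWord c n) {S : Bool × Bool → Prop}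
    (hS : ∀ i, S (c i) → S (c (i + 1))) {i : ℕ} (hi : S (c i)) (j : ℕ) : S (c j) := by
  have h1 : ∀ m, S (c (i + m)) := by
    intro m
    induction m with
    | zero => exact hi
    | succ m ih => exact hS _ ih
  have h2 : ∀ m, c (j + m * n) = c j := by
    intro m
    induction m with
    | zero => simp
    | succ m ih => rw [add_mul, one_mul, ← add_assoc, hc.period, ih]
  have h3 : i ≤ j + i * n := by nlinarith [hc.pos, Nat.zero_le j, Nat.zero_le i]
  rw [← h2 i]
  obtain ⟨m, hm⟩ := Nat.exists_eq_add_of_le h3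
  rw [hm]
  exact h1 m

/-! ### Non-crossing conjugates -/

/-- No two axes of conjugates of `g` cross. -/
def NonCrossing (g : Γ) : Prop := ∀ a b : Γ, IsConj g a → IsConj g b → ∀ p q p' q' : ℝ,
  FixPair a p q → FixPair b p' q' → p < p' → p' < q → q' ≤ q

lemma nonCrossing_of_simple {g : Γ} (hg : IsHyp g) {L : Set ℍ} (hL : IsCompleteGeodesic L)
    (hgL : (fun z : ℍ => g • z) '' L = L)
    (hinj : ∀ h : Γ, ∀ z ∈ L, h • z ∈ L → ∃ m : ℤ, h • z = g ^ m • z) : NonCrossing g := by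
  have hLa : L = axis g := eq_axis hg hL hgL
  rintro a b ha hb p q p' q' hp hq h1 h2
  by_contra h3
  push Not at h3
  obtain ⟨z, hz, hz'⟩ := exists_mem_inter h1 h2 h3
  rw [← hp.axis_eq] at hz
  rw [← hq.axis_eq] at hz'
  obtain ⟨k, hk⟩ := isConj_iff.mp ha
  obtain ⟨l, hl⟩ := isConj_iff.mp hb
  have e1 : k⁻¹ • z ∈ L := by
    rw [hLa, ← smul_mem_axis k]
    have : (k : SL(2, ℤ)) * g * (k : SL(2, ℤ))⁻¹ = a := by rw [← hk]; rfl
    rw [this]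
    change (k : SL(2, ℤ)) • (k : SL(2, ℤ))⁻¹ • z ∈ _
    rwa [smul_inv_smul]
  have e2 : l⁻¹ • z ∈ L := by
    rw [hLa, ← smul_mem_axis l]
    have : (l : SL(2, ℤ)) * g * (l : SL(2, ℤ))⁻¹ = b := by rw [← hl]; rfl
    rw [this]
    change (l : SL(2, ℤ)) • (l : SL(2, ℤ))⁻¹ • z ∈ _
    rwa [smul_inv_smul]
  have e3 : (l⁻¹ * k) • k⁻¹ • z = l⁻¹ • z := by rw [← mul_smul, mul_inv_cancel_right]
  obtain ⟨m, hm⟩ := hinj (l⁻¹ * k) _ e1 (by rw [e3]; exact e2)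
  have e4 : (g ^ m)⁻¹ * (l⁻¹ * k) = 1 := by
    have : (((g ^ m)⁻¹ * (l⁻¹ * k) : Γ) : SL(2, ℤ)) = 1 := by
      refine eq_one_of_smul_eq (Subtype.mem _) (z := k⁻¹ • z) ?_
      change ((g ^ m)⁻¹ * (l⁻¹ * k)) • k⁻¹ • z = k⁻¹ • z
      rw [mul_smul, hm, inv_smul_smul]
    exact Subtype.ext this
  have e5 : k = l * g ^ m := by
    rw [inv_mul_eq_one] at e4
    rw [e4, mul_inv_cancel_left]
  have e6 : a = b := by
    rw [← hk, ← hl, e5]; group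
  rw [← e6] at hq
  have h4 : fixForm (a : SL(2, ℤ)) (p', 1) = 0 := by rw [hq.fixForm]; simp
  rcases hp.root h4 with h | h <;> linarith

/-- Some conjugate of `g` has fixed points `p < a`, `b < q`. -/
def Spans (g : Γ) (a b : ℝ) : Prop := ∃ k : Γ, IsConj g k ∧ ∃ p q : ℝ, FixPair k p q ∧ p < a ∧ b < q

lemma NonCrossing.spans_trans {g : Γ} (hg : NonCrossing g) {a b c : ℝ}
    (h1 : Spans g a b) (h2 : Spans g b c) : Spans g a c := by
  obtain ⟨k, hk, p, q, hp, h3, h4⟩ := h1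
  obtain ⟨l, hl, p', q', hq, h5, h6⟩ := h2
  rcases lt_or_ge p p' with h | h
  · have := hg k l hk hl _ _ _ _ hp hq h (by linarith)
    exact ⟨k, hk, p, q, hp, h3, by linarith⟩
  · exact ⟨l, hl, p', q', hq, by linarith, h6⟩

lemma FixPair.between {M : SL(2, ℤ)} {p q m : ℝ} (h : FixPair M p q)
    (hm : MarkovTorus.fixForm M (1, 0) * MarkovTorus.fixForm M (m, 1) < 0) : p < m ∧ m < q := by
  rw [h.fixForm, h.fixForm] at hm
  simp only [mul_zero, sub_zero, mul_one] at hm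
  have h1 : (M 1 0 : ℝ) ^ 2 * ((m - p) * (m - q)) < 0 := by linarith
  have h2 : (m - p) * (m - q) < 0 := by
    by_contra hcon
    push Not at hcon
    have := mul_nonneg (sq_nonneg (M 1 0 : ℝ)) hcon
    linarith
  have := h.lt
  rcases mul_neg_iff.mp h2 with ⟨h3, h4⟩ | ⟨h3, h4⟩ <;> constructor <;> linarith

lemma fixForm_smul (M : SL(2, ℤ)) (c : ℝ) (U : ℝ × ℝ) : fixForm M (c • U) = c ^ 2 * fixForm M U := by
  simp [fixForm]; ring

lemma fixForm_neg (M : SL(2, ℤ)) (U : ℝ × ℝ) : fixForm M (-U) = fixForm M U := by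
  simp [fixForm]

lemma IsHyp.of_isConj {a b : Γ} (h : IsConj a b) (ha : IsHyp a) : IsHyp b := by
  obtain ⟨c, rfl⟩ := isConj_iff.mp h
  exact ha.conj c

/-- If `h` moves `U` to `∞` and `V`, `W` to `m₁`, `m₂`, a conjugate of `g` whose fixed points
separate `U` from `V` and from `W` yields one spanning `[m₁, m₂]`. -/
lemma spans_of_fixForm {g k : Γ} (hg : IsHyp g) (hk : IsConj g k) (h : Γ) {U V W : ℝ × ℝ} {m₁ m₂ : ℝ}
    {r s t : ℝ} (hr : r ≠ 0) (hs : s ≠ 0) (ht : t ≠ 0) (hU : act h U = r • (1, 0))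
    (hV : act h V = s • (m₁, 1)) (hW : act h W = t • (m₂, 1))
    (h1 : fixForm k U * fixForm k V < 0) (h2 : fixForm k U * fixForm k W < 0) : Spans g m₁ m₂ := by
  have hk' : IsHyp (h * k * h⁻¹ : Γ) := (IsHyp.of_isConj hk hg).conj h
  obtain ⟨p, q, hpq⟩ := hk'.exists_fixPair
  have e : ((h * k * h⁻¹ : Γ) : SL(2, ℤ)) = h * k * (h : SL(2, ℤ))⁻¹ := rfl
  have key : ∀ {c m : ℝ} {X : ℝ × ℝ}, c ≠ 0 → act h X = c • (m, 1) →
      fixForm k U * fixForm k X < 0 → p < m ∧ m < q := by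
    intro c m X hc hX hneg
    apply hpq.between
    rw [← fixForm_conj h, ← fixForm_conj h (M := k) (U := X), hU, hX, fixForm_smul, fixForm_smul, ← e] at hneg
    have : 0 < r ^ 2 * c ^ 2 := by positivity
    have e' : r ^ 2 * c ^ 2 * (fixForm (h * k * h⁻¹ : Γ) (1, 0) * fixForm (h * k * h⁻¹ : Γ) (m, 1)) < 0 := by
      linarith
    exact (mul_neg_iff_of_pos this _).mp e'
  refine ⟨h * k * h⁻¹, hk.trans (isConj_iff.mpr ⟨h, rfl⟩), p, q, hpq, (key hs hV h1).1, (key ht hW h2).2⟩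

lemma act_T_zpow (j : ℤ) (U : ℝ × ℝ) : act (ModularGroup.T ^ j) U = (U.1 + j * U.2, U.2) := by
  have e : ∀ a b, (ModularGroup.T ^ j) a b = (!![1, j; 0, 1] : Matrix (Fin 2) (Fin 2) ℤ) a b := by
    intro a b; rw [← ModularGroup.coe_T_zpow]
  ext <;> simp only [act, e] <;> simp

lemma act_neg_left (g : SL(2, ℤ)) (U : ℝ × ℝ) : act (-g) U = (-1 : ℝ) • act g U := by
  ext <;> simp [act] <;> ring

/-- A non-crossing family of axes spans no interval of length `6`. -/
lemma NonCrossing.not_spans {g : Γ} (hg : NonCrossing g) (hyp : IsHyp g) {a b : ℝ} (hab : a + 6 ≤ b) :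
    ¬ Spans g a b := by
  rintro ⟨k, hk, p, q, hpq, h1, h2⟩
  obtain ⟨h, hh, -, hT⟩ := exists_translate 1
  have hact : ∀ x : ℝ, ∃ c : ℝ, c ≠ 0 ∧ act h (x, 1) = c • (x + 6, 1) := by
    intro x
    rcases hT with rfl | rfl
    · refine ⟨1, one_ne_zero, ?_⟩
      rw [act_T_zpow]; simp
    · refine ⟨-1, by norm_num, ?_⟩
      rw [act_neg_left, act_T_zpow]; simp
  have hk' : IsHyp ((⟨h, hh⟩ * k * ⟨h, hh⟩⁻¹ : Γ)) := (IsHyp.of_isConj hk hyp).conj h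
  obtain ⟨p', q', hpq'⟩ := hk'.exists_fixPair
  have e : ((⟨h, hh⟩ * k * ⟨h, hh⟩⁻¹ : Γ) : SL(2, ℤ)) = h * k * h⁻¹ := rfl
  have root : ∀ x, fixForm k (x, 1) = 0 → x + 6 = p' ∨ x + 6 = q' := by
    intro x hx
    obtain ⟨c, hc, hc'⟩ := hact x
    apply hpq'.root
    rw [← fixForm_conj h, hc', fixForm_smul] at hx
    rw [e]
    simpa [hc] using hx
  have hp := root p (by rw [hpq.fixForm]; simp)
  have hq := root q (by rw [hpq.fixForm]; simp)
  have hlt := hpq.lt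
  have hlt' := hpq'.lt
  have := hg k _ hk (hk.trans (isConj_iff.mpr ⟨⟨h, hh⟩, rfl⟩)) p q p' q' hpq hpq'
  rcases hp with hp | hp <;> rcases hq with hq | hq
  · linarith
  · have := this (by linarith) (by linarith)
    linarith
  · linarith
  · linarith

end MarkovTorus

namespace MarkovTorus

/-! ### Simple closed geodesics correspond to positive words -/

/-- The fixed points of `M` separate the ends of the boundary interval of the letter `l`. -/
def MarkovQuad.Separates (Q : MarkovQuad) (M : SL(2, ℤ)) (l : Bool × Bool) : Prop :=
  fixForm M (Q.coneStart l) * fixForm M (Q.coneEnd l) < 0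

lemma MarkovQuad.base_separates (M : SL(2, ℤ)) :
    (base.Separates M (true, true) ↔ fixForm M (1, 1) * fixForm M (1, 0) < 0) ∧
    (base.Separates M (false, true) ↔ fixForm M (1, 0) * fixForm M (-1, 1) < 0) ∧
    (base.Separates M (true, false) ↔ fixForm M (-1, 1) * fixForm M (0, 1) < 0) ∧
    (base.Separates M (false, false) ↔ fixForm M (0, 1) * fixForm M (1, 1) < 0) := by
  simp only [Separates, coneStart, coneEnd, fixForm_neg]
  simp [MarkovFraction.vec, base]

/-- The value of a cyclic word and the letters at a corner of the word. -/
lemma MarkovQuad.exists_separates {Q : MarkovQuad} {f : Bool → Γ} (hA : (f true : SL(2, ℤ)) = Q.A)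
    (hB : (f false : SL(2, ℤ)) = Q.B) {c : ℕ → Bool × Bool} {n : ℕ} (hc : CyclicWord c n) {g : Γ}
    (hg : IsHyp g) (hgc : IsConj g (seg f c 0 n)) (i : ℕ) : ∃ k : Γ, IsConj g k ∧
      Q.Separates k (c (i + 1)) ∧ Q.Separates k (invLetter (c i)) := by
  have hconj := hgc.trans (hc.isConj f (i + 1))
  have hyp := IsHyp.of_isConj hconj hg
  have e : ((seg f c (i + 1) n : Γ) : SL(2, ℤ)) = seg (fun b => (f b : SL(2, ℤ))) c (i + 1) n :=
    map_seg Γ.subtype f c (i + 1) n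
  refine ⟨_, hconj, ?_⟩
  rw [e] at hyp ⊢
  exact MarkovQuad.fixForm_seg hA hB hc i hyp

/-- If `c` meets `S` but is not contained in `S`, a letter of `S` is followed by one outside `S`. -/
lemma CyclicWord.exists_exit {c : ℕ → Bool × Bool} {n : ℕ} (hc : CyclicWord c n)
    {S : Bool × Bool → Prop} {i j : ℕ} (hi : S (c i)) (hj : ¬ S (c j)) :
    ∃ m, S (c m) ∧ ¬ S (c (m + 1)) := by
  by_contra hcon
  push Not at hcon
  exact hj (hc.closed hcon hi j)

/-- The value of the positive word `d`. -/
def evalPos {G : Type*} [Group G] (a b : G) (d : List Bool) : G := (d.map fun i => cond i a b).prod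

lemma evalPos_eq {G : Type*} [Group G] (f : Bool → G) (d : List Bool) :
    evalPos (f true) (f false) d = evalWord f (d.map fun i => (i, true)) := by
  simp only [evalPos, evalWord, List.map_map]
  congr 2
  ext i
  cases i <;> rfl

lemma exists_positive_word {g : Γ} (hyp : IsHyp g) (hg : NonCrossing g) {s : Vertex}
    (hs : HasSlope g s) (h0 : 0 < vden s) (h1 : 0 ≤ vnum s) :
    ∃ d : List Bool, IsConj g (evalPos alpha beta d) := by
  have hg1 : g ≠ 1 := by
    rintro rfl
    simp [IsHyp] at hyp
  set f : Bool → Γ := fun i => cond i alpha beta with hf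
  obtain ⟨c, n, hc, hconj⟩ := exists_cyclicWord lift_alpha_beta_bijective.2 hg1
  change IsConj g (seg f c 0 n) at hconj
  by_cases hpos : ∀ i, (c i).2 = true
  · refine ⟨((List.range' 0 n).map c).map Prod.fst, ?_⟩
    have e : evalPos alpha beta (((List.range' 0 n).map c).map Prod.fst) = seg f c 0 n := by
      rw [show alpha = f true from rfl, show beta = f false from rfl, evalPos_eq, seg_eq]
      congr 1
      simp only [List.map_map]
      congr 1
      ext i
      · rfl
      · simp [hpos]
    rwa [e]
  exfalso
  push Not at hpos
  obtain ⟨j, hj⟩ := hpos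
  have count : ∀ φ : Γ →* Multiplicative ℤ, (φ (seg f c 0 n)).toAdd = (φ g).toAdd := by
    intro φ
    obtain ⟨k, hk⟩ := isConj_iff.mp hconj
    rw [← hk]
    simp
  obtain ⟨iα, hα⟩ : ∃ i, c i = (true, true) := by
    obtain ⟨φ, h2, h3⟩ := exists_hom 1 0
    refine exists_letter_of_pos (f := f) φ true h2 h3 c 0 n ?_
    rw [count, hs.toAdd_map, h2, h3]; linarith
  obtain ⟨iβ, hβ⟩ : ∃ i, c i = (false, true) := by
    obtain ⟨φ, h2, h3⟩ := exists_hom 0 1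
    refine exists_letter_of_pos (f := f) φ false h3 h2 c 0 n ?_
    rw [count, hs.toAdd_map, h2, h3]; linarith
  have base := MarkovQuad.base_separates
  have corner := fun i => MarkovQuad.base.exists_separates (f := f) MarkovQuad.base_A.symm
    MarkovQuad.base_B.symm hc hyp hconj i
  -- the four kinds of corners
  have hinf : Spans g (-1) 1 := by
    obtain ⟨m, hm, hm'⟩ := hc.exists_exit (S := fun l => l.2 = false) (i := j) (j := iα)
      (by simpa using hj) (by simp [hα])
    obtain ⟨k, hk, h2, h3⟩ := corner m
    have hr := hc.reduced m
    have : fixForm k (1, 0) * fixForm k (-1, 1) < 0 ∧ fixForm k (1, 0) * fixForm k (1, 1) < 0 := by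
      revert hm hm' hr h2 h3
      rcases c m with ⟨_ | _, _ | _⟩ <;> rcases c (m + 1) with ⟨_ | _, _ | _⟩ <;>
        simp [invLetter, base] <;> intro a b <;> constructor <;> linarith
    refine spans_of_fixForm hyp hk 1 (U := (1, 0)) (V := (-1, 1)) (W := (1, 1)) one_ne_zero one_ne_zero
      one_ne_zero ?_ ?_ ?_ this.1 this.2 <;> simp [act_one]
  have hz : Spans g 1 2 := by
    obtain ⟨m, hm, hm'⟩ := hc.exists_exit (S := fun l => l = (true, true) ∨ l = (false, false))
      (i := iα) (j := iβ) (by simp [hα]) (by simp [hβ])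
    obtain ⟨k, hk, h2, h3⟩ := corner m
    have hr := hc.reduced m
    have : fixForm k (-1, 1) * fixForm k (0, 1) < 0 ∧ fixForm k (-1, 1) * fixForm k (1, 0) < 0 := by
      revert hm hm' hr h2 h3
      rcases c m with ⟨_ | _, _ | _⟩ <;> rcases c (m + 1) with ⟨_ | _, _ | _⟩ <;>
        simp [invLetter, base] <;> intro a b <;> constructor <;> linarith
    refine spans_of_fixForm hyp hk alpha (U := (-1, 1)) (V := (0, 1)) (W := (1, 0))
      (r := -1) (s := 1) (t := 1) (by norm_num) one_ne_zero one_ne_zero ?_ ?_ ?_ this.1 this.2 <;>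
      simp [act, alpha, matAlpha] <;> norm_num
  have hx : Spans g (-2) (-1) := by
    obtain ⟨m, hm, hm'⟩ := hc.exists_exit (S := fun l => l = (false, true) ∨ l = (true, false))
      (i := iβ) (j := iα) (by simp [hβ]) (by simp [hα])
    obtain ⟨k, hk, h2, h3⟩ := corner m
    have hr := hc.reduced m
    have : fixForm k (1, 1) * fixForm k (1, 0) < 0 ∧ fixForm k (1, 1) * fixForm k (0, 1) < 0 := by
      revert hm hm' hr h2 h3
      rcases c m with ⟨_ | _, _ | _⟩ <;> rcases c (m + 1) with ⟨_ | _, _ | _⟩ <;>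
        simp [invLetter, base] <;> intro a b <;> constructor <;> linarith
    refine spans_of_fixForm hyp hk beta (U := (1, 1)) (V := (1, 0)) (W := (0, 1))
      (r := 1) (s := -1) (t := 1) one_ne_zero (by norm_num) one_ne_zero ?_ ?_ ?_ this.1 this.2 <;>
      simp [act, beta, matBeta] <;> norm_num
  have hy : Spans g 2 4 := by
    obtain ⟨m, hm, hm'⟩ := hc.exists_exit (S := fun l => l.2 = true)
      (i := iα) (j := j) (by simp [hα]) hj
    obtain ⟨k, hk, h2, h3⟩ := corner m
    have hr := hc.reduced m
    have : fixForm k (0, 1) * fixForm k (1, 1) < 0 ∧ fixForm k (0, 1) * fixForm k (-1, 1) < 0 := by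
      revert hm hm' hr h2 h3
      rcases c m with ⟨_ | _, _ | _⟩ <;> rcases c (m + 1) with ⟨_ | _, _ | _⟩ <;>
        simp [invLetter, base] <;> intro a b <;> constructor <;> linarith
    have e : ∀ U, act ((alpha * beta : Γ) : SL(2, ℤ)) U = act matAlpha (act matBeta U) := act_mul _ _
    refine spans_of_fixForm hyp hk (alpha * beta) (U := (0, 1)) (V := (1, 1)) (W := (-1, 1))
      (r := -1) (s := 1) (t := -1) (by norm_num) one_ne_zero (by norm_num) ?_ ?_ ?_ this.1 this.2 <;>
      rw [e] <;> simp [act, matAlpha, matBeta] <;> norm_num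
  exact hg.not_spans hyp (by norm_num)
    (hg.spans_trans (hg.spans_trans (hg.spans_trans hx hinf) hz) hy)

/-! ### Reduction of positive words -/

/-- The fixed points of a separating matrix: case of the interval `(z, ∞)` and `(x, y)`. -/
lemma MarkovQuad.fixPair_of_separates_A {Q : MarkovQuad} {M : SL(2, ℤ)} (hM : IsHyp M)
    (h1 : Q.Separates M (true, true)) (h2 : Q.Separates M (true, false)) :
    ∃ p q : ℝ, FixPair M p q ∧ (Q.x.val : ℝ) < p ∧ p < Q.y.val ∧ (Q.z.val : ℝ) < q := by
  obtain ⟨p, q, h⟩ := hM.exists_fixPair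
  simp only [Separates, coneStart, coneEnd, fixForm_neg, MarkovFraction.vec_eq, fixForm_smul] at h1 h2
  have hx := Q.x.n_pos_real
  have hy := Q.y.n_pos_real
  have hz := Q.z.n_pos_real
  have hyz : (Q.y.val : ℝ) < Q.z.val := by exact_mod_cast Q.val_lt_yz
  have hxy : (Q.x.val : ℝ) < Q.y.val := by exact_mod_cast Q.val_lt_xy
  have h1' : fixForm M (1, 0) * fixForm M ((Q.z.val : ℝ), 1) < 0 := by
    refine (mul_neg_iff_of_pos (a := (Q.z.n : ℝ) ^ 2) (by positivity) _).mp ?_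
    linarith
  have h2' : fixForm M ((Q.x.val : ℝ), 1) * fixForm M ((Q.y.val : ℝ), 1) < 0 := by
    refine (mul_neg_iff_of_pos (a := (Q.x.n : ℝ) ^ 2 * (Q.y.n : ℝ) ^ 2) (by positivity) _).mp ?_
    linarith
  obtain ⟨h3, h4⟩ := h.between h1'
  refine ⟨p, q, h, ?_, ?_, h4⟩
  all_goals
    rw [h.fixForm, h.fixForm] at h2'
    simp only [mul_one] at h2'
    have hc : 0 < (M 1 0 : ℝ) ^ 2 := by have := h.c_ne; positivity
    have hpos : 0 < (M 1 0 : ℝ) ^ 2 * ((q - Q.x.val) * (q - Q.y.val)) :=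
      mul_pos hc (mul_pos (by linarith) (by linarith))
    have h5 : ((Q.x.val : ℝ) - p) * (Q.y.val - p) < 0 := by
      refine (mul_neg_iff_of_pos hpos _).mp ?_
      linarith
    rcases mul_neg_iff.mp h5 with ⟨h6, h7⟩ | ⟨h6, h7⟩ <;> linarith

/-- The fixed points of a separating matrix: case of the interval `(∞, x)` and `(y, z)`. -/
lemma MarkovQuad.fixPair_of_separates_B {Q : MarkovQuad} {M : SL(2, ℤ)} (hM : IsHyp M)
    (h1 : Q.Separates M (false, true)) (h2 : Q.Separates M (false, false)) :
    ∃ p q : ℝ, FixPair M p q ∧ p < Q.x.val ∧ (Q.y.val : ℝ) < q ∧ q < Q.z.val := by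
  obtain ⟨p, q, h⟩ := hM.exists_fixPair
  simp only [Separates, coneStart, coneEnd, fixForm_neg, MarkovFraction.vec_eq, fixForm_smul] at h1 h2
  have hx := Q.x.n_pos_real
  have hy := Q.y.n_pos_real
  have hz := Q.z.n_pos_real
  have hyz : (Q.y.val : ℝ) < Q.z.val := by exact_mod_cast Q.val_lt_yz
  have hxy : (Q.x.val : ℝ) < Q.y.val := by exact_mod_cast Q.val_lt_xy
  have h1' : fixForm M (1, 0) * fixForm M ((Q.x.val : ℝ), 1) < 0 := by
    refine (mul_neg_iff_of_pos (a := (Q.x.n : ℝ) ^ 2) (by positivity) _).mp ?_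
    linarith
  have h2' : fixForm M ((Q.y.val : ℝ), 1) * fixForm M ((Q.z.val : ℝ), 1) < 0 := by
    refine (mul_neg_iff_of_pos (a := (Q.y.n : ℝ) ^ 2 * (Q.z.n : ℝ) ^ 2) (by positivity) _).mp ?_
    linarith
  obtain ⟨h3, h4⟩ := h.between h1'
  refine ⟨p, q, h, h3, ?_⟩
  rw [h.fixForm, h.fixForm] at h2'
  simp only [mul_one] at h2'
  have hc : 0 < (M 1 0 : ℝ) ^ 2 := by have := h.c_ne; positivity
  have hpos : 0 < (M 1 0 : ℝ) ^ 2 * ((Q.y.val - p) * (Q.z.val - p)) :=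
    mul_pos hc (mul_pos (by linarith) (by linarith))
  have h5 : ((Q.y.val : ℝ) - q) * (Q.z.val - q) < 0 := by
    refine (mul_neg_iff_of_pos hpos _).mp ?_
    linarith
  rcases mul_neg_iff.mp h5 with ⟨h6, h7⟩ | ⟨h6, h7⟩ <;> constructor <;> linarith

/-- A word in which each `b` is followed by `a` is a word in `a` and `b * a`. -/
lemma exists_evalPos_left {G : Type*} [Group G] {f : Bool → G} {d : ℕ → Bool}
    (hd : ∀ i, d i = false → d (i + 1) = true) (n i : ℕ) (hn : n = 0 ∨ d (i + n - 1) = true) :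
    ∃ L, seg f (fun i => (d i, true)) i n = evalPos (f true) (f false * f true) L := by
  induction n using Nat.strong_induction_on generalizing i with
  | _ n ih =>
    rcases n with _ | n
    · exact ⟨[], rfl⟩
    cases hi : d i
    · have h1 := hd i hi
      rcases n with _ | n
      · simp [hi] at hn
      obtain ⟨L, hL⟩ := ih n (by omega) (i + 2) (by
        rcases n with _ | n
        · exact Or.inl rfl
        · right
          rcases hn with hn | hn
          · omega
          · rw [← hn]; congr 1; omega)
      refine ⟨false :: L, ?_⟩
      simp only [seg, hi, h1, letter, cond_true, hL, evalPos, List.map_cons, List.prod_cons, cond_false,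
        mul_assoc]
    · obtain ⟨L, hL⟩ := ih n (by omega) (i + 1) (by
        rcases n with _ | n
        · exact Or.inl rfl
        · right
          rcases hn with hn | hn
          · omega
          · rw [← hn]; congr 1; omega)
      refine ⟨true :: L, ?_⟩
      simp only [seg, hi, letter, cond_true, hL, evalPos, List.map_cons, List.prod_cons]

/-- A word in which each `a` is followed by `b` is a word in `a * b` and `b`. -/
lemma exists_evalPos_right {G : Type*} [Group G] {f : Bool → G} {d : ℕ → Bool}
    (hd : ∀ i, d i = true → d (i + 1) = false) (n i : ℕ) (hn : n = 0 ∨ d (i + n - 1) = false) :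
    ∃ L, seg f (fun i => (d i, true)) i n = evalPos (f true * f false) (f false) L := by
  induction n using Nat.strong_induction_on generalizing i with
  | _ n ih =>
    rcases n with _ | n
    · exact ⟨[], rfl⟩
    cases hi : d i
    · obtain ⟨L, hL⟩ := ih n (by omega) (i + 1) (by
        rcases n with _ | n
        · exact Or.inl rfl
        · right
          rcases hn with hn | hn
          · omega
          · rw [← hn]; congr 1; omega)
      refine ⟨false :: L, ?_⟩
      simp only [seg, hi, letter, cond_true, hL, evalPos, List.map_cons, List.prod_cons, cond_false]
    · have h1 := hd i hi
      rcases n with _ | n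
      · simp [hi] at hn
      obtain ⟨L, hL⟩ := ih n (by omega) (i + 2) (by
        rcases n with _ | n
        · exact Or.inl rfl
        · right
          rcases hn with hn | hn
          · omega
          · rw [← hn]; congr 1; omega)
      refine ⟨true :: L, ?_⟩
      simp only [seg, hi, h1, letter, cond_true, hL, evalPos, List.map_cons, List.prod_cons, mul_assoc]

lemma toAdd_map_evalPos {G : Type*} [Group G] (φ : G →* Multiplicative ℤ) (a b : G) (L : List Bool) :
    (φ (evalPos a b L)).toAdd = L.count true * (φ a).toAdd + L.count false * (φ b).toAdd := by
  induction L with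
  | nil => simp [evalPos]
  | cons i L ih =>
    have : evalPos a b (i :: L) = cond i a b * evalPos a b L := by simp [evalPos]
    rw [this, map_mul, toAdd_mul, ih]
    cases i <;> simp <;> ring

end MarkovTorus

namespace MarkovTorus

/-! ### Uniqueness of the simple closed geodesic of a given slope -/

lemma IsConj.toAdd_map_eq {g k : Γ} (h : IsConj g k) (φ : Γ →* Multiplicative ℤ) :
    (φ g).toAdd = (φ k).toAdd := by
  obtain ⟨c, rfl⟩ := isConj_iff.mp h
  simp

lemma slope_eq_of_isConj {g a b : Γ} {s u w : Vertex} {L : List Bool} (hs : HasSlope g s)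
    (ha : HasSlope a u) (hb : HasSlope b w) (h : IsConj g (evalPos a b L)) :
    vden s = L.count true * vden u + L.count false * vden w ∧
    vnum s = L.count true * vnum u + L.count false * vnum w := by
  obtain ⟨φ, h1, h2⟩ := exists_hom 1 0
  obtain ⟨ψ, h3, h4⟩ := exists_hom 0 1
  have e1 := IsConj.toAdd_map_eq h φ
  have e2 := IsConj.toAdd_map_eq h ψ
  rw [toAdd_map_evalPos, hs.toAdd_map, ha.toAdd_map, hb.toAdd_map, h1, h2] at e1
  rw [toAdd_map_evalPos, hs.toAdd_map, ha.toAdd_map, hb.toAdd_map, h3, h4] at e2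
  simp only [mul_one, mul_zero, add_zero, zero_add] at e1 e2
  exact ⟨e1, by linear_combination e2 - e1⟩

lemma HasSlope.mul {a b : Γ} {u v w : Vertex} (ha : HasSlope a u) (hb : HasSlope b w)
    (h : IsFareyTriple u v w) : HasSlope (a * b) v := by
  unfold HasSlope at *
  rw [map_mul, ha, hb, h.num_eq, h.den_eq]
  rw [mul_mul_mul_comm, ← zpow_add, ← zpow_add]
  congr 2; ring

lemma HasSlope.mul_comm {a b : Γ} {v : Vertex} (h : HasSlope (a * b) v) : HasSlope (b * a) v := by
  unfold HasSlope at *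
  rw [← h, map_mul, map_mul, _root_.mul_comm]

lemma evalPos_eq_seg {G : Type*} [Group G] {f : Bool → G} (L : List Bool) :
    evalPos (f true) (f false) L = seg f (fun i => (cyc L i, true)) 0 L.length := by
  rw [evalPos_eq, seg_eq]
  congr 1
  conv_lhs => rw [← map_cyc L]
  rw [List.map_map]
  rfl

lemma NonCrossing.exists_labelledTriple {g : Γ} (hyp : IsHyp g) (hg : NonCrossing g) {s : Vertex}
    (hs : HasSlope g s) (h1 : 0 ≤ vnum s) (hcop : IsCoprime (vnum s) (vden s))
    (N : ℕ) : ∀ {u v w : Vertex} {Q : MarkovQuad}, IsLabelledTriple u v w Q → ∀ {f : Bool → Γ},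
      (f true : SL(2, ℤ)) = Q.A → (f false : SL(2, ℤ)) = Q.B → HasSlope (f true) u →
      HasSlope (f false) w → ∀ {L : List Bool}, L.count true + L.count false < N → 0 < L.count true →
      0 < L.count false → IsConj g (evalPos (f true) (f false) L) →
      ∃ (u' w' : Vertex) (Q' : MarkovQuad) (m : Γ), IsLabelledTriple u' s w' Q' ∧
        (m : SL(2, ℤ)) = Q'.y.matA ∧ IsConj g m := by
  induction N with
  | zero => intros; omega
  | succ N ih =>
    intro u v w Q hQ f hA hB ha hb L hL hca hcb hconj
    have htri := hQ.isFareyTriple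
    have hdet := htri.det
    obtain ⟨e1, e2⟩ := slope_eq_of_isConj hs ha hb hconj
    by_cases heq : L.count true = L.count false
    · -- the word is `ab` or `ba`
      have hone : L.count true = 1 := by
        have : ((L.count true : ℕ) : ℤ) ∣ 1 := by
          obtain ⟨p, q, hpq⟩ := hcop
          refine ⟨p * (vnum u + vnum w) + q * (vden u + vden w), ?_⟩
          rw [← hpq, e1, e2, ← heq]; ring
        have := Int.eq_one_of_dvd_one (by positivity) this
        exact_mod_cast this
      have hlen : L.length = 2 := by
        rw [← List.count_true_add_count_false]; omega
      have hsv : s = v := by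
        rw [← heq, hone] at e1 e2
        refine vertex_ext ?_ ?_
        · rw [e2, htri.num_eq]; push_cast; ring
        · rw [e1, htri.den_eq]; push_cast; ring
      have hAB : IsConj g (f true * f false) := by
        obtain ⟨i, j, rfl⟩ := List.length_eq_two.mp hlen
        refine hconj.trans ?_
        cases i <;> cases j
        · simp at hone
        · simp only [evalPos, List.map_cons, List.map_nil, List.prod_cons, List.prod_nil, mul_one,
            cond_true, cond_false]
          exact isConj_iff.mpr ⟨f true, by group⟩
        · simp only [evalPos, List.map_cons, List.map_nil, List.prod_cons, List.prod_nil, mul_one,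
            cond_true, cond_false]
          exact IsConj.refl _
        · simp at hone
      refine ⟨u, w, Q, f true * f false, hsv ▸ hQ, ?_, hAB⟩
      rw [← Q.A_mul_B, ← hA, ← hB]; rfl
    set d := cyc L with hd
    have hlen : L.count true + L.count false = L.length := List.count_true_add_count_false L
    have hword : CyclicWord (fun i => (d i, true)) L.length :=
      ⟨by omega, fun i => by simp only [hd, cyc_add_length], fun i => by simp [invLetter]⟩
    rw [evalPos_eq_seg] at hconj
    have hmem : ∀ b : Bool, 0 < L.count b → ∃ i, d i = b := by
      intro b hb
      obtain ⟨i, hi, h⟩ := List.getElem_of_mem (List.count_pos_iff.mp hb)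
      exact ⟨i, by rw [hd, cyc_eq L hi, h]⟩
    obtain ⟨iA, hiA⟩ := hmem true hca
    obtain ⟨iB, hiB⟩ := hmem false hcb
    have hper : ∀ i, d (i + 1 + L.length - 1) = d i := by
      intro i
      rw [show i + 1 + L.length - 1 = i + L.length by omega, hd, cyc_add_length]
    by_cases hBB : ∀ i, d i = false → d (i + 1) = true
    · obtain ⟨L', hL'⟩ := exists_evalPos_left (f := f) hBB L.length (iA + 1)
        (Or.inr (by rw [hper, hiA]))
      have hconj' := hconj.trans (hword.isConj f (iA + 1))
      rw [hL'] at hconj'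
      have hba : HasSlope (f false * f true) v := (ha.mul hb htri).mul_comm
      obtain ⟨e3, e4⟩ := slope_eq_of_isConj hs ha hba hconj'
      rw [htri.den_eq] at e3
      rw [htri.num_eq] at e4
      have c1 : (L'.count false : ℤ) = L.count false := by
        linear_combination (vnum u * e3 - vden u * e4) - (vnum u * e1 - vden u * e2) +
          (L.count false - L'.count false : ℤ) * hdet
      have c2 : (L'.count true : ℤ) + L'.count false = L.count true := by
        linear_combination (vden w * e4 - vnum w * e3) - (vden w * e2 - vnum w * e1) +
          (L.count true - L'.count true - L'.count false : ℤ) * hdet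
      have c3 : 0 < L'.count true := by
        by_contra hcon
        exact heq (by omega)
      have hu : 0 ≤ vnum u := by
        rcases hQ.num_nonneg.2 with h | ⟨rfl, rfl⟩
        · exact h
        · have k1 : vnum ((-1 : ℚ) : Vertex) = -1 := by simp [vnum]
          have k2 : vnum (⊤ : Vertex) = 1 := rfl
          rw [k1, k2] at e2
          omega
      obtain ⟨v', hv'⟩ := hQ.exists_left hu
      exact ih hv' (f := fun b => cond b (f true) (f false * f true)) hA
        (by rw [MarkovQuad.left_B, ← hA, ← hB]; rfl) ha hba (L := L') (by omega) c3 (by omega) hconj'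
    by_cases hAA : ∀ i, d i = true → d (i + 1) = false
    · obtain ⟨L', hL'⟩ := exists_evalPos_right (f := f) hAA L.length (iB + 1)
        (Or.inr (by rw [hper, hiB]))
      have hconj' := hconj.trans (hword.isConj f (iB + 1))
      rw [hL'] at hconj'
      have hab : HasSlope (f true * f false) v := ha.mul hb htri
      obtain ⟨e3, e4⟩ := slope_eq_of_isConj hs hab hb hconj'
      rw [htri.den_eq] at e3
      rw [htri.num_eq] at e4
      have c1 : (L'.count true : ℤ) = L.count true := by
        linear_combination (vden w * e4 - vnum w * e3) - (vden w * e2 - vnum w * e1) +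
          (L.count true - L'.count true : ℤ) * hdet
      have c2 : (L'.count true : ℤ) + L'.count false = L.count false := by
        linear_combination (vnum u * e3 - vden u * e4) - (vnum u * e1 - vden u * e2) +
          (L.count false - L'.count true - L'.count false : ℤ) * hdet
      have c3 : 0 < L'.count false := by
        by_contra hcon
        exact heq (by omega)
      obtain ⟨v', hv'⟩ := hQ.exists_right
      exact ih hv' (f := fun b => cond b (f true * f false) (f false))
        (by rw [MarkovQuad.right_A, ← hA, ← hB]; rfl) hB hab hb (L := L') (by omega) (by omega) c3 hconj'
    · exfalso
      push Not at hBB hAA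
      obtain ⟨i, hi1, hi2⟩ := hAA
      obtain ⟨j, hj1, hj2⟩ := hBB
      replace hi2 : d (i + 1) = true := by simpa using hi2
      replace hj2 : d (j + 1) = false := by simpa using hj2

      obtain ⟨k, hk, h2, h3⟩ := Q.exists_separates hA hB hword hyp hconj i
      obtain ⟨l, hl, h4, h5⟩ := Q.exists_separates hA hB hword hyp hconj j
      simp only [hi1, hi2, invLetter] at h2 h3
      simp only [hj1, hj2, invLetter] at h4 h5
      obtain ⟨p, q, hpq, b1, b2, b3⟩ := MarkovQuad.fixPair_of_separates_A (IsHyp.of_isConj hk hyp) h2 h3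
      obtain ⟨p', q', hpq', b4, b5, b6⟩ :=
        MarkovQuad.fixPair_of_separates_B (IsHyp.of_isConj hl hyp) h4 h5
      have := hg l k hl hk _ _ _ _ hpq' hpq (by linarith) (by linarith)
      linarith

/-- A simple closed geodesic of nonnegative slope `s` is the axis of the Cohn matrix of the label
of `s`. -/
lemma IsSimpleClosedGeodesic.exists_eq {s : ℚ} (hs0 : 0 ≤ s) {C : Set 𝔛}
    (hC : IsSimpleClosedGeodesic s C) : ∃ u w Q, IsLabelledTriple u (s : Vertex) w Q ∧
      C = proj '' axis Q.y.matA := by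
  obtain ⟨g, L, hs, hyp, hL, hgL, hinj, rfl⟩ := hC
  have hyp' : IsHyp (g : SL(2, ℤ)) := hyp
  have hNC := nonCrossing_of_simple hyp' hL hgL hinj
  have h0 : 0 < vden (s : Vertex) := by simpa [vden] using s.den_pos
  have h1 : 0 ≤ vnum (s : Vertex) := by simpa [vnum] using hs0
  obtain ⟨d, hd⟩ := exists_positive_word hyp' hNC hs h0 h1
  obtain ⟨a, b, ha, hb, ha', hb', -⟩ := IsLabelledTriple.base.generators
  have ea : a = alpha := Subtype.ext (ha.trans MarkovQuad.base_A)
  have eb : b = beta := Subtype.ext (hb.trans MarkovQuad.base_B)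
  subst ea eb
  obtain ⟨e1, e2⟩ := slope_eq_of_isConj hs ha' hb' hd
  have k1 : vnum ((-1 : ℚ) : Vertex) = -1 := by simp [vnum]
  have k2 : vnum (⊤ : Vertex) = 1 := rfl
  have k3 : vden ((-1 : ℚ) : Vertex) = 1 := by simp [vden]
  have k4 : vden (⊤ : Vertex) = 0 := rfl
  rw [k1, k2] at e2
  rw [k3, k4] at e1
  obtain ⟨u, w, Q, m, hQ, hm, hgm⟩ := hNC.exists_labelledTriple hyp' hs h1 (Rat.isCoprime_num_den s)
    (d.count true + d.count false + 1) IsLabelledTriple.base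
    (f := fun i => cond i alpha beta) ha hb ha' hb' (L := d) (by omega) (by omega) (by omega) hd
  refine ⟨u, w, Q, hQ, ?_⟩
  obtain ⟨c, hc⟩ := isConj_iff.mp hgm
  rw [eq_axis hyp' hL hgL, ← hm, ← hc]
  exact (proj_axis_conj c.2 g).symm

end MarkovTorus

namespace MarkovTorus

/-! ### Existence of the simple closed geodesic of a given slope -/

lemma FixPair.matA_eq {s : MarkovFraction} {p q : ℝ} (h : FixPair s.matA p q) (X : ℝ) :
    (s.n : ℝ) ^ 2 * ((X - p) * (X - q)) = 1 - (s.n * X - s.k) * (s.k + 3 * s.n - s.n * X) := by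
  have h1 := h.sum
  have h2 := h.prod
  have h3 : (s.n : ℝ) * s.l = s.k ^ 2 + 1 := by exact_mod_cast s.eq
  simp only [MarkovFraction.matA_10, MarkovFraction.matA_00, MarkovFraction.matA_01,
    MarkovFraction.matA_11] at h1 h2
  push_cast at h1 h2
  linear_combination (-s.n * X : ℝ) * h1 + s.n * h2 + h3

lemma FixPair.matA_lt {s : MarkovFraction} {p q : ℝ} (h : FixPair s.matA p q) :
    s.k < s.n * p ∧ s.n * q < s.k + 3 * s.n := by
  have hn := s.n_pos_real
  have h1 := h.sum
  simp only [MarkovFraction.matA_10, MarkovFraction.matA_00, MarkovFraction.matA_11] at h1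
  push_cast at h1
  have hp := h.matA_eq p
  simp only [sub_self, zero_mul, mul_zero] at hp
  have hlt := mul_lt_mul_of_pos_left h.lt hn
  have hprod : 0 < (s.n * p - s.k) * (s.k + 3 * s.n - s.n * p) := by linarith
  rcases pos_and_pos_or_neg_and_neg_of_mul_pos hprod with ⟨h2, h3⟩ | ⟨h2, h3⟩
  · constructor <;> linarith
  · linarith

lemma FixPair.lt_iff {M : SL(2, ℤ)} {p q : ℝ} (h : FixPair M p q) (X : ℝ) :
    (X - p) * (X - q) < 0 ↔ p < X ∧ X < q := by
  have := h.lt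
  constructor
  · intro hX
    rcases mul_neg_iff.mp hX with ⟨h3, h4⟩ | ⟨h3, h4⟩ <;> constructor <;> linarith
  · rintro ⟨h1, h2⟩
    exact mul_neg_of_pos_of_neg (by linarith) (by linarith)

namespace MarkovQuad

variable {Q : MarkovQuad}

/-- Positions of the fixed points of `A`. -/
lemma fixPair_A {p q : ℝ} (h : FixPair Q.A p q) :
    Q.x.k < Q.x.n * p ∧ p < Q.y.val ∧ Q.z.val < q := by
  have hx := Q.x.n_pos_real
  have hy := Q.y.n_pos_real
  have hz := Q.z.n_pos_real
  have h' : FixPair Q.x.matA p q := h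
  have d1 : (Q.y.k * Q.x.n - Q.x.k * Q.y.n : ℝ) = Q.z.n := by exact_mod_cast Q.d₁
  have d3 : (Q.z.k * Q.x.n - Q.x.k * Q.z.n : ℝ) = 3 * Q.x.n * Q.z.n - Q.y.n := by exact_mod_cast Q.d₃
  have m : (Q.x.n ^ 2 + Q.y.n ^ 2 + Q.z.n ^ 2 : ℝ) = 3 * Q.x.n * Q.y.n * Q.z.n := by
    exact_mod_cast Q.markov_eq
  refine ⟨h'.matA_lt.1, ((h'.lt_iff _).mp ?_).1, ((h'.lt_iff _).mp ?_).2⟩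
  · have e := h'.matA_eq Q.y.val
    have e2 : ((Q.y.n : ℝ) * Q.x.n) ^ 2 * ((Q.y.val - p) * (Q.y.val - q)) = - (Q.x.n : ℝ) ^ 2 := by
      have e3 : (Q.y.n : ℝ) * Q.y.val = Q.y.k := by rw [Q.y.val_real]; field_simp
      calc ((Q.y.n : ℝ) * Q.x.n) ^ 2 * ((Q.y.val - p) * (Q.y.val - q))
          = (Q.y.n : ℝ) ^ 2 * ((Q.x.n : ℝ) ^ 2 * ((Q.y.val - p) * (Q.y.val - q))) := by ring
        _ = (Q.y.n : ℝ) ^ 2 - (Q.x.n * (Q.y.n * Q.y.val) - Q.x.k * Q.y.n) *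
            (Q.x.k * Q.y.n + 3 * Q.x.n * Q.y.n - Q.x.n * (Q.y.n * Q.y.val)) := by rw [e]; ring
        _ = - (Q.x.n : ℝ) ^ 2 := by
          rw [e3]
          linear_combination (-3 * Q.x.n * Q.y.n + (Q.y.k * Q.x.n - Q.x.k * Q.y.n) + Q.z.n : ℝ) * d1 + m
    have hpos : 0 < ((Q.y.n : ℝ) * Q.x.n) ^ 2 := by positivity
    refine (mul_neg_iff_of_pos hpos _).mp ?_
    rw [e2]
    have : 0 < (Q.x.n : ℝ) ^ 2 := by positivity
    linarith
  · have e := h'.matA_eq Q.z.val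
    have e2 : ((Q.z.n : ℝ) * Q.x.n) ^ 2 * ((Q.z.val - p) * (Q.z.val - q)) = - (Q.x.n : ℝ) ^ 2 := by
      have e3 : (Q.z.n : ℝ) * Q.z.val = Q.z.k := by rw [Q.z.val_real]; field_simp
      calc ((Q.z.n : ℝ) * Q.x.n) ^ 2 * ((Q.z.val - p) * (Q.z.val - q))
          = (Q.z.n : ℝ) ^ 2 * ((Q.x.n : ℝ) ^ 2 * ((Q.z.val - p) * (Q.z.val - q))) := by ring
        _ = (Q.z.n : ℝ) ^ 2 - (Q.x.n * (Q.z.n * Q.z.val) - Q.x.k * Q.z.n) *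
            (Q.x.k * Q.z.n + 3 * Q.x.n * Q.z.n - Q.x.n * (Q.z.n * Q.z.val)) := by rw [e]; ring
        _ = - (Q.x.n : ℝ) ^ 2 := by
          rw [e3]
          linear_combination (-3 * Q.x.n * Q.z.n + (Q.z.k * Q.x.n - Q.x.k * Q.z.n) +
            (3 * Q.x.n * Q.z.n - Q.y.n) : ℝ) * d3 + m
    have hpos : 0 < ((Q.z.n : ℝ) * Q.x.n) ^ 2 := by positivity
    refine (mul_neg_iff_of_pos hpos _).mp ?_
    rw [e2]
    have : 0 < (Q.x.n : ℝ) ^ 2 := by positivity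
    linarith

/-- A point of the axis between the semicircle `(x, y)` and the line `Re = z` is in the core. -/
lemma mem_core_of_axis {p q : ℝ} (h : FixPair Q.A p q) {z : ℍ} (hz : z ∈ axis Q.A)
    (h1 : z.re ≤ Q.z.val) (h2 : 0 < qf Q.x.vec Q.y.vec z) : z ∈ Q.core ∧ p < z.re := by
  obtain ⟨hp1, hp2, hq⟩ := fixPair_A h
  have hxn := Q.x.n_pos_real
  have hyn := Q.y.n_pos_real
  have hzn := Q.z.n_pos_real
  have hyz : (Q.y.val : ℝ) < Q.z.val := by exact_mod_cast Q.val_lt_yz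
  rw [h.axis_eq] at hz
  have hz' : z.re ^ 2 + z.im ^ 2 - (p + q) * z.re + p * q = 0 := hz
  have him : 0 < z.im ^ 2 := by have := z.im_pos; positivity
  obtain ⟨k1, k2⟩ := (h.lt_iff z.re).mp (by linarith)
  refine ⟨(Q.mem_core z).mpr ⟨?_, ?_, h2, ?_⟩, k1⟩
  · have := mul_lt_mul_of_pos_left k1 hxn
    linarith
  · rw [Q.z.val_real, le_div_iff₀ hzn] at h1
    linarith
  · rw [Q.y.vec_eq, Q.z.vec_eq, qf_smul]
    refine mul_pos (by positivity) ?_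
    have e : (q - p) * qf ((Q.y.val : ℝ), 1) ((Q.z.val : ℝ), 1) z =
        (q - z.re) * ((p - Q.y.val) * (p - Q.z.val)) + (z.re - p) * ((q - Q.y.val) * (q - Q.z.val)) := by
      simp only [qf]
      linear_combination (q - p) * hz'
    refine pos_of_mul_pos_right (a := q - p) ?_ (by linarith)
    rw [e]
    have a1 : 0 < (p - Q.y.val) * (p - Q.z.val) := mul_pos_of_neg_of_neg (by linarith) (by linarith)
    have a2 : 0 < (q - Q.y.val) * (q - Q.z.val) := mul_pos (by linarith) (by linarith)
    have := mul_pos (sub_pos.mpr k2) a1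
    have := mul_pos (sub_pos.mpr k1) a2
    linarith

lemma zpow_smul_mem_axis (M : SL(2, ℤ)) (m : ℤ) {z : ℍ} (hz : z ∈ axis M) : M ^ m • z ∈ axis M := by
  have := (smul_mem_axis (M ^ m) M z).mpr hz
  rwa [(Commute.zpow_self M m).eq, mul_inv_cancel_right] at this

/-- Every point of the axis of `A` is moved into the core by a power of `A`. -/
lemma exists_zpow_smul_mem_core {p q : ℝ} (h : FixPair Q.A p q) {z : ℍ} (hz : z ∈ axis Q.A) :
    ∃ m : ℤ, Q.A ^ m • z ∈ Q.core ∧ p < (Q.A ^ m • z).re := by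
  obtain ⟨hp1, hp2, hq⟩ := fixPair_A h
  have hyz : (Q.y.val : ℝ) < Q.z.val := by exact_mod_cast Q.val_lt_yz
  have hlt := h.lt
  set R : ℍ → ℝ := fun w => (w.re - p) / (q - w.re) with hR
  have hre : ∀ w ∈ axis Q.A, p < w.re ∧ w.re < q := by
    intro w hw
    rw [h.axis_eq] at hw
    have hw' : w.re ^ 2 + w.im ^ 2 - (p + q) * w.re + p * q = 0 := hw
    have him : 0 < w.im ^ 2 := by have := w.im_pos; positivity
    exact (h.lt_iff w.re).mp (by linarith)
  have hqf : ∀ w ∈ axis Q.A, qf (p, 1) (p, 1) w = (q - p) * (w.re - p) ∧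
      qf (q, 1) (q, 1) w = (q - p) * (q - w.re) := by
    intro w hw
    rw [h.axis_eq] at hw
    have hw' : w.re ^ 2 + w.im ^ 2 - (p + q) * w.re + p * q = 0 := hw
    simp only [qf]
    constructor <;> linear_combination hw'
  -- the multiplier
  set c : ℝ := (Q.A 1 0 : ℝ) with hc
  set d : ℝ := (Q.A 1 1 : ℝ) with hd
  have hcn : c = Q.x.n := rfl
  have hdk : d = -Q.x.k := by simp [hd, A]
  have hcpos : 0 < c := by rw [hcn]; exact Q.x.n_pos_real
  have hsum := h.sum
  have hprod := h.prod
  have hdet := det_real Q.A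
  have hu : (c * p + d) * (c * q + d) = 1 := by
    linear_combination c * hprod + d * hsum + hdet
  have hu1 : 0 < c * p + d := by rw [hcn, hdk]; linarith
  have hu2 : c * p + d < c * q + d := by nlinarith
  have hactp : ∀ r, r = p ∨ r = q → act Q.A (r, 1) = (c * r + d) • (r, 1) := by
    intro r hr
    have hroot : c * ((r - p) * (r - q)) = 0 := by rcases hr with rfl | rfl <;> simp
    ext
    · simp [act]
      linear_combination -hroot - r * hsum + hprod
    · simp [act]; rfl
  set Λ : ℝ := ((c * q + d) / (c * p + d)) ^ 2 with hΛ
  have hΛ1 : 1 < Λ := by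
    rw [hΛ]
    exact one_lt_pow₀ ((one_lt_div hu1).mpr hu2) two_ne_zero
  have hstep : ∀ w ∈ axis Q.A, R (Q.A • w) = Λ * R w := by
    intro w hw
    have hw' : Q.A • w ∈ axis Q.A := by simpa using zpow_smul_mem_axis Q.A 1 hw
    have e1 := qf_act Q.A (p, 1) (p, 1) w
    have e2 := qf_act Q.A (q, 1) (q, 1) w
    rw [hactp p (Or.inl rfl), qf_smul, (hqf _ hw).1, (hqf _ hw').1] at e1
    rw [hactp q (Or.inr rfl), qf_smul, (hqf _ hw).2, (hqf _ hw').2] at e2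
    have haut := autFactor_pos Q.A w
    obtain ⟨k1, k2⟩ := hre w hw
    obtain ⟨k3, k4⟩ := hre _ hw'
    have hq0 : q - p ≠ 0 := by linarith
    have hu3 : 0 < c * q + d := by linarith
    simp only [hR, hΛ]
    rw [div_pow, div_mul_div_comm, div_eq_div_iff (by linarith) (by
      have : 0 < q - w.re := by linarith
      positivity)]
    have e1' : (c * p + d) ^ 2 * ((Q.A • w).re - p) * autFactor Q.A w = w.re - p := by
      apply mul_left_cancel₀ hq0; linarith
    have e2' : (c * q + d) ^ 2 * (q - (Q.A • w).re) * autFactor Q.A w = q - w.re := by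
      apply mul_left_cancel₀ hq0; linarith
    rw [← e1', ← e2']; ring
  have hzpow : ∀ m : ℤ, R (Q.A ^ m • z) = Λ ^ m * R z := by
    have hΛ0 : Λ ≠ 0 := by positivity
    intro m
    induction m using Int.induction_on with
    | zero => simp
    | succ i ih =>
      rw [zpow_add_one₀ hΛ0, _root_.add_comm, zpow_add, zpow_one, mul_smul,
        hstep _ (zpow_smul_mem_axis _ _ hz), ih]
      ring
    | pred i ih =>
      have e := hstep _ (zpow_smul_mem_axis Q.A (-(i : ℤ) - 1) hz)
      rw [← mul_smul, ← zpow_one_add, show (1 : ℤ) + (-i - 1) = -i by ring, ih] at e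
      apply mul_left_cancel₀ hΛ0
      rw [← e, zpow_sub_one₀ hΛ0]
      field_simp
  have mono : ∀ w ∈ axis Q.A, (R w ≤ (Q.z.val - p) / (q - Q.z.val) ↔ w.re ≤ Q.z.val) := by
    intro w hw
    obtain ⟨k1, k2⟩ := hre w hw
    simp only [hR]
    rw [div_le_div_iff₀ (by linarith) (by linarith)]
    constructor
    · intro hle
      by_contra hcon
      push Not at hcon
      nlinarith
    · intro hle
      nlinarith
  have hr0 : 0 < ((Q.z.val : ℝ) - p) / (q - Q.z.val) := div_pos (by linarith) (by linarith)
  have hRz : 0 < R z := by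
    obtain ⟨k1, k2⟩ := hre z hz
    exact div_pos (by linarith) (by linarith)
  obtain ⟨m, hm1, hm2⟩ := exists_mem_Ioc_zpow (div_pos hRz hr0) hΛ1
  rw [lt_div_iff₀ hr0] at hm1
  rw [div_le_iff₀ hr0] at hm2
  have hΛpos : ∀ j : ℤ, 0 < Λ ^ j := fun j => zpow_pos (by linarith) j
  refine ⟨-(m + 1), ?_⟩
  have hmem := zpow_smul_mem_axis Q.A (-(m + 1)) hz
  have hmem' := zpow_smul_mem_axis Q.A (-m) hz
  apply mem_core_of_axis h hmem
  · rw [← mono _ hmem, hzpow, zpow_neg, inv_mul_le_iff₀ (hΛpos _)]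
    exact hm2
  · by_contra hcon
    have h1 : ¬ (Q.A ^ (-m) • z).re ≤ Q.z.val := by
      rw [← mono _ hmem', hzpow, zpow_neg, inv_mul_le_iff₀ (hΛpos _), not_le]
      exact hm1
    have h2 : Q.A • Q.A ^ (-(m + 1)) • z = Q.A ^ (-m) • z := by
      rw [← mul_smul, ← zpow_one_add]; congr 2; ring
    have h3 : ¬ (Q.A • Q.A ^ (-(m + 1)) • z ∈ Q.region (true, true)) := by
      rw [Q.smul_mem_region_A, not_not]; exact hcon
    apply h3
    change 0 < qf (-1, 0) Q.z.vec _
    rw [h2, qf_neg_one_zero]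
    rw [not_le, Q.z.val_real, div_lt_iff₀ Q.z.n_pos_real] at h1
    linarith

lemma qf_vec (s t : MarkovFraction) (z : ℍ) : qf s.vec t.vec z =
    s.n * t.n * ((z.re - s.val) * (z.re - t.val) + z.im ^ 2) := by
  rw [s.vec_eq, t.vec_eq, qf_smul]
  simp only [qf]; ring

lemma mem_core' (z : ℍ) : z ∈ Q.core ↔ (Q.x.val : ℝ) ≤ z.re ∧ z.re ≤ Q.z.val ∧
    0 < (z.re - Q.x.val) * (z.re - Q.y.val) + z.im ^ 2 ∧
    0 < (z.re - Q.y.val) * (z.re - Q.z.val) + z.im ^ 2 := by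
  have hx := Q.x.n_pos_real
  have hy := Q.y.n_pos_real
  have hz := Q.z.n_pos_real
  rw [mem_core, qf_vec, qf_vec, mul_pos_iff_of_pos_left (by positivity),
    mul_pos_iff_of_pos_left (by positivity), Q.x.val_real, Q.z.val_real, div_le_iff₀' hx,
    le_div_iff₀' hz]

/-- The vertical lines through `x`, `y`, `z` lie in the core. -/
lemma mem_core_of_re {z : ℍ} (h : z.re = Q.x.val ∨ z.re = Q.y.val ∨ z.re = Q.z.val) :
    z ∈ Q.core := by
  have hyz : (Q.y.val : ℝ) < Q.z.val := by exact_mod_cast Q.val_lt_yz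
  have hxy : (Q.x.val : ℝ) < Q.y.val := by exact_mod_cast Q.val_lt_xy
  have him : 0 < z.im ^ 2 := by have := z.im_pos; positivity
  rw [mem_core']
  rcases h with h | h | h <;> rw [h] <;> refine ⟨by linarith, by linarith, ?_, ?_⟩ <;> nlinarith

end MarkovQuad

lemma MarkovFraction.ext_val {s t : MarkovFraction} (h : s.val = t.val) : s = t := by
  have h1 : s.k = t.k := by rw [← s.val_num, ← t.val_num, h]
  have h2 : s.n = t.n := by rw [← s.val_den, ← t.val_den, h]
  have h3 : s.l = t.l := by
    have e1 := s.eq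
    rw [h1, h2, ← t.eq] at e1
    exact mul_left_cancel₀ t.n_pos.ne' e1
  cases s; cases t
  simp_all

namespace IsLabelledTriple

variable {u v w : Vertex} {Q : MarkovQuad}

lemma y_unique (h : IsLabelledTriple u v w Q) {u' w' : Vertex} {Q' : MarkovQuad}
    (h' : IsLabelledTriple u' v w' Q') : Q.y = Q'.y :=
  MarkovFraction.ext_val (h.fractional.2.1.unique h'.fractional.2.1)

/-- Elements of `Γ` that move a point of the axis of `A` to the axis are powers of `A`. -/
lemma axis_unique (h : IsLabelledTriple u v w Q) {g : SL(2, ℤ)} (hg : g ∈ Γ) {z : ℍ}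
    (hz : z ∈ axis Q.A) (hgz : g • z ∈ axis Q.A) : ∃ m : ℤ, g = Q.A ^ m := by
  obtain ⟨p, q, hpq⟩ := Q.x.isHyp_matA.exists_fixPair
  obtain ⟨m, hm, -⟩ := MarkovQuad.exists_zpow_smul_mem_core (Q := Q) hpq hz
  obtain ⟨l, hl, -⟩ := MarkovQuad.exists_zpow_smul_mem_core (Q := Q) hpq hgz
  have e : (Q.A ^ l * g * (Q.A ^ m)⁻¹) • Q.A ^ m • z = Q.A ^ l • g • z := by
    rw [← mul_smul, ← mul_smul, inv_mul_cancel_right]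
  have := h.core_unique hm (mul_mem (mul_mem (zpow_mem h.A_mem l) hg)
    (inv_mem (zpow_mem h.A_mem m))) (by rw [e]; exact hl)
  refine ⟨-l + m, ?_⟩
  rw [mul_inv_eq_one, ← eq_inv_mul_iff_mul_eq] at this
  rw [this, zpow_add, zpow_neg]

/-- No translate of the vertical line through `x` meets the axis of `A`. -/
lemma axis_disjoint (h : IsLabelledTriple u v w Q) {g : SL(2, ℤ)} (hg : g ∈ Γ) {z : ℍ}
    (hz : z ∈ axis Q.A) : (g • z).re ≠ Q.x.val := by
  intro hre
  obtain ⟨p, q, hpq⟩ := Q.x.isHyp_matA.exists_fixPair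
  obtain ⟨m, hm, hp⟩ := MarkovQuad.exists_zpow_smul_mem_core (Q := Q) hpq hz
  have hc := Q.mem_core_of_re (Or.inl hre)
  have e : (g * (Q.A ^ m)⁻¹) • Q.A ^ m • z = g • z := by
    rw [← mul_smul, inv_mul_cancel_right]
  have := h.core_unique hm (mul_mem hg (inv_mem (zpow_mem h.A_mem m))) (by rw [e]; exact hc)
  rw [mul_inv_eq_one] at this
  rw [← this, hre] at hp
  have := (MarkovQuad.fixPair_A hpq).1
  have hn := Q.x.n_pos_real
  have := mul_lt_mul_of_pos_left hp hn
  rw [Q.x.val_real, mul_div_cancel₀ _ hn.ne'] at this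
  linarith

lemma isSimpleClosedGeodesic (h : IsLabelledTriple u v w Q) :
    IsSimpleClosedGeodesic v (proj '' axis Q.y.matA) := by
  obtain ⟨v', hr⟩ := h.exists_right
  obtain ⟨a, b, ha, -, hs, -, -⟩ := hr.generators
  have hax : Q.y.matA = Q.right.A := rfl
  refine ⟨a, axis Q.y.matA, hs, ?_, isCompleteGeodesic_axis Q.y.isHyp_matA, ?_, ?_, rfl⟩
  · rw [ha]; exact Q.y.isHyp_matA
  · have := smul_axis_self Q.y.matA
    rw [hax, ← ha] at this ⊢
    exact this
  · intro k z hz hkz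
    obtain ⟨m, hm⟩ := hr.axis_unique k.2 hz hkz
    refine ⟨m, ?_⟩
    have : k = a ^ m := by
      apply Subtype.ext
      rw [hm, ← ha]; rfl
    rw [this]

lemma isSimpleClosedGeodesic_iff {s : ℚ} (hs : 0 ≤ s) (h : IsLabelledTriple u (s : Vertex) w Q)
    (C : Set 𝔛) : IsSimpleClosedGeodesic s C ↔ C = proj '' axis Q.y.matA := by
  constructor
  · intro hC
    obtain ⟨u', w', Q', h', rfl⟩ := hC.exists_eq hs
    rw [h.y_unique h']
  · rintro rfl
    exact h.isSimpleClosedGeodesic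

lemma disjoint_verticalArc (h : IsLabelledTriple u v w Q) :
    Disjoint (verticalArc Q.y.val) (proj '' axis Q.y.matA) := by
  obtain ⟨v', hr⟩ := h.exists_right
  rw [Set.disjoint_left]
  rintro _ ⟨z, hz, rfl⟩ ⟨w, hw, hzw⟩
  obtain ⟨g, hg, hgz⟩ := (proj_eq_iff _ _).mp hzw.symm
  exact hr.axis_disjoint hg hw (by rw [hgz]; exact hz)

end IsLabelledTriple
end MarkovTorus

namespace MarkovTorus

/-! ### Topology of the modular torus -/

lemma continuous_smul_int (g : SL(2, ℤ)) : Continuous fun z : ℍ => g • z :=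
  continuous_const_smul (Matrix.SpecialLinearGroup.mapGL ℝ g)

instance : ContinuousConstSMul Γ ℍ := ⟨fun g => continuous_smul_int g⟩

instance : ProperlyDiscontinuousSMul Γ ℍ where
  finite_disjoint_inter_image {K L} hK hL := by
    have h := (ProperlyDiscontinuousSMul.finite_disjoint_inter_image (Γ := 𝒮ℒ) hK hL)
    let e : Γ → 𝒮ℒ := fun g => ⟨Matrix.SpecialLinearGroup.mapGL ℝ (g : SL(2, ℤ)), g, rfl⟩
    have he : Function.Injective e := by
      intro a b hab
      have := congrArg Subtype.val hab
      exact Subtype.ext (Matrix.SpecialLinearGroup.mapGL_injective this)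
    exact (h.preimage he.injOn).subset fun g hg => hg

instance : T2Space 𝔛 := inferInstance

lemma isOpenQuotientMap_proj : IsOpenQuotientMap proj := MulAction.isOpenQuotientMap_quotientMk

lemma continuous_proj : Continuous proj := isOpenQuotientMap_proj.continuous

/-- The point `a + i exp s`. -/
noncomputable def pt (a s : ℝ) : ℍ := ⟨⟨a, Real.exp s⟩, Real.exp_pos s⟩

@[simp] lemma pt_re (a s : ℝ) : (pt a s).re = a := rfl
@[simp] lemma pt_im (a s : ℝ) : (pt a s).im = Real.exp s := rfl

lemma pt_eq (z : ℍ) : pt z.re (Real.log z.im) = z :=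
  UpperHalfPlane.ext_re_im rfl (by rw [pt_im, Real.exp_log z.im_pos])

lemma continuous_pt {X : Type*} [TopologicalSpace X] {f g : X → ℝ} (hf : Continuous f)
    (hg : Continuous g) : Continuous fun x => pt (f x) (g x) := by
  rw [isEmbedding_coe.continuous_iff]
  have : Continuous fun x => ((f x : ℂ) + (Real.exp (g x) : ℂ) * Complex.I) := by fun_prop
  refine this.congr fun x => ?_
  apply Complex.ext <;> simp [pt, Complex.exp_ofReal_re]

/-- Boxes in the upper half-plane are compact. -/
lemma isCompact_box (a b : ℝ) {c : ℝ} (hc : 0 < c) (d : ℝ) :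
    IsCompact {z : ℍ | a ≤ z.re ∧ z.re ≤ b ∧ c ≤ z.im ∧ z.im ≤ d} := by
  have h : IsCompact ((fun p : ℝ × ℝ => pt p.1 p.2) '' (Set.Icc a b ×ˢ Set.Icc (Real.log c) (Real.log d))) :=
    (isCompact_Icc.prod isCompact_Icc).image (continuous_pt continuous_fst continuous_snd)
  refine h.of_isClosed_subset ?_ ?_
  · refine (isClosed_le continuous_const continuous_re).inter
      ((isClosed_le continuous_re continuous_const).inter
        ((isClosed_le continuous_const continuous_im).inter (isClosed_le continuous_im continuous_const)))
  · rintro z ⟨h1, h2, h3, h4⟩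
    exact ⟨(z.re, Real.log z.im), ⟨⟨h1, h2⟩, Real.log_le_log hc h3, Real.log_le_log z.im_pos h4⟩, pt_eq z⟩

/-- The imaginary part after a transformation that does not fix `∞`. -/
lemma im_smul_mul_im_le {g : SL(2, ℤ)} (hg : g 1 0 ≠ 0) (z : ℍ) : (g • z).im * z.im ≤ 1 := by
  have h := (smul_re_im g z).2
  have hz := z.im_pos
  have hgz := (g • z).im_pos
  have h1 : (1 : ℝ) ≤ (g 1 0 : ℝ) ^ 2 := by
    have : (1 : ℤ) ≤ (g 1 0) ^ 2 := by
      have : 0 < (g 1 0) ^ 2 := by positivity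
      omega
    exact_mod_cast this
  have h2 : z.im ^ 2 ≤ autFactor g z := by
    unfold autFactor
    nlinarith [sq_nonneg ((g 1 0 : ℝ) * z.re + g 1 1), sq_nonneg z.im]
  have h3 : (g • z).im * z.im * z.im ≤ 1 * z.im := by
    rw [one_mul]
    calc (g • z).im * z.im * z.im = (g • z).im * z.im ^ 2 := by ring
      _ ≤ (g • z).im * autFactor g z := by gcongr
      _ = z.im := h
  exact le_of_mul_le_mul_right h3 hz

/-- The imaginary part after a transformation that fixes `∞`. -/
lemma im_smul_of_eq_zero {g : SL(2, ℤ)} (hg : g 1 0 = 0) (z : ℍ) : (g • z).im = z.im := by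
  have h := (smul_re_im g z).2
  have hdet := det_real g
  have h0 : (g 1 0 : ℝ) = 0 := by exact_mod_cast hg
  have hd : (g 1 1 : ℝ) ^ 2 = 1 := by
    have hdet' := det_int g
    rw [hg] at hdet'
    have : g 1 1 ∣ 1 := ⟨g 0 0, by linarith⟩
    rcases Int.isUnit_iff.mp (isUnit_of_dvd_one this) with h | h <;> rw [h] <;> norm_num
  have : autFactor g z = 1 := by
    unfold autFactor; rw [h0]; simpa using hd
  rwa [this, mul_one] at h

/-- The vertical line through a Markov fraction is properly embedded. -/
lemma isProperMap_vertical (s : MarkovFraction) {L : Set ℍ} (hL : L = {z : ℍ | z.re = (s.val : ℝ)}) :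
    IsProperMap fun z : L => proj z := by
  have hcont : Continuous fun z : L => proj z := continuous_proj.comp continuous_subtype_val
  rw [isProperMap_iff_isCompact_preimage]
  refine ⟨hcont, fun K hK => ?_⟩
  obtain ⟨N, hN⟩ := hK.elim_directed_cover
    (fun N : ℕ => proj '' {z : ℍ | 1 / ((N : ℝ) + 1) < z.im ∧ z.im < N + 1})
    (fun N => isOpenQuotientMap_proj.isOpenMap _
      ((isOpen_lt continuous_const continuous_im).inter (isOpen_lt continuous_im continuous_const)))
    (by
      intro x _
      obtain ⟨z, rfl⟩ := isOpenQuotientMap_proj.surjective x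
      have hz := z.im_pos
      obtain ⟨N, hN⟩ := exists_nat_gt (max z.im (1 / z.im))
      rw [max_lt_iff] at hN
      refine Set.mem_iUnion.mpr ⟨N, z, ⟨?_, by linarith⟩, rfl⟩
      rw [div_lt_iff₀ (by positivity)]
      have := hN.2
      rw [div_lt_iff₀ hz] at this
      nlinarith)
    (by
      apply Monotone.directed_le
      intro M N hMN
      apply Set.image_mono
      rintro z ⟨h1, h2⟩
      have : (M : ℝ) ≤ N := by exact_mod_cast hMN
      refine ⟨lt_of_le_of_lt ?_ h1, by linarith⟩
      gcongr)
  have hN0 : (0 : ℝ) < N + 1 := by positivity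
  have hn := s.n_pos_real
  have hbound : ∀ (σ : SL(2, ℤ)) (z : ℍ), proj z ∈ K → (σ • z).im ≤ N + 1 := by
    intro σ z hz
    obtain ⟨w, ⟨hw1, hw2⟩, hw⟩ := hN hz
    obtain ⟨h, -, rfl⟩ := (proj_eq_iff _ _).mp hw
    by_contra hcon
    push Not at hcon
    have e : h • z = (h * σ⁻¹) • σ • z := by rw [mul_smul, inv_smul_smul]
    rw [e] at hw1 hw2
    by_cases hc : (h * σ⁻¹) 1 0 = 0
    · rw [im_smul_of_eq_zero hc] at hw2
      linarith
    · have := im_smul_mul_im_le hc (σ • z)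
      rw [div_lt_iff₀ hN0] at hw1
      have h1 := ((h * σ⁻¹) • σ • z).im_pos
      nlinarith
  have hcl : IsClosed ((fun z : L => proj z) ⁻¹' K) := hK.isClosed.preimage hcont
  have hLc : IsClosed L := by
    rw [hL]; exact isClosed_eq continuous_re continuous_const
  rw [Subtype.isCompact_iff]
  refine (isCompact_box s.val s.val (c := 1 / (s.n ^ 2 * (N + 1))) (by positivity)
    (N + 1)).of_isClosed_subset (hLc.isClosedEmbedding_subtypeVal.isClosedMap _ hcl) ?_
  rintro _ ⟨⟨z, hzL⟩, hz, rfl⟩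
  have hre : z.re = s.val := by rw [hL] at hzL; exact hzL
  refine ⟨hre.ge, hre.le, ?_, ?_⟩
  · have h1 := hbound s.matA z hz
    have h2 := (smul_re_im s.matA z).2
    have haut : autFactor s.matA z = (s.n * z.im) ^ 2 := by
      simp only [autFactor, MarkovFraction.matA_10, MarkovFraction.matA_11]
      rw [hre, s.val_real, mul_div_cancel₀ _ hn.ne']
      push_cast; ring
    rw [haut] at h2
    have hz0 := z.im_pos
    have h3 : (s.matA • z).im * (s.n ^ 2 * z.im) = 1 := by
      apply mul_right_cancel₀ hz0.ne'
      linarith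
    change 1 / _ ≤ z.im
    rw [div_le_iff₀ (by positivity)]
    calc (1 : ℝ) = (s.matA • z).im * (s.n ^ 2 * z.im) := h3.symm
      _ ≤ (N + 1) * (s.n ^ 2 * z.im) := by gcongr
      _ = _ := by ring
  · simpa using hbound 1 z hz

/-- A parametrization of a geodesic that starts at a finite endpoint. -/
lemma exists_parametrization {u : ℝ} {v : WithTop ℝ} (h : (u : WithTop ℝ) ≠ v) :
    ∃ c : ℝ → ℍ, Continuous c ∧ (∀ s, c s ∈ geodesic u v) ∧
      Filter.Tendsto (fun s => (c s).re) Filter.atBot (nhds u) ∧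
      Filter.Tendsto (fun s => (c s).im) Filter.atBot (nhds 0) := by
  cases v using WithTop.recTopCoe with
  | top =>
    refine ⟨fun s => pt u s, continuous_pt continuous_const continuous_id, fun s => rfl,
      tendsto_const_nhds, Real.tendsto_exp_atBot⟩
  | coe v =>
    have huv : u ≠ v := by simpa using h
    have hd : 0 < |v - u| := abs_pos.mpr (sub_ne_zero.mpr huv.symm)
    have hden : ∀ s, 0 < 1 + Real.exp s ^ 2 := fun s => by positivity
    have c1 : Continuous fun s : ℝ => (u + v * Real.exp s ^ 2) / (1 + Real.exp s ^ 2) :=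
      Continuous.div (by fun_prop) (by fun_prop) fun s => (hden s).ne'
    have c2 : Continuous fun s : ℝ => Real.exp s * |v - u| / (1 + Real.exp s ^ 2) :=
      Continuous.div (by fun_prop) (by fun_prop) fun s => (hden s).ne'
    have hpos : ∀ s, 0 < Real.exp s * |v - u| / (1 + Real.exp s ^ 2) := fun s => by positivity
    have hexp := Real.tendsto_exp_atBot
    refine ⟨fun s => pt ((u + v * Real.exp s ^ 2) / (1 + Real.exp s ^ 2))
      (Real.log (Real.exp s * |v - u| / (1 + Real.exp s ^ 2))),
      continuous_pt c1 (c2.log fun s => (hpos s).ne'), ?_, ?_, ?_⟩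
    · intro s
      change (pt _ _).re ^ 2 + (pt _ _).im ^ 2 - (u + v) * (pt _ _).re + u * v = 0
      rw [pt_re, pt_im, Real.exp_log (hpos s)]
      have := hden s
      field_simp
      rw [sq_abs]
      ring
    · simp only [pt_re]
      have : Filter.Tendsto (fun s : ℝ => (u + v * Real.exp s ^ 2) / (1 + Real.exp s ^ 2)) Filter.atBot
          (nhds ((u + v * 0 ^ 2) / (1 + 0 ^ 2))) :=
        ((tendsto_const_nhds.add (tendsto_const_nhds.mul (hexp.pow 2))).div
          (tendsto_const_nhds.add (hexp.pow 2)) (by norm_num))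
      simpa using this
    · simp only [pt_im, Real.exp_log (hpos _)]
      have : Filter.Tendsto (fun s : ℝ => Real.exp s * |v - u| / (1 + Real.exp s ^ 2)) Filter.atBot
          (nhds (0 * |v - u| / (1 + 0 ^ 2))) :=
        ((hexp.mul tendsto_const_nhds).div (tendsto_const_nhds.add (hexp.pow 2)) (by norm_num))
      simpa using this

/-- A compact set whose complement consists of points in horoballs. -/
lemma exists_compact_core : ∃ K : Set 𝔛, IsCompact K ∧ ∀ z : ℍ, proj z ∉ K →
    ∃ g : SL(2, ℤ), 1 < (g • z).im := by
  refine ⟨proj '' {z : ℍ | 0 ≤ z.re ∧ z.re ≤ 6 ∧ 1 / 2 ≤ z.im ∧ z.im ≤ 1},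
    (isCompact_box 0 6 (by norm_num) 1).image continuous_proj, fun z hz => ?_⟩
  obtain ⟨g, hg1, hg2⟩ := ModularGroup.exists_smul_mem_fd z
  refine ⟨g, ?_⟩
  by_contra hcon
  push Not at hcon
  apply hz
  have him : 1 / 2 ≤ (g • z).im := by
    rw [Complex.normSq_apply] at hg1
    have e1 : ((g • z : ℍ) : ℂ).re = (g • z).re := rfl
    have e2 : ((g • z : ℍ) : ℂ).im = (g • z).im := rfl
    rw [e1, e2] at hg1
    have := (g • z).im_pos
    rw [abs_le] at hg2
    nlinarith
  obtain ⟨j, h, hh, rfl⟩ := exists_T_zpow_mul g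
  rw [mul_smul] at hcon him
  have himT : (ModularGroup.T ^ j • h • z).im = (h • z).im := ModularGroup.im_T_zpow_smul _ _
  rw [himT] at hcon him
  obtain ⟨i, h1, h2⟩ : ∃ i : ℤ, 0 ≤ (h • z).re + 6 * i ∧ (h • z).re + 6 * i ≤ 6 := by
    refine ⟨-⌊(h • z).re / 6⌋, ?_, ?_⟩
    · have := Int.floor_le ((h • z).re / 6)
      push_cast; linarith
    · have := Int.lt_floor_add_one ((h • z).re / 6)
      push_cast; linarith
  obtain ⟨k, hk, hk', -⟩ := exists_translate i
  have ere : (k • h • z).re = (h • z).re + 6 * i := by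
    rw [hk', ModularGroup.re_T_zpow_smul]; push_cast; ring
  have eim : (k • h • z).im = (h • z).im := by
    rw [hk', ModularGroup.im_T_zpow_smul]
  refine ⟨k • h • z, ⟨by rw [ere]; exact h1, by rw [ere]; exact h2, by rw [eim]; exact him,
    by rw [eim]; exact hcon⟩, ?_⟩
  rw [proj_smul hk, proj_smul hh]

/-- The finite endpoints of properly embedded geodesics are rational. -/
lemma exists_act_eq_of_proper {u : ℝ} {v : WithTop ℝ} (h : (u : WithTop ℝ) ≠ v)
    (hL : IsProperMap fun z : geodesic u v => proj z) :
    ∃ g : SL(2, ℤ), (g 1 0 : ℝ) * u + g 1 1 = 0 := by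
  obtain ⟨c, hc, hcL, hre, him⟩ := exists_parametrization h
  obtain ⟨K, hK, hKout⟩ := exists_compact_core
  have hpre := hL.isCompact_preimage hK
  rw [Subtype.isCompact_iff] at hpre
  set P : Set ℍ := Subtype.val '' ((fun z : geodesic u v => proj z) ⁻¹' K) with hP
  obtain ⟨ε, hε, hεP⟩ : ∃ ε : ℝ, 0 < ε ∧ ∀ z ∈ P, ε ≤ z.im := by
    rcases P.eq_empty_or_nonempty with h0 | h0
    · exact ⟨1, one_pos, by rw [h0]; simp⟩
    · obtain ⟨z, hz, hmin⟩ := hpre.exists_isMinOn h0 continuous_im.continuousOn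
      exact ⟨z.im, z.im_pos, fun w hw => hmin hw⟩
  have hev := him.eventually_lt_const hε
  obtain ⟨s₀, hs₀⟩ := Filter.eventually_atBot.mp hev
  have hout : ∀ s ≤ s₀, ∃ g : SL(2, ℤ), 1 < (g • c s).im := by
    intro s hs
    apply hKout
    intro hcon
    have := hεP (c s) ⟨⟨c s, hcL s⟩, hcon, rfl⟩
    linarith [hs₀ s hs]
  obtain ⟨g, hg⟩ := hout s₀ le_rfl
  -- the end of the geodesic stays in one horoball
  have hopen : ∀ g : SL(2, ℤ), IsOpen {z : ℍ | 1 < (g • z).im} := fun g =>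
    isOpen_lt continuous_const (continuous_im.comp (continuous_smul_int g))
  have hsub : c '' Set.Iic s₀ ⊆ {z : ℍ | 1 < (g • z).im} := by
    refine IsPreconnected.subset_left_of_subset_union (hopen g)
      (v := ⋃ g' ∈ {g' : SL(2, ℤ) | ∃ z : ℍ, (g' • z).im ≠ (g • z).im}, {z : ℍ | 1 < (g' • z).im})
      (isOpen_biUnion fun g' _ => hopen g') ?_ ?_ ⟨c s₀, ⟨s₀, Set.mem_Iic.mpr le_rfl, rfl⟩, hg⟩
      (isPreconnected_Iic.image c hc.continuousOn)
    · rw [Set.disjoint_left]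
      intro z hz hz'
      simp only [Set.mem_iUnion] at hz'
      obtain ⟨g', ⟨w, hw⟩, hz'⟩ := hz'
      have e : ∀ w : ℍ, g' • w = (g' * g⁻¹) • g • w := fun w => by rw [mul_smul, inv_smul_smul]
      rw [e] at hw
      by_cases h0 : (g' * g⁻¹) 1 0 = 0
      · exact hw (im_smul_of_eq_zero h0 _)
      · have h1 := im_smul_mul_im_le h0 (g • z)
        rw [← e] at h1
        have h2 : 1 < (g • z).im := hz
        have h3 : 1 < (g' • z).im := hz'
        nlinarith
    · rintro _ ⟨s, hs, rfl⟩
      obtain ⟨g', hg'⟩ := hout s hs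
      by_cases h0 : ∃ z : ℍ, (g' • z).im ≠ (g • z).im
      · right
        simp only [Set.mem_iUnion]
        exact ⟨g', h0, hg'⟩
      · left
        push Not at h0
        change 1 < (g • c s).im
        rw [← h0]
        exact hg'
  refine ⟨g, ?_⟩
  by_contra hne
  have hlim : Filter.Tendsto (fun s => autFactor g (c s)) Filter.atBot
      (nhds ((g 1 0 * u + g 1 1) ^ 2 + (g 1 0 * 0) ^ 2)) := by
    unfold autFactor
    exact (((tendsto_const_nhds.mul hre).add tendsto_const_nhds).pow 2).add
      ((tendsto_const_nhds.mul him).pow 2)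
  have hpos : 0 < ((g 1 0 : ℝ) * u + g 1 1) ^ 2 + (g 1 0 * 0) ^ 2 := by positivity
  have hle : ∀ᶠ s in Filter.atBot, autFactor g (c s) ≤ (c s).im := by
    filter_upwards [Filter.eventually_le_atBot s₀] with s hs
    have h1 : 1 < (g • c s).im := hsub ⟨s, hs, rfl⟩
    have h2 := (smul_re_im g (c s)).2
    have := autFactor_pos g (c s)
    nlinarith
  have := le_of_tendsto_of_tendsto hlim him hle
  linarith

end MarkovTorus

namespace MarkovTorus

/-! ### Simple proper arcs -/

lemma exists_act_snd_eq_zero {u v : WithTop ℝ} (h : u ≠ v)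
    (hL : IsProperMap fun z : geodesic u v => proj z) :
    ∃ g : SL(2, ℤ), (act g (toVec u)).2 = 0 := by
  cases u using WithTop.recTopCoe with
  | top => exact ⟨1, by simp [act_one, toVec]⟩
  | coe u =>
    obtain ⟨g, hg⟩ := exists_act_eq_of_proper h hL
    exact ⟨g, by simpa [act, toVec] using hg⟩

lemma toVec_coe (t : ℝ) : toVec (t : WithTop ℝ) = (t, 1) := rfl

lemma toVec_top : toVec ⊤ = (1, 0) := rfl

/-- A simple proper arc is the projection of a vertical line over a rational point. -/
lemma IsSimpleProperArc.exists_vertical {S : Set 𝔛} (h : IsSimpleProperArc S) :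
    ∃ t : ℝ, S = proj '' {z : ℍ | z.re = t} ∧ Set.InjOn proj {z : ℍ | z.re = t} ∧
      ∃ g : SL(2, ℤ), (g 1 0 : ℝ) * t + g 1 1 = 0 := by
  obtain ⟨L, ⟨u, v, huv, rfl⟩, hinj, hprop, rfl⟩ := h
  obtain ⟨g, hg⟩ := exists_act_snd_eq_zero huv hprop
  obtain ⟨g', hg'⟩ : ∃ g : SL(2, ℤ), (act g (toVec v)).2 = 0 := by
    refine exists_act_snd_eq_zero huv.symm ?_
    rw [geodesic_comm]; exact hprop
  obtain ⟨j, k, hk, rfl⟩ := exists_T_zpow_mul g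
  rw [act_mul, act_T_zpow] at hg
  have hU : act k (toVec u) = (act k (toVec u)).1 • toVec ⊤ := by
    rw [toVec_top]; ext
    · simp
    · simpa using hg
  have hc : (act k (toVec u)).1 ≠ 0 := by
    intro h0
    rw [h0, zero_smul] at hU
    exact act_ne_zero k (toVec_ne_zero u) hU
  obtain ⟨v', d, hd, hV⟩ := exists_boundary_smul k v
  have hv' : v' ≠ ⊤ := by
    rintro rfl
    apply huv
    rw [← wedge_toVec_eq_zero, ← wedge_act k, hU, hV, wedge_smul, wedge_toVec_eq_zero.mpr rfl, mul_zero]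
  obtain ⟨t, rfl⟩ := WithTop.ne_top_iff_exists.mp hv'
  have hmem : ∀ z : ℍ, k • z ∈ {z : ℍ | z.re = t} ↔ z ∈ geodesic u v :=
    fun z => smul_mem_geodesic hc hd hU hV z
  refine ⟨t, (proj_image_smul hk hmem).symm, ?_, g' * k⁻¹, ?_⟩
  · intro z hz w hw hzw
    have hz' : k⁻¹ • z ∈ geodesic u v := by rw [← hmem, smul_inv_smul]; exact hz
    have hw' : k⁻¹ • w ∈ geodesic u v := by rw [← hmem, smul_inv_smul]; exact hw
    have := hinj hz' hw' (by rw [proj_smul (inv_mem hk), proj_smul (inv_mem hk), hzw])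
    exact (MulAction.injective k⁻¹) this
  · have e : act (g' * k⁻¹) (d • toVec (t : WithTop ℝ)) = act g' (toVec v) := by
      rw [← hV, act_mul, act_inv_act]
    have e2 := congrArg Prod.snd e
    rw [hg', act_smul, toVec_coe] at e2
    simpa [act, hd] using e2

namespace MarkovFraction

variable (s : MarkovFraction)

lemma matA_mul_T_mul_matB : s.matA * ModularGroup.T ^ (3 : ℤ) * s.matB = ModularGroup.T ^ (3 : ℤ) := by
  have hT : ((ModularGroup.T ^ (3 : ℤ) : SL(2, ℤ)) : Matrix (Fin 2) (Fin 2) ℤ) = !![1, 3; 0, 1] :=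
    ModularGroup.coe_T_zpow 3
  have e := s.eq
  apply Subtype.ext
  rw [Matrix.SpecialLinearGroup.coe_mul, Matrix.SpecialLinearGroup.coe_mul, hT]
  change !![_, _; _, _] * _ * !![_, _; _, _] = _
  ext i j
  fin_cases i <;> fin_cases j <;> simp [Matrix.mul_apply, Fin.sum_univ_two] <;> linarith

end MarkovFraction

lemma axis_inv (M : SL(2, ℤ)) : axis M⁻¹ = axis M := by
  have i00 : (M⁻¹) 0 0 = M 1 1 := by simp [Matrix.SpecialLinearGroup.SL2_inv_expl]
  have i01 : (M⁻¹) 0 1 = -M 0 1 := by simp [Matrix.SpecialLinearGroup.SL2_inv_expl]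
  have i10 : (M⁻¹) 1 0 = -M 1 0 := by simp [Matrix.SpecialLinearGroup.SL2_inv_expl]
  have i11 : (M⁻¹) 1 1 = M 0 0 := by simp [Matrix.SpecialLinearGroup.SL2_inv_expl]
  ext z
  simp only [axis, Set.mem_ofPred_eq, axisForm, i00, i01, i10, i11]
  push_cast
  constructor <;> intro h <;> linarith

lemma proj_T_zpow_six (i : ℤ) (z : ℍ) : proj (ModularGroup.T ^ (6 * i) • z) = proj z := by
  obtain ⟨h, hh, hz, -⟩ := exists_translate i
  rw [← hz, proj_smul hh]

namespace IsLabelledTriple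

variable {u v w : Vertex} {Q : MarkovQuad}

/-- The closed geodesic is invariant under the translation by `3`. -/
lemma proj_T_axis (h : IsLabelledTriple u v w Q) (j : ℤ) {z : ℍ} (hz : z ∈ axis Q.y.matA) :
    proj (ModularGroup.T ^ (3 * j) • z) ∈ proj '' axis Q.y.matA := by
  rcases Int.even_or_odd' j with ⟨i, rfl | rfl⟩
  · exact ⟨z, hz, by rw [← mul_assoc, show (3 * 2 : ℤ) = 6 by norm_num, proj_T_zpow_six]⟩
  · have e : (ModularGroup.T ^ (3 * (2 * i + 1)) : SL(2, ℤ)) =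
        ModularGroup.T ^ (6 * (i + 1)) * ModularGroup.T ^ (-3 : ℤ) := by
      rw [← zpow_add]; congr 1; ring
    rw [e, mul_smul, proj_T_zpow_six]
    have hB : Q.B * Q.y.matA * Q.B⁻¹ = Q.y.matB := by
      rw [← Q.A_mul_B, ← Q.B_mul_A]; group
    have hT : ModularGroup.T ^ (-3 : ℤ) * Q.y.matA⁻¹ * (ModularGroup.T ^ (-3 : ℤ))⁻¹ = Q.y.matB := by
      have := Q.y.matA_mul_T_mul_matB
      rw [mul_assoc, ← eq_inv_mul_iff_mul_eq, ← eq_inv_mul_iff_mul_eq] at this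
      rw [this]; group
    have h1 : ModularGroup.T ^ (-3 : ℤ) • z ∈ axis Q.y.matB := by
      rw [← hT, smul_mem_axis, axis_inv]; exact hz
    refine ⟨Q.B⁻¹ • ModularGroup.T ^ (-3 : ℤ) • z, ?_, proj_smul (inv_mem h.B_mem) _⟩
    rw [← smul_mem_axis Q.B, hB, smul_inv_smul]
    exact h1

lemma matA_mem (h : IsLabelledTriple u v w Q) : Q.y.matA ∈ Γ := by
  rw [← Q.A_mul_B]; exact mul_mem h.A_mem h.B_mem

lemma verticalArc_add (h : IsLabelledTriple u v w Q) (j : ℤ) {t : ℝ} (ht : t = Q.y.val + 3 * j) :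
    proj '' {z : ℍ | z.re = t} = verticalArc Q.y.val := by
  have step : ∀ i : ℤ, ∀ {r : ℝ}, proj '' {z : ℍ | z.re = r + 6 * i} = proj '' {z : ℍ | z.re = r} := by
    intro i r
    obtain ⟨k, hk, hz, -⟩ := exists_translate i
    refine proj_image_smul hk fun z => ?_
    rw [hz, Set.mem_ofPred_eq, Set.mem_ofPred_eq, ModularGroup.re_T_zpow_smul]
    push_cast
    constructor <;> intro h <;> linarith
  rcases Int.even_or_odd' j with ⟨i, rfl | rfl⟩
  · rw [ht, show (Q.y.val : ℝ) + 3 * ((2 * i : ℤ) : ℝ) = Q.y.val + 6 * i by push_cast; ring, step]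
    rfl
  · rw [ht, show (Q.y.val : ℝ) + 3 * ((2 * i + 1 : ℤ) : ℝ) = (Q.y.val + 3) + 6 * i by push_cast; ring,
      step]
    have hn := Q.y.n_pos_real
    refine proj_image_smul h.matA_mem fun z => ?_
    have hA : act Q.y.matA (toVec (Q.y.val : ℝ)) = (-1 / (Q.y.n : ℝ)) • toVec ⊤ := by
      have e : (Q.y.n : ℝ) * Q.y.l = Q.y.k ^ 2 + 1 := by exact_mod_cast Q.y.eq
      rw [toVec_coe, toVec_top, Q.y.val_real]
      ext
      · simp [act]
        field_simp
        linear_combination -e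
      · simp [act]
        field_simp; ring
    have hA' : act Q.y.matA (toVec ⊤) = (Q.y.n : ℝ) • toVec ((Q.y.val + 3 : ℝ) : WithTop ℝ) := by
      rw [toVec_coe, toVec_top, Q.y.val_real]
      ext
      · simp [act]
        field_simp; ring
      · simp [act]
    exact smul_mem_geodesic (u := ⊤) (v := (Q.y.val : ℝ)) (u' := ((Q.y.val + 3 : ℝ) : WithTop ℝ))
      (v' := ⊤) hn.ne' (div_ne_zero (by norm_num) hn.ne') hA' hA z

/-- The only simple proper arc disjoint from the closed geodesic is the vertical one. -/
lemma eq_verticalArc (h : IsLabelledTriple u v w Q) {S : Set 𝔛} (hS : IsSimpleProperArc S)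
    (hd : Disjoint S (proj '' axis Q.y.matA)) : S = verticalArc Q.y.val := by
  obtain ⟨t, rfl, hinj, g, hg⟩ := hS.exists_vertical
  have hn := Q.y.n_pos_real
  obtain ⟨p, q, hpq⟩ := Q.y.isHyp_matA.exists_fixPair
  set j : ℤ := ⌊(t - Q.y.val) / 3⌋ with hj
  have hj1 : 0 ≤ t - 3 * j - Q.y.val := by
    have := Int.floor_le ((t - Q.y.val) / 3)
    linarith
  have hj2 : t - 3 * j - Q.y.val < 3 := by
    have := Int.lt_floor_add_one ((t - Q.y.val) / 3)
    linarith
  set r := t - 3 * j with hr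
  have hT : ∀ z : ℍ, (ModularGroup.T ^ (3 * j) • z).re = z.re + 3 * j := by
    intro z; rw [ModularGroup.re_T_zpow_smul]; push_cast; ring
  rcases hj1.eq_or_lt with h0 | h0
  · exact h.verticalArc_add j (by linarith)
  exfalso
  have hk : (Q.y.k : ℝ) = Q.y.n * Q.y.val := by rw [Q.y.val_real]; field_simp
  have hq := hpq.matA_eq r
  rw [hk] at hq
  rcases lt_trichotomy ((r - p) * (r - q)) 0 with h1 | h1 | h1
  · -- the line crosses a translate of the closed geodesic
    obtain ⟨h2, h3⟩ := (hpq.lt_iff r).mp h1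
    obtain ⟨z, hz, hzr⟩ := exists_mem_vertical_inter h2 h3
    rw [← hpq.axis_eq] at hz
    refine Set.disjoint_left.mp hd ⟨_, ?_, rfl⟩ (h.proj_T_axis j hz)
    rw [Set.mem_ofPred_eq, hT, hzr, hr]; ring
  · -- the line is asymptotic to a translate of the closed geodesic
    have hroot : fixForm Q.y.matA (r, 1) = 0 := by
      rw [hpq.fixForm]; simp only [mul_one]; rw [h1, mul_zero]
    have hg' : (g 1 0 : ℝ) ≠ 0 := by
      intro h2
      have hdet := det_real g
      rw [h2] at hg hdet
      simp only [zero_mul, zero_add] at hg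
      rw [hg] at hdet
      norm_num at hdet
    have hgz : g 1 0 ≠ 0 := by exact_mod_cast hg'
    refine Q.y.isHyp_matA.fixForm_ne_zero (k := -(g 1 1) - 3 * j * g 1 0) (n := g 1 0) (Or.inr hgz) ?_
    have e : (((-(g 1 1) - 3 * j * g 1 0 : ℤ) : ℝ), ((g 1 0 : ℤ) : ℝ)) = (g 1 0 : ℝ) • (r, (1 : ℝ)) := by
      ext
      · simp only [Prod.smul_fst, smul_eq_mul, hr]; push_cast; linear_combination -hg
      · simp
    rw [e, fixForm_smul, hroot, mul_zero]
  · -- the line crosses a translate of itself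
    have hσ : 0 < Q.y.val + 3 - r := by linarith
    have h2 : (Q.y.n : ℝ) ^ 2 * ((r - Q.y.val) * (Q.y.val + 3 - r)) < 1 := by
      have : 0 < (Q.y.n : ℝ) ^ 2 * ((r - p) * (r - q)) := by positivity
      linarith
    set e : ℝ := Q.y.val + 1 / (Q.y.n ^ 2 * (Q.y.val + 3 - r)) with he
    have hre : r < e := by
      rw [he, ← sub_lt_iff_lt_add', lt_div_iff₀ (by positivity)]
      linarith
    obtain ⟨z, hz, hzr⟩ := exists_mem_vertical_inter (p := Q.y.val) (t := r) (q := e) (by linarith) hre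
    have hA : act Q.y.matA (toVec (Q.y.val : ℝ)) = (-1 / (Q.y.n : ℝ)) • toVec ⊤ := by
      have e : (Q.y.n : ℝ) * Q.y.l = Q.y.k ^ 2 + 1 := by exact_mod_cast Q.y.eq
      rw [toVec_coe, toVec_top, Q.y.val_real]
      ext
      · simp [act]
        field_simp
        linear_combination -e
      · simp [act]
        field_simp; ring
    have hA' : act Q.y.matA (toVec (e : ℝ)) = (1 / (Q.y.n * (Q.y.val + 3 - r)) : ℝ) • toVec (r : ℝ) := by
      have e3 : (Q.y.n : ℝ) * Q.y.l = Q.y.k ^ 2 + 1 := by exact_mod_cast Q.y.eq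
      have e4 : (Q.y.l : ℝ) = Q.y.n * Q.y.val ^ 2 + 1 / Q.y.n := by
        field_simp; rw [hk] at e3; linear_combination e3
      rw [toVec_coe, toVec_coe]
      ext
      · simp only [act, MarkovFraction.matA_00, MarkovFraction.matA_01, Prod.smul_mk, smul_eq_mul]
        push_cast
        rw [e4, hk, he]
        have := hσ.ne'
        field_simp
        ring
      · simp only [act, MarkovFraction.matA_10, MarkovFraction.matA_11, Prod.smul_mk, smul_eq_mul]
        push_cast
        rw [hk, he]
        have := hσ.ne'
        field_simp
        ring
    have hAz : (Q.y.matA • z).re = r :=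
      (smul_mem_geodesic (div_ne_zero (by norm_num) hn.ne') (by positivity) hA hA' z).mpr hz
    have hproj : proj (ModularGroup.T ^ (3 * j) • Q.y.matA • z) = proj (ModularGroup.T ^ (3 * j) • z) := by
      have : ModularGroup.T ^ (3 * j) • Q.y.matA • z =
          (ModularGroup.T ^ (3 * j) * Q.y.matA * (ModularGroup.T ^ (3 * j))⁻¹) •
            ModularGroup.T ^ (3 * j) • z := by
        rw [← mul_smul, ← mul_smul, inv_mul_cancel_right]
      rw [this, proj_smul (gamma_normal.conj_mem _ h.matA_mem _)]
    have heq := hinj (by rw [Set.mem_ofPred_eq, hT, hAz, hr]; ring)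
      (by rw [Set.mem_ofPred_eq, hT, hzr, hr]; ring) hproj
    have h3 := eq_one_of_smul_eq h.matA_mem ((MulAction.injective (ModularGroup.T ^ (3 * j))) heq)
    have h4 := Q.y.isHyp_matA
    rw [h3] at h4
    simp [IsHyp] at h4

/-- The core embeds in `𝔛`. -/
lemma eq_of_proj_eq (h : IsLabelledTriple u v w Q) {z z' : ℍ} (hz : z ∈ Q.core) (hz' : z' ∈ Q.core)
    (hp : proj z = proj z') : z = z' := by
  obtain ⟨g, hg, rfl⟩ := (proj_eq_iff _ _).mp hp
  rw [h.core_unique hz' hg hz, one_smul]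

lemma isSimpleProperArc (h : IsLabelledTriple u v w Q) {s : MarkovFraction}
    (hs : s = Q.x ∨ s = Q.y ∨ s = Q.z) : IsSimpleProperArc (verticalArc s.val) := by
  refine ⟨{z | z.re = s.val}, ⟨⊤, (s.val : ℝ), WithTop.top_ne_coe, rfl⟩, ?_,
    isProperMap_vertical s rfl, rfl⟩
  intro z hz z' hz'
  have hcore : ∀ z : ℍ, z.re = s.val → z ∈ Q.core := by
    intro z hz
    apply Q.mem_core_of_re
    rcases hs with rfl | rfl | rfl <;> simp [hz]
  exact h.eq_of_proj_eq (hcore z hz) (hcore z' hz')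

lemma arc_iff (h : IsLabelledTriple u v w Q) (S : Set 𝔛) :
    (IsSimpleProperArc S ∧ Disjoint S (proj '' axis Q.y.matA)) ↔ S = verticalArc Q.y.val := by
  constructor
  · rintro ⟨h1, h2⟩
    exact h.eq_verticalArc h1 h2
  · rintro rfl
    exact ⟨h.isSimpleProperArc (Or.inr (Or.inl rfl)), h.disjoint_verticalArc⟩

end IsLabelledTriple
end MarkovTorus

namespace MarkovTorus

/-! ### The ideal triangulation -/

lemma idealTriangle_rotate (u v w : WithTop ℝ) : idealTriangle v w u = idealTriangle u v w := by
  unfold idealTriangle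
  rw [Set.inter_comm, ← Set.inter_assoc]

lemma Counterclockwise.rotate {u v w : WithTop ℝ} (h : Counterclockwise u v w) :
    Counterclockwise v w u := by
  unfold Counterclockwise at *
  tauto

lemma IsComplementaryTriangle.rotate {ι : Type*} {A : ι → Set 𝔛} {u v w : WithTop ℝ}
    (h : IsComplementaryTriangle A u v w) : IsComplementaryTriangle A v w u where
  ccw := h.ccw.rotate
  inj := idealTriangle_rotate u v w ▸ h.inj
  disjoint := idealTriangle_rotate u v w ▸ h.disjoint
  side₁ := h.side₂
  side₂ := h.side₃
  side₃ := h.side₁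

lemma mem_idealTriangle_top {a b : ℝ} (hab : a < b) (p : ℍ) : p ∈ idealTriangle a b ⊤ ↔
    a < p.re ∧ p.re < b ∧ 0 < (p.re - a) * (p.re - b) + p.im ^ 2 := by
  change (0 < (b - a) * (p.re ^ 2 + p.im ^ 2 - (a + b) * p.re + a * b) ∧ p.re < b) ∧ a < p.re ↔ _
  rw [mul_pos_iff_of_pos_left (sub_pos.mpr hab),
    show p.re ^ 2 + p.im ^ 2 - (a + b) * p.re + a * b = (p.re - a) * (p.re - b) + p.im ^ 2 by ring]
  tauto

namespace MarkovQuad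

variable (Q : MarkovQuad)

/-- The three arcs over `x`, `z`, `y`. -/
noncomputable def arcs : Fin 3 → Set 𝔛 :=
  ![verticalArc Q.x.val, verticalArc Q.z.val, verticalArc Q.y.val]

lemma exists_re_of_mem_arcs {q : 𝔛} {i : Fin 3} (h : q ∈ Q.arcs i) : ∃ p ∈ Q.core, proj p = q ∧
    (p.re = ![(Q.x.val : ℝ), (Q.z.val : ℝ), (Q.y.val : ℝ)] i) := by
  fin_cases i <;> obtain ⟨p, hp, rfl⟩ := h
  · exact ⟨p, Q.mem_core_of_re (Or.inl hp), rfl, hp⟩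
  · exact ⟨p, Q.mem_core_of_re (Or.inr (Or.inr hp)), rfl, hp⟩
  · exact ⟨p, Q.mem_core_of_re (Or.inr (Or.inl hp)), rfl, hp⟩

lemma val_lt_real : (Q.x.val : ℝ) < Q.y.val ∧ (Q.y.val : ℝ) < Q.z.val :=
  ⟨by exact_mod_cast Q.val_lt_xy, by exact_mod_cast Q.val_lt_yz⟩

lemma mem_core_of_mem_left {p : ℍ} (h : p ∈ idealTriangle (Q.x.val : ℝ) (Q.y.val : ℝ) ⊤) :
    p ∈ Q.core := by
  obtain ⟨h1, h2⟩ := Q.val_lt_real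
  obtain ⟨h3, h4, h5⟩ := (mem_idealTriangle_top h1 p).mp h
  refine (Q.mem_core' p).mpr ⟨h3.le, by linarith, h5, ?_⟩
  have := mul_pos_of_neg_of_neg (sub_neg.mpr h4) (sub_neg.mpr (h4.trans h2))
  positivity

lemma mem_core_of_mem_right {p : ℍ} (h : p ∈ idealTriangle (Q.y.val : ℝ) (Q.z.val : ℝ) ⊤) :
    p ∈ Q.core := by
  obtain ⟨h1, h2⟩ := Q.val_lt_real
  obtain ⟨h3, h4, h5⟩ := (mem_idealTriangle_top h2 p).mp h
  refine (Q.mem_core' p).mpr ⟨by linarith, h4.le, ?_, h5⟩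
  have := mul_pos (sub_pos.mpr h3) (sub_pos.mpr (h1.trans h3))
  have := pow_pos p.im_pos 2
  linarith

/-- The two triangles and the three lines fill the core. -/
lemma mem_triangle_of_mem_core {p : ℍ} (h : p ∈ Q.core) (hx : p.re ≠ Q.x.val) (hy : p.re ≠ Q.y.val)
    (hz : p.re ≠ Q.z.val) : p ∈ idealTriangle (Q.x.val : ℝ) (Q.y.val : ℝ) ⊤ ∨
      p ∈ idealTriangle (Q.y.val : ℝ) (Q.z.val : ℝ) ⊤ := by
  obtain ⟨h1, h2⟩ := Q.val_lt_real
  obtain ⟨h3, h4, h5, h6⟩ := (Q.mem_core' p).mp h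
  rw [mem_idealTriangle_top h1, mem_idealTriangle_top h2]
  rcases lt_or_gt_of_ne hy with h7 | h7
  · exact Or.inl ⟨lt_of_le_of_ne h3 hx.symm, h7, h5⟩
  · exact Or.inr ⟨h7, lt_of_le_of_ne h4 hz, h6⟩

end MarkovQuad

lemma act_toVec_val {s : MarkovFraction} {g : SL(2, ℤ)} {V : ℝ × ℝ} (h : act g s.vec = V) :
    act g (toVec (s.val : ℝ)) = (s.n : ℝ)⁻¹ • V := by
  rw [← h, s.vec_eq, act_smul, smul_smul, inv_mul_cancel₀ s.n_pos_real.ne', one_smul]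
  rfl

namespace IsLabelledTriple

variable {u v w : Vertex} {Q : MarkovQuad}

lemma proj_geodesic_left (h : IsLabelledTriple u v w Q) :
    proj '' geodesic (Q.x.val : ℝ) (Q.y.val : ℝ) = verticalArc Q.z.val := by
  have hx := Q.x.n_pos_real.ne'
  have hy := Q.y.n_pos_real.ne'
  have hz := Q.z.n_pos_real.ne'
  have h1 : act Q.A (toVec (Q.x.val : ℝ)) = (-(Q.x.n : ℝ)⁻¹) • toVec ⊤ := by
    rw [act_toVec_val Q.act_A_x, toVec_top]; ext <;> simp
  have h2 : act Q.A (toVec (Q.y.val : ℝ)) = ((Q.y.n : ℝ)⁻¹ * Q.z.n) • toVec (Q.z.val : ℝ) := by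
    rw [act_toVec_val Q.act_A_y, Q.z.vec_eq, smul_smul]; rfl
  exact (proj_image_smul h.A_mem
    (smul_mem_geodesic (neg_ne_zero.mpr (inv_ne_zero hx)) (by positivity) h1 h2)).symm

lemma proj_geodesic_right (h : IsLabelledTriple u v w Q) :
    proj '' geodesic (Q.y.val : ℝ) (Q.z.val : ℝ) = verticalArc Q.x.val := by
  have hx := Q.x.n_pos_real.ne'
  have hy := Q.y.n_pos_real.ne'
  have hz := Q.z.n_pos_real.ne'
  have h1 : act Q.B (toVec (Q.z.val : ℝ)) = (Q.z.n : ℝ)⁻¹ • toVec ⊤ := by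
    rw [act_toVec_val Q.act_B_z, toVec_top]
  have h2 : act Q.B (toVec (Q.y.val : ℝ)) = ((Q.y.n : ℝ)⁻¹ * Q.x.n) • toVec (Q.x.val : ℝ) := by
    rw [act_toVec_val Q.act_B_y, Q.x.vec_eq, smul_smul]; rfl
  rw [geodesic_comm]
  exact (proj_image_smul h.B_mem
    (smul_mem_geodesic (inv_ne_zero hz) (by positivity) h1 h2)).symm

/-- A point of the core off the three lines is not on the arcs. -/
lemma disjoint_arcs_of_re (h : IsLabelledTriple u v w Q) {p : ℍ} (hp : p ∈ Q.core)
    (hx : p.re ≠ Q.x.val) (hy : p.re ≠ Q.y.val) (hz : p.re ≠ Q.z.val) (i : Fin 3) :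
    proj p ∉ Q.arcs i := by
  intro hi
  obtain ⟨p', hp', he, hre⟩ := Q.exists_re_of_mem_arcs hi
  obtain rfl := h.eq_of_proj_eq hp' hp he
  fin_cases i
  · exact hx hre
  · exact hz hre
  · exact hy hre

lemma left_isComplementaryTriangle (h : IsLabelledTriple u v w Q) :
    IsComplementaryTriangle Q.arcs (Q.x.val : ℝ) (Q.y.val : ℝ) ⊤ where
  ccw := Or.inl ⟨by exact_mod_cast Q.val_lt_real.1, WithTop.coe_lt_top _⟩
  inj _ hp _ hp' := h.eq_of_proj_eq (Q.mem_core_of_mem_left hp) (Q.mem_core_of_mem_left hp')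
  disjoint i := by
    rw [Set.disjoint_left]
    rintro _ ⟨p, hp, rfl⟩
    obtain ⟨h1, h2, -⟩ := (mem_idealTriangle_top Q.val_lt_real.1 p).mp hp
    exact h.disjoint_arcs_of_re (Q.mem_core_of_mem_left hp) h1.ne' h2.ne
      (h2.trans Q.val_lt_real.2).ne i
  side₁ := ⟨1, h.proj_geodesic_left⟩
  side₂ := ⟨2, rfl⟩
  side₃ := ⟨0, rfl⟩

lemma right_isComplementaryTriangle (h : IsLabelledTriple u v w Q) :
    IsComplementaryTriangle Q.arcs (Q.y.val : ℝ) (Q.z.val : ℝ) ⊤ where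
  ccw := Or.inl ⟨by exact_mod_cast Q.val_lt_real.2, WithTop.coe_lt_top _⟩
  inj _ hp _ hp' := h.eq_of_proj_eq (Q.mem_core_of_mem_right hp) (Q.mem_core_of_mem_right hp')
  disjoint i := by
    rw [Set.disjoint_left]
    rintro _ ⟨p, hp, rfl⟩
    obtain ⟨h1, h2, -⟩ := (mem_idealTriangle_top Q.val_lt_real.2 p).mp hp
    exact h.disjoint_arcs_of_re (Q.mem_core_of_mem_right hp) (Q.val_lt_real.1.trans h1).ne' h1.ne'
      h2.ne i
  side₁ := ⟨0, h.proj_geodesic_right⟩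
  side₂ := ⟨1, rfl⟩
  side₃ := ⟨2, rfl⟩

/-- A point off the three arcs lifts to one of the two triangles. -/
lemma exists_triangle (h : IsLabelledTriple u v w Q) (p : ℍ) (hp : ∀ i, proj p ∉ Q.arcs i) :
    ∃ g ∈ Γ, g • p ∈ idealTriangle (Q.x.val : ℝ) (Q.y.val : ℝ) ⊤ ∨
      g • p ∈ idealTriangle (Q.y.val : ℝ) (Q.z.val : ℝ) ⊤ := by
  obtain ⟨g, hg, hgp⟩ := h.cover p
  refine ⟨g, hg, Q.mem_triangle_of_mem_core hgp ?_ ?_ ?_⟩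
  · exact fun h1 => hp 0 ⟨_, h1, proj_smul hg p⟩
  · exact fun h1 => hp 2 ⟨_, h1, proj_smul hg p⟩
  · exact fun h1 => hp 1 ⟨_, h1, proj_smul hg p⟩

lemma isIdealTriangulation (h : IsLabelledTriple u v w Q) : IsIdealTriangulation Q.arcs where
  arc i := by
    fin_cases i
    · exact h.isSimpleProperArc (Or.inl rfl)
    · exact h.isSimpleProperArc (Or.inr (Or.inr rfl))
    · exact h.isSimpleProperArc (Or.inr (Or.inl rfl))
  disjoint i j hij := by
    rw [Set.disjoint_left]
    intro q hi hj
    obtain ⟨p, hp, rfl, hre⟩ := Q.exists_re_of_mem_arcs hi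
    obtain ⟨p', hp', he, hre'⟩ := Q.exists_re_of_mem_arcs hj
    obtain rfl := h.eq_of_proj_eq hp' hp he
    rw [hre] at hre'
    have h1 := Q.val_lt_real
    fin_cases i <;> fin_cases j <;> simp at hij hre' <;> norm_cast at h1 <;>
      linarith [h1.1, h1.2]
  triangle q hq := by
    obtain ⟨p, rfl⟩ := Quotient.exists_rep q
    obtain ⟨g, hg, h1 | h1⟩ := h.exists_triangle p hq
    · exact ⟨_, _, _, h.left_isComplementaryTriangle, _, h1, proj_smul hg p⟩
    · exact ⟨_, _, _, h.right_isComplementaryTriangle, _, h1, proj_smul hg p⟩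

end IsLabelledTriple
end MarkovTorus

namespace MarkovTorus

/-! ### Complementary triangles -/

lemma Counterclockwise.ne {u v w : WithTop ℝ} (h : Counterclockwise u v w) : u ≠ v := by
  rintro rfl
  have := (counterclockwise_iff u u w).mp h
  simp [wedge, mul_comm] at this

/-- In the coordinates `re z`, `|z|²` the half-planes are affine. -/
lemma exists_segment (p q : ℍ) {t : ℝ} (h0 : 0 ≤ t) (h1 : t ≤ 1) :
    ∃ r : ℍ, ∀ U V, qf U V r = (1 - t) * qf U V p + t * qf U V q := by
  set x := (1 - t) * p.re + t * q.re with hx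
  set y := (1 - t) * (p.re ^ 2 + p.im ^ 2) + t * (q.re ^ 2 + q.im ^ 2) - x ^ 2 with hy
  have hpos : 0 < y := by
    have e : y = (1 - t) * p.im ^ 2 + t * q.im ^ 2 + t * (1 - t) * (p.re - q.re) ^ 2 := by
      rw [hy, hx]; ring
    have h2 : 0 ≤ t * (1 - t) * (p.re - q.re) ^ 2 :=
      mul_nonneg (mul_nonneg h0 (sub_nonneg.mpr h1)) (sq_nonneg _)
    have hp := pow_pos p.im_pos 2
    have hq := pow_pos q.im_pos 2
    rw [e]
    rcases h0.eq_or_lt with rfl | h0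
    · simpa using hp
    · have := mul_pos h0 hq
      have := mul_nonneg (sub_nonneg.mpr h1) hp.le
      linarith
  refine ⟨⟨⟨x, √y⟩, Real.sqrt_pos.mpr hpos⟩, fun U V => ?_⟩
  change U.2 * V.2 * (x ^ 2 + √y ^ 2) - (U.1 * V.2 + U.2 * V.1) * x + U.1 * V.1 = _
  rw [Real.sq_sqrt hpos.le, hy, hx]
  simp only [qf]
  ring

/-- The form that is positive to the left of the geodesic from `u` to `v`. -/
noncomputable def leftForm (u v : WithTop ℝ) (z : ℍ) : ℝ :=
  wedge (toVec u) (toVec v) * qf (toVec u) (toVec v) z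

lemma exists_segment_leftForm (p q : ℍ) {t : ℝ} (h0 : 0 ≤ t) (h1 : t ≤ 1) :
    ∃ r : ℍ, ∀ u v, leftForm u v r = (1 - t) * leftForm u v p + t * leftForm u v q := by
  obtain ⟨r, hr⟩ := exists_segment p q h0 h1
  exact ⟨r, fun u v => by simp only [leftForm, hr]; ring⟩

lemma mem_idealTriangle {u v w : WithTop ℝ} {z : ℍ} : z ∈ idealTriangle u v w ↔
    0 < leftForm u v z ∧ 0 < leftForm v w z ∧ 0 < leftForm w u z := by
  simp only [idealTriangle, Set.mem_inter_iff, mem_leftSide, leftForm]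
  tauto

lemma leftForm_eq_zero {u v : WithTop ℝ} (h : u ≠ v) {z : ℍ} :
    leftForm u v z = 0 ↔ z ∈ geodesic u v := by
  rw [leftForm, mul_eq_zero, wedge_toVec_eq_zero, mem_geodesic, or_iff_right h]

lemma qf_self_pos (u : WithTop ℝ) (z : ℍ) : 0 < qf (toVec u) (toVec u) z := by
  have := pow_pos z.im_pos 2
  cases u using WithTop.recTopCoe with
  | top => simp [qf, toVec]
  | coe u =>
    simp only [qf, toVec]
    nlinarith [sq_nonneg (z.re - u)]

/-- A side of an ideal triangle lies to the left of the next side. -/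
lemma leftForm_next_pos {u v w : WithTop ℝ} (h : Counterclockwise u v w) {z : ℍ}
    (hz : z ∈ geodesic u v) : 0 < leftForm v w z := by
  have hc := (counterclockwise_iff u v w).mp h
  rw [mem_geodesic] at hz
  have hv := qf_self_pos v z
  have e : leftForm v w z * wedge (toVec u) (toVec v) ^ 2 =
      -(wedge (toVec u) (toVec v) * wedge (toVec v) (toVec w) * wedge (toVec w) (toVec u)) *
        qf (toVec v) (toVec v) z - wedge (toVec v) (toVec w) ^ 2 * wedge (toVec u) (toVec v) *
        qf (toVec u) (toVec v) z := by
    simp only [leftForm, qf, wedge]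
    ring
  rw [hz, mul_zero, sub_zero] at e
  have h1 : 0 < leftForm v w z * wedge (toVec u) (toVec v) ^ 2 := by
    rw [e]; exact mul_pos (neg_pos.mpr hc) hv
  exact pos_of_mul_pos_left h1 (sq_nonneg _)

lemma leftForm_prev_pos {u v w : WithTop ℝ} (h : Counterclockwise u v w) {z : ℍ}
    (hz : z ∈ geodesic u v) : 0 < leftForm w u z := by
  have hc := (counterclockwise_iff u v w).mp h
  rw [mem_geodesic] at hz
  have hv := qf_self_pos u z
  have e : leftForm w u z * wedge (toVec u) (toVec v) ^ 2 =
      -(wedge (toVec u) (toVec v) * wedge (toVec v) (toVec w) * wedge (toVec w) (toVec u)) *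
        qf (toVec u) (toVec u) z - wedge (toVec w) (toVec u) ^ 2 * wedge (toVec u) (toVec v) *
        qf (toVec u) (toVec v) z := by
    simp only [leftForm, qf, wedge]
    ring
  rw [hz, mul_zero, sub_zero] at e
  have h1 : 0 < leftForm w u z * wedge (toVec u) (toVec v) ^ 2 := by
    rw [e]; exact mul_pos (neg_pos.mpr hc) hv
  exact pos_of_mul_pos_left h1 (sq_nonneg _)

lemma idealTriangle_nonempty {u v w : WithTop ℝ} (h : Counterclockwise u v w) :
    (idealTriangle u v w).Nonempty := by
  obtain ⟨p, hp⟩ := (geodesic_infinite h.ne).nonempty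
  obtain ⟨q, hq⟩ := (geodesic_infinite h.rotate.ne).nonempty
  obtain ⟨r, hr⟩ := exists_segment_leftForm p q (t := 1 / 2) (by norm_num) (by norm_num)
  refine ⟨r, mem_idealTriangle.mpr ?_⟩
  have h1 := (leftForm_eq_zero h.ne).mpr hp
  have h2 := leftForm_next_pos h hp
  have h3 := leftForm_prev_pos h hp
  have h4 := (leftForm_eq_zero h.rotate.ne).mpr hq
  have h5 := leftForm_next_pos h.rotate hq
  have h6 := leftForm_prev_pos h.rotate hq
  rw [hr, hr, hr]
  refine ⟨?_, ?_, ?_⟩ <;> linarith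

section

variable {ι : Type*} {A : ι → Set 𝔛} {u v w a b c : WithTop ℝ}

/-- A complementary triangle that meets the left of a geodesic over an arc lies to the left. -/
lemma IsComplementaryTriangle.leftForm_pos (h : IsComplementaryTriangle A u v w) (hab : a ≠ b)
    (hs : ∃ i, proj '' geodesic a b = A i) {p q : ℍ} (hp : p ∈ idealTriangle u v w)
    (hq : q ∈ idealTriangle u v w) (hpos : 0 < leftForm a b p) : 0 < leftForm a b q := by
  by_contra! hneg
  obtain ⟨i, hi⟩ := hs
  set t := leftForm a b p / (leftForm a b p - leftForm a b q) with ht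
  have hd : 0 < leftForm a b p - leftForm a b q := by linarith
  have h0 : 0 < t := div_pos hpos hd
  have h1 : t ≤ 1 := (div_le_one hd).mpr (by linarith)
  obtain ⟨r, hr⟩ := exists_segment_leftForm p q h0.le h1
  have hr0 : leftForm a b r = 0 := by
    rw [hr, ht]
    field_simp
    ring
  rw [mem_idealTriangle] at hp hq
  have conv : ∀ x y : WithTop ℝ, 0 < leftForm x y p → 0 < leftForm x y q → 0 < leftForm x y r := by
    intro x y hx hy
    rw [hr]
    have := mul_pos h0 hy
    have := mul_nonneg (sub_nonneg.mpr h1) hx.le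
    linarith
  have hrT : r ∈ idealTriangle u v w := mem_idealTriangle.mpr
    ⟨conv _ _ hp.1 hq.1, conv _ _ hp.2.1 hq.2.1, conv _ _ hp.2.2 hq.2.2⟩
  refine Set.disjoint_left.mp (h.disjoint i) ⟨r, hrT, rfl⟩ ?_
  rw [← hi]
  exact ⟨r, (leftForm_eq_zero hab).mp hr0, rfl⟩

lemma IsComplementaryTriangle.subset (h : IsComplementaryTriangle A u v w)
    (h' : IsComplementaryTriangle A a b c) {p : ℍ} (hp : p ∈ idealTriangle u v w)
    (hp' : p ∈ idealTriangle a b c) : idealTriangle u v w ⊆ idealTriangle a b c := by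
  intro q hq
  rw [mem_idealTriangle] at hp' ⊢
  exact ⟨h.leftForm_pos h'.ccw.ne h'.side₁ hp hq hp'.1,
    h.leftForm_pos h'.ccw.rotate.ne h'.side₂ hp hq hp'.2.1,
    h.leftForm_pos h'.ccw.rotate.rotate.ne h'.side₃ hp hq hp'.2.2⟩

/-- A side of a complementary triangle is a side of every complementary triangle that it meets. -/
lemma IsComplementaryTriangle.side_eq (h : IsComplementaryTriangle A u v w)
    (h' : IsComplementaryTriangle A a b c) {p : ℍ} (hp : p ∈ idealTriangle u v w)
    (hp' : p ∈ idealTriangle a b c) : (u = a ∧ v = b) ∨ (u = b ∧ v = c) ∨ (u = c ∧ v = a) := by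
  have hpT := mem_idealTriangle.mp hp
  have hpS := mem_idealTriangle.mp hp'
  -- the side lies in the closure of the second triangle
  have hnn : ∀ x y : WithTop ℝ, (∀ q ∈ idealTriangle u v w, 0 < leftForm x y q) →
      ∀ z ∈ geodesic u v, 0 ≤ leftForm x y z := by
    intro x y hxy z hz
    by_contra! hneg
    have hp0 := hxy p hp
    have hd : 0 < leftForm x y p - leftForm x y z := by linarith
    set t := leftForm x y p / (leftForm x y p - leftForm x y z) with ht
    have h0 : 0 < t := div_pos hp0 hd
    have h1 : t < 1 := (div_lt_one hd).mpr (by linarith)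
    obtain ⟨r, hr⟩ := exists_segment_leftForm p z h0.le h1.le
    have hr0 : leftForm x y r = 0 := by
      rw [hr, ht]
      field_simp
      ring
    have hrT : r ∈ idealTriangle u v w := by
      have e1 := (leftForm_eq_zero h.ccw.ne).mpr hz
      have e2 := mul_pos h0 (leftForm_next_pos h.ccw hz)
      have e3 := mul_pos h0 (leftForm_prev_pos h.ccw hz)
      have hs := sub_pos.mpr h1
      have f1 := mul_pos hs hpT.1
      have f2 := mul_pos hs hpT.2.1
      have f3 := mul_pos hs hpT.2.2
      rw [mem_idealTriangle, hr, hr, hr, e1]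
      refine ⟨?_, ?_, ?_⟩ <;> linarith
    exact (hxy r hrT).ne' hr0
  have hsub := h.subset h' hp hp'
  have hcov : geodesic u v ⊆ geodesic a b ∪ geodesic b c ∪ geodesic c a := by
    intro z hz
    by_contra hcon
    simp only [Set.mem_union, not_or] at hcon
    have k1 := hnn a b (fun q hq => (mem_idealTriangle.mp (hsub hq)).1) z hz
    have k2 := hnn b c (fun q hq => (mem_idealTriangle.mp (hsub hq)).2.1) z hz
    have k3 := hnn c a (fun q hq => (mem_idealTriangle.mp (hsub hq)).2.2) z hz
    have l1 := mt (leftForm_eq_zero h'.ccw.ne).mp hcon.1.1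
    have l2 := mt (leftForm_eq_zero h'.ccw.rotate.ne).mp hcon.1.2
    have l3 := mt (leftForm_eq_zero h'.ccw.rotate.rotate.ne).mp hcon.2
    obtain ⟨i, hi⟩ := h.side₁
    refine Set.disjoint_left.mp (h'.disjoint i) ⟨z, mem_idealTriangle.mpr
      ⟨lt_of_le_of_ne k1 (Ne.symm l1), lt_of_le_of_ne k2 (Ne.symm l2),
        lt_of_le_of_ne k3 (Ne.symm l3)⟩, rfl⟩ ?_
    rw [← hi]
    exact ⟨z, hz, rfl⟩
  have orient : ∀ x y : WithTop ℝ, x ≠ y → 0 < leftForm x y p →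
      (geodesic u v ∩ geodesic x y).Infinite → u = x ∧ v = y := by
    intro x y hxy hpos hinf
    obtain ⟨z₁, hz₁, z₂, hz₂, hne⟩ := hinf.nontrivial
    rcases endpoints_eq h.ccw.ne hne hz₁.2 hz₂.2 hz₁.1 hz₂.1 with e | ⟨rfl, rfl⟩
    · exact e
    · have := hpT.1
      rw [leftForm, wedge_swap, qf_comm] at this
      rw [leftForm] at hpos
      linarith
  have hinf := geodesic_infinite h.ccw.ne
  rw [← Set.inter_eq_left.mpr hcov, Set.inter_union_distrib_left, Set.inter_union_distrib_left,
    Set.infinite_union, Set.infinite_union] at hinf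
  rcases hinf with (hinf | hinf) | hinf
  · exact Or.inl (orient _ _ h'.ccw.ne hpS.1 hinf)
  · exact Or.inr (Or.inl (orient _ _ h'.ccw.rotate.ne hpS.2.1 hinf))
  · exact Or.inr (Or.inr (orient _ _ h'.ccw.rotate.rotate.ne hpS.2.2 hinf))

lemma IsComplementaryTriangle.eq_rotation (h : IsComplementaryTriangle A u v w)
    (h' : IsComplementaryTriangle A a b c) {p : ℍ} (hp : p ∈ idealTriangle u v w)
    (hp' : p ∈ idealTriangle a b c) : (u = a ∧ v = b ∧ w = c) ∨ (u = b ∧ v = c ∧ w = a) ∨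
      (u = c ∧ v = a ∧ w = b) := by
  have h1 := h.side_eq h' hp hp'
  have h2 := h.rotate.side_eq h' (idealTriangle_rotate u v w ▸ hp) hp'
  have n1 := h'.ccw.ne
  have n2 := h'.ccw.rotate.ne
  have n3 := h'.ccw.rotate.rotate.ne
  rcases h1 with ⟨rfl, rfl⟩ | ⟨rfl, rfl⟩ | ⟨rfl, rfl⟩ <;>
    rcases h2 with ⟨e, rfl⟩ | ⟨e, rfl⟩ | ⟨e, rfl⟩ <;> simp_all

/-- The translate of a complementary triangle by an element of `Γ`. -/
lemma IsComplementaryTriangle.exists_smul (h : IsComplementaryTriangle A u v w) {g : SL(2, ℤ)}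
    (hg : g ∈ Γ) : ∃ u' v' w', IsComplementaryTriangle A u' v' w' ∧
      (∀ z, g • z ∈ idealTriangle u' v' w' ↔ z ∈ idealTriangle u v w) ∧
      proj '' geodesic u' v' = proj '' geodesic u v ∧
      proj '' geodesic v' w' = proj '' geodesic v w ∧
      proj '' geodesic w' u' = proj '' geodesic w u := by
  obtain ⟨u', c, hc, hu⟩ := exists_boundary_smul g u
  obtain ⟨v', d, hd, hv⟩ := exists_boundary_smul g v
  obtain ⟨w', e, he, hw⟩ := exists_boundary_smul g w
  have s1 := proj_image_smul hg (smul_mem_geodesic hc hd hu hv)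
  have s2 := proj_image_smul hg (smul_mem_geodesic hd he hv hw)
  have s3 := proj_image_smul hg (smul_mem_geodesic he hc hw hu)
  have hT : ∀ z, g • z ∈ idealTriangle u' v' w' ↔ z ∈ idealTriangle u v w := by
    intro z
    simp only [idealTriangle, Set.mem_inter_iff, smul_mem_leftSide hc hd hu hv,
      smul_mem_leftSide hd he hv hw, smul_mem_leftSide he hc hw hu]
  refine ⟨u', v', w', ⟨(counterclockwise_of_act hc hd he hu hv hw).mpr h.ccw, ?_, ?_, ?_, ?_, ?_⟩,
    hT, s1, s2, s3⟩
  · intro p hp q hq hpq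
    have k := h.inj ((hT (g⁻¹ • p)).mp (by simpa using hp)) ((hT (g⁻¹ • q)).mp (by simpa using hq))
      (by rw [proj_smul (inv_mem hg), proj_smul (inv_mem hg), hpq])
    exact MulAction.injective _ k
  · rw [proj_image_smul hg hT]; exact h.disjoint
  · rw [s1]; exact h.side₁
  · rw [s2]; exact h.side₂
  · rw [s3]; exact h.side₃

end

namespace IsLabelledTriple

variable {u v w : Vertex} {Q : MarkovQuad}

lemma counterclockwiseArcs (h : IsLabelledTriple u v w Q) : CounterclockwiseArcs Q.arcs := by
  intro a b c hT
  obtain ⟨p, hp⟩ := idealTriangle_nonempty hT.ccw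
  obtain ⟨g, hg, hgp⟩ := h.exists_triangle p
    (fun i hi => Set.disjoint_left.mp (hT.disjoint i) ⟨p, hp, rfl⟩ hi)
  obtain ⟨a', b', c', hT', hmem, e1, e2, e3⟩ := hT.exists_smul hg
  rw [← e1, ← e2, ← e3]
  rcases hgp with hgp | hgp
  · rcases hT'.eq_rotation h.left_isComplementaryTriangle ((hmem p).mpr hp) hgp with
      ⟨rfl, rfl, rfl⟩ | ⟨rfl, rfl, rfl⟩ | ⟨rfl, rfl, rfl⟩
    · exact ⟨1, h.proj_geodesic_left, rfl, rfl⟩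
    · exact ⟨2, rfl, rfl, h.proj_geodesic_left⟩
    · exact ⟨0, rfl, h.proj_geodesic_left, rfl⟩
  · rcases hT'.eq_rotation h.right_isComplementaryTriangle ((hmem p).mpr hp) hgp with
      ⟨rfl, rfl, rfl⟩ | ⟨rfl, rfl, rfl⟩ | ⟨rfl, rfl, rfl⟩
    · exact ⟨0, h.proj_geodesic_right, rfl, rfl⟩
    · exact ⟨1, rfl, rfl, h.proj_geodesic_right⟩
    · exact ⟨2, rfl, h.proj_geodesic_right, rfl⟩

end IsLabelledTriple
end MarkovTorus

namespace MarkovTorus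

/-! ### Labels of horoballs -/

lemma IsFractionalLabel.labelled {v : Vertex} {x : ℚ} (h : IsFractionalLabel v x) : Labelled v := by
  cases h with
  | top => exact Or.inr le_top
  | zero => exact Or.inr le_rfl
  | neg_one => exact Or.inl rfl
  | step hpos => exact Or.inr hpos.le

lemma fractionalLabel_horoball {v : Vertex} {x : ℚ} (h : IsFractionalLabel v x) :
    fractionalLabel (horoball v) = x := by
  rw [fractionalLabel, fareyLabel_horoball]
  exact (isFractionalLabel_iff h.labelled x).mp h

lemma nonneg_of_mem_horoball {r : ℚ} {z : ℍ} (hz : z ∈ horoball r) (h0 : 0 < z.re) : 0 ≤ r := by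
  by_contra! hr
  rw [mem_horoball_coe] at hz
  have hd : (1 : ℝ) ≤ r.den := by exact_mod_cast r.den_pos
  have hnum : (r.num : ℝ) ≤ -1 := by
    have := Rat.num_neg.mpr hr
    exact_mod_cast (by omega : r.num ≤ -1)
  have hr' : (r : ℝ) * r.den ≤ -1 := by
    have : (r : ℝ) * r.den = r.num := by exact_mod_cast Rat.mul_den_eq_num r
    rwa [this]
  have h1 : (1 : ℝ) ≤ (z.re - r) * r.den := by nlinarith
  have h2 : ((z.re - r) * r.den) ^ 2 + z.im ^ 2 * r.den ^ 2 < z.im := by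
    rw [lt_div_iff₀ (by positivity)] at hz
    linarith
  nlinarith [sq_nonneg (z.im - 1 / 2), sq_nonneg z.im, mul_le_mul_of_nonneg_left
    (one_le_pow₀ hd : (1 : ℝ) ≤ (r.den : ℝ) ^ 2) (sq_nonneg z.im)]

end MarkovTorus

theorem mainTheorem9 (H : Set ℍ) (hH : H ∈ horoballs) (k : ℤ) (n : ℕ) (hn : 0 < n)
    (hkn : Int.gcd k n = 1) (hlabel : fractionalLabel H = (k : ℚ) / n) :
    -- (i)
    markovLabel H = n ∧
    -- (ii)
    k ^ 2 ≡ -1 [ZMOD n] ∧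
    -- (iii)
    ((∃! C : Set 𝔛, IsSimpleClosedGeodesic (fareyLabel H) C) ∧
      ∀ C : Set 𝔛, IsSimpleClosedGeodesic (fareyLabel H) C →
        ∀ A : Set 𝔛, (IsSimpleProperArc A ∧ Disjoint A C) ↔ A = verticalArc (k / n)) ∧
    -- (iv)
    (∀ H₁ H₂ : Set ℍ, ImmediatePrecedents H₁ H₂ H →
      fractionalLabel H₁ < (k : ℚ) / n ∧ (k : ℚ) / n < fractionalLabel H₂ ∧
      IsIdealTriangulation ![verticalArc (fractionalLabel H₁), verticalArc (fractionalLabel H₂),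
        verticalArc (k / n)] ∧
      CounterclockwiseArcs ![verticalArc (fractionalLabel H₁), verticalArc (fractionalLabel H₂),
        verticalArc (k / n)]) := by
  obtain ⟨r, rfl, z, hz, h0, -⟩ := hH
  have hr := nonneg_of_mem_horoball hz h0
  obtain ⟨u, w, Q, hQ⟩ := exists_labelledTriple hr
  obtain ⟨-, hm, -⟩ := hQ.markov
  obtain ⟨hx, hy, hz⟩ := hQ.fractional
  rw [fractionalLabel_horoball hy] at hlabel
  have hk : Q.y.k = k := by
    rw [← Q.y.val_num, hlabel]
    exact Rat.num_div_eq_of_coprime (by exact_mod_cast hn) hkn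
  have hn' : Q.y.n = n := by
    rw [← Q.y.val_den, hlabel]
    exact Rat.den_div_eq_of_coprime (by exact_mod_cast hn) hkn
  rw [fareyLabel_horoball, ← hlabel]
  have hgeo := IsLabelledTriple.isSimpleClosedGeodesic_iff hr hQ
  refine ⟨?_, ?_, ⟨⟨_, (hgeo _).mpr rfl, fun C => (hgeo C).mp⟩, ?_⟩, ?_⟩
  · rw [markovLabel, fareyLabel_horoball, (isMarkovLabel_iff hy.labelled _).mp hm, hn']
  · rw [← hk, ← hn']
    exact (Int.modEq_iff_dvd.mpr ⟨Q.y.l, by linear_combination -Q.y.eq⟩).symm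
  · intro C hC A
    rw [(hgeo C).mp hC]
    exact hQ.arc_iff A
  · rintro H₁ H₂ ⟨u', v', w', rfl, hv, rfl, htri⟩
    obtain rfl := horoball_injective hv
    obtain ⟨rfl, rfl⟩ := htri.unique hQ.isFareyTriple
    rw [fractionalLabel_horoball hx, fractionalLabel_horoball hz]
    exact ⟨Q.val_lt_xy, Q.val_lt_yz, hQ.isIdealTriangulation, hQ.counterclockwiseArcs⟩
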